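/- Let $\mathcal O$ be a pair of orthogonal lines through the origin of the plane, and let $\mathcal O_\theta$ be the pair obtained by rotating both lines counterclockwise by $\theta$ around the origin. A quadrant of $\mathcal O_\theta$ is an open wedge of size $\pi/2$, with any vertex, whose two bounding rays are parallel to the lines of $\mathcal O_\theta$. For a finite point set $P$, the rectilinear convex hull $\mathcal{RH}_\theta(P)$ is the plane minus the union of all quadrants of $\mathcal O_\theta$ that contain no point of $P$. Theorem. There is a real RAM algorithm with the following property. Its input consists of $\mathcal O$ (given by a nonzero direction vector of one of its lines) and of two disjoint finite sets $R$ and $B$ of points in the plane such that no three points of $R\cup B$ lie on a line (each set listed in arbitrary order). Let $n=|R|+|B|$. The algorithm computes the (possibly empty) set of angular intervals of $\theta\in[0,2\pi)$ for which $\mathcal{RH}_\theta(B)$ is (strictly) contained in $\mathcal{RH}_\theta(R)$, that is, it lists, each exactly once and by its exact endpoints, the maximal intervals of the set $$\{\theta\in[0,2\pi) : \mathcal{RH}_\theta(B)\subseteq \operatorname{int}\mathcal{RH}_\theta(R)\}.$$ It runs in $O(n\log n)$ time and $O(n)$ space (in $O(1)$ time and space when $n\le 1$). Here the real RAM stores real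 numbers and integer indices in memory cells, all indices being smaller than the $O(n)$ bound on the memory size; it has indirect addressing, rational constants, and exact comparisons, arithmetic operations $+,-,\times,\div$ and trigonometric operations $\sin,\cos,\arctan$ on reals, each at unit cost; on indices it has comparisons, addition, subtraction and halving, each at unit cost. -/

import Mathlib

/-! ### Geometry. The plane is `ℂ`; the pair of orthogonal lines through the origin is given by a
nonzero direction vector `u` of one of them (the other line is spanned by `I * u`). -/

/-- Counterclockwise rotation of the vector `u` around the origin by the angle `θ`. -/
noncomputable def rotateBy (θ : ℝ) (u : ℂ) : ℂ :=
  Complex.exp (θ * Complex.I) * u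

/-- The open wedge of size `π / 2` with vertex `v` bounded by the rays that leave `v` in the
directions `d` and `I * d`. -/
def openQuadrant (v d : ℂ) : Set ℂ :=
  {p | ∃ s t : ℝ, 0 < s ∧ 0 < t ∧ p = v + s * d + t * (Complex.I * d)}

/-- The quadrants for the two orthogonal lines of direction `u`, `I * u` after a counterclockwise
rotation of these lines by `θ`: four of them at each vertex `v`. -/
def IsQuadrant (u : ℂ) (θ : ℝ) (q : Set ℂ) : Prop :=
  ∃ (v : ℂ) (k : Fin 4), q = openQuadrant v (rotateBy (θ + (k : ℕ) * (Real.pi / 2)) u)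

/-- The rectilinear convex hull of `P` for the lines rotated by `θ`: the plane minus the union of
all `P`-free (open) quadrants. -/
def rectHull (u : ℂ) (θ : ℝ) (P : Set ℂ) : Set ℂ :=
  Set.univ \ ⋃₀ {q | IsQuadrant u θ q ∧ q ∩ P = ∅}

/-- The angles in `[0, 2π)` at which the hull of `B` is strictly contained in that of `R`, that is,
contained in its interior. -/
def containmentAngles (u : ℂ) (R B : Set ℂ) : Set ℝ :=
  {θ | θ ∈ Set.Ico 0 (2 * Real.pi) ∧ rectHull u θ B ⊆ interior (rectHull u θ R)}

/-- No three points of `P` lie on a line. -/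
def NoThreeCollinear (P : Set ℂ) : Prop :=
  ∀ a ∈ P, ∀ b ∈ P, ∀ c ∈ P, a ≠ b → a ≠ c → b ≠ c → ¬ Collinear ℝ {a, b, c}

/-- The maximal intervals (connected components) of a set of reals. -/
def maximalIntervals (A : Set ℝ) : Set (Set ℝ) :=
  {J | ∃ θ ∈ A, J = connectedComponentIn A θ}

/-! ### The real RAM -/

namespace RealRAM

/-- The memory: scalar variables and arrays of natural numbers (indices), and scalar variables and
arrays of real numbers, each named by a natural number. `iarr a i` and `rarr a i` are the `i`th
cells of the arrays named `a`. -/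
structure State where
  ivar : ℕ → ℕ
  iarr : ℕ → ℕ → ℕ
  rvar : ℕ → ℝ
  rarr : ℕ → ℕ → ℝ

/-- Index expressions. -/
inductive IExp where
  | lit (n : ℕ)
  | var (x : ℕ)
  | get (a : ℕ) (i : IExp)
  | plus (e f : IExp)
  | minus (e f : IExp)
  | half (e : IExp)

/-- Real expressions: rational constants, memory access, arithmetic and trigonometry. -/
inductive RExp where
  | lit (q : ℚ)
  | var (x : ℕ)
  | get (a : ℕ) (i : IExp)
  | plus (e f : RExp)
  | minus (e f : RExp)
  | times (e f : RExp)
  | quot (e f : RExp)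
  | sin (e : RExp)
  | cos (e : RExp)
  | arctan (e : RExp)

/-- Tests: comparisons of indices or of reals, and Boolean combinations. -/
inductive BExp where
  | ilt (e f : IExp)
  | ieq (e f : IExp)
  | rlt (e f : RExp)
  | req (e f : RExp)
  | not (b : BExp)
  | and (b c : BExp)

/-- Programs. -/
inductive Stmt where
  | skip
  | setI (x : ℕ) (e : IExp)
  | putI (a : ℕ) (i e : IExp)
  | setR (x : ℕ) (e : RExp)
  | putR (a : ℕ) (i : IExp) (e : RExp)
  | seq (c d : Stmt)
  | cond (b : BExp) (c d : Stmt)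
  | loop (b : BExp) (c : Stmt)

/-- The value of an index expression (subtraction is truncated, `half` rounds down). -/
def IExp.eval (s : State) : IExp → ℕ
  | .lit n => n
  | .var x => s.ivar x
  | .get a i => s.iarr a (i.eval s)
  | .plus e f => e.eval s + f.eval s
  | .minus e f => e.eval s - f.eval s
  | .half e => e.eval s / 2

/-- The value of a real expression. -/
noncomputable def RExp.eval (s : State) : RExp → ℝ
  | .lit q => q
  | .var x => s.rvar x
  | .get a i => s.rarr a (i.eval s)
  | .plus e f => e.eval s + f.eval s
  | .minus e f => e.eval s - f.eval s
  | .times e f => e.eval s * f.eval s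
  | .quot e f => e.eval s / f.eval s
  | .sin e => Real.sin (e.eval s)
  | .cos e => Real.cos (e.eval s)
  | .arctan e => Real.arctan (e.eval s)

/-- The truth value of a test. -/
def BExp.eval (s : State) : BExp → Prop
  | .ilt e f => e.eval s < f.eval s
  | .ieq e f => e.eval s = f.eval s
  | .rlt e f => e.eval s < f.eval s
  | .req e f => e.eval s = f.eval s
  | .not b => ¬ b.eval s
  | .and b c => b.eval s ∧ c.eval s

/-- The evaluation does not fail on a machine whose arrays have `M` cells and whose index words
hold numbers below `M`: no array access out of bounds and no overflow. -/
def IExp.Ok (M : ℕ) (s : State) : IExp → Prop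
  | .lit n => n < M
  | .var _ => True
  | .get _ i => i.Ok M s ∧ i.eval s < M
  | .plus e f => e.Ok M s ∧ f.Ok M s ∧ e.eval s + f.eval s < M
  | .minus e f => e.Ok M s ∧ f.Ok M s
  | .half e => e.Ok M s

/-- As for index expressions; moreover there is no division by zero. -/
def RExp.Ok (M : ℕ) (s : State) : RExp → Prop
  | .lit _ => True
  | .var _ => True
  | .get _ i => i.Ok M s ∧ i.eval s < M
  | .plus e f => e.Ok M s ∧ f.Ok M s
  | .minus e f => e.Ok M s ∧ f.Ok M s
  | .times e f => e.Ok M s ∧ f.Ok M s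
  | .quot e f => e.Ok M s ∧ f.Ok M s ∧ f.eval s ≠ 0
  | .sin e => e.Ok M s
  | .cos e => e.Ok M s
  | .arctan e => e.Ok M s

/-- The test can be evaluated (conjunctions are evaluated from the left, with short circuit). -/
def BExp.Ok (M : ℕ) (s : State) : BExp → Prop
  | .ilt e f => e.Ok M s ∧ f.Ok M s
  | .ieq e f => e.Ok M s ∧ f.Ok M s
  | .rlt e f => e.Ok M s ∧ f.Ok M s
  | .req e f => e.Ok M s ∧ f.Ok M s
  | .not b => b.Ok M s
  | .and b c => b.Ok M s ∧ (b.eval s → c.Ok M s)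

/-- The number of elementary operations in an index expression. -/
def IExp.cost : IExp → ℕ
  | .lit _ => 1
  | .var _ => 1
  | .get _ i => i.cost + 1
  | .plus e f => e.cost + f.cost + 1
  | .minus e f => e.cost + f.cost + 1
  | .half e => e.cost + 1

/-- The number of elementary operations in a real expression. -/
def RExp.cost : RExp → ℕ
  | .lit _ => 1
  | .var _ => 1
  | .get _ i => i.cost + 1
  | .plus e f => e.cost + f.cost + 1
  | .minus e f => e.cost + f.cost + 1
  | .times e f => e.cost + f.cost + 1
  | .quot e f => e.cost + f.cost + 1
  | .sin e => e.cost + 1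
  | .cos e => e.cost + 1
  | .arctan e => e.cost + 1

/-- The number of elementary operations in a test. -/
def BExp.cost : BExp → ℕ
  | .ilt e f => e.cost + f.cost + 1
  | .ieq e f => e.cost + f.cost + 1
  | .rlt e f => e.cost + f.cost + 1
  | .req e f => e.cost + f.cost + 1
  | .not b => b.cost + 1
  | .and b c => b.cost + c.cost + 1

/-- Write `v` to an index variable. -/
def State.setI (s : State) (x v : ℕ) : State :=
  { s with ivar := Function.update s.ivar x v }

/-- Write `v` to a cell of an index array. -/
def State.putI (s : State) (a i v : ℕ) : State :=
  { s with iarr := Function.update s.iarr a (Function.update (s.iarr a) i v) }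

/-- Write `v` to a real variable. -/
noncomputable def State.setR (s : State) (x : ℕ) (v : ℝ) : State :=
  { s with rvar := Function.update s.rvar x v }

/-- Write `v` to a cell of a real array. -/
noncomputable def State.putR (s : State) (a i : ℕ) (v : ℝ) : State :=
  { s with rarr := Function.update s.rarr a (Function.update (s.rarr a) i v) }

/-- `Exec M c s s' t`: started in the state `s`, the program `c` halts without failure in the state
`s'` after `t` elementary steps, on a machine whose arrays have `M` cells and whose index words
hold numbers below `M`. A program names a fixed finite number of variables and arrays, so that the
space used is `O(M)` words. -/
inductive Exec (M : ℕ) : Stmt → State → State → ℕ → Prop where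
  | skip (s : State) : Exec M .skip s s 1
  | setI (s : State) (x : ℕ) (e : IExp) (he : e.Ok M s) :
      Exec M (.setI x e) s (s.setI x (e.eval s)) (e.cost + 1)
  | putI (s : State) (a : ℕ) (i e : IExp) (hi : i.Ok M s) (hM : i.eval s < M) (he : e.Ok M s) :
      Exec M (.putI a i e) s (s.putI a (i.eval s) (e.eval s)) (i.cost + e.cost + 1)
  | setR (s : State) (x : ℕ) (e : RExp) (he : e.Ok M s) :
      Exec M (.setR x e) s (s.setR x (e.eval s)) (e.cost + 1)
  | putR (s : State) (a : ℕ) (i : IExp) (e : RExp) (hi : i.Ok M s) (hM : i.eval s < M)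
      (he : e.Ok M s) :
      Exec M (.putR a i e) s (s.putR a (i.eval s) (e.eval s)) (i.cost + e.cost + 1)
  | seq {c d : Stmt} {s s' s'' : State} {t t' : ℕ} (hc : Exec M c s s' t)
      (hd : Exec M d s' s'' t') : Exec M (.seq c d) s s'' (t + t')
  | condTrue {b : BExp} {c d : Stmt} {s s' : State} {t : ℕ} (hb : b.Ok M s) (h : b.eval s)
      (hc : Exec M c s s' t) : Exec M (.cond b c d) s s' (b.cost + 1 + t)
  | condFalse {b : BExp} {c d : Stmt} {s s' : State} {t : ℕ} (hb : b.Ok M s) (h : ¬ b.eval s)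
      (hd : Exec M d s s' t) : Exec M (.cond b c d) s s' (b.cost + 1 + t)
  | loopDone {b : BExp} {c : Stmt} {s : State} (hb : b.Ok M s) (h : ¬ b.eval s) :
      Exec M (.loop b c) s s (b.cost + 1)
  | loopStep {b : BExp} {c : Stmt} {s s' s'' : State} {t t' : ℕ} (hb : b.Ok M s) (h : b.eval s)
      (hc : Exec M c s s' t) (hl : Exec M (.loop b c) s' s'' t') :
      Exec M (.loop b c) s s'' (b.cost + 1 + t + t')

end RealRAM

/-! ### Input and output -/

/-- The list `l` enumerates the finite set `P` without repetition, in some order. -/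
def Enumerates (l : List ℂ) (P : Finset ℂ) : Prop :=
  l.Nodup ∧ ∀ z, z ∈ l ↔ z ∈ P

/-- The initial memory: the index variables 0, 1 hold the numbers of red and of blue points, the
real variables 0, 1 hold the coordinates of the direction `u`, the real arrays 0, 1 hold the
coordinates of the red points and the real arrays 2, 3 those of the blue points. Everything else
is zero. -/
noncomputable def inputState (u : ℂ) (rs bs : List ℂ) : RealRAM.State where
  ivar x := if x = 0 then rs.length else if x = 1 then bs.length else 0
  iarr _ _ := 0
  rvar x := if x = 0 then u.re else if x = 1 then u.im else 0
  rarr a i :=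
    if a = 0 then (rs.getD i 0).re
    else if a = 1 then (rs.getD i 0).im
    else if a = 2 then (bs.getD i 0).re
    else if a = 3 then (bs.getD i 0).im
    else 0

/-- The `j`th interval in the output: its endpoints are the `j`th cells of the real arrays 4 and 5;
it is open if the `j`th cell of the index array 0 is zero, and otherwise it contains its left
endpoint. -/
def outputInterval (s : RealRAM.State) (j : ℕ) : Set ℝ :=
  {θ | θ < s.rarr 5 j ∧ (s.rarr 4 j < θ ∨ s.iarr 0 j ≠ 0 ∧ s.rarr 4 j = θ)}

/-- The output, whose length is in the index variable 2, lists the maximal intervals of `A`, each of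
them once. -/
def ReportsIntervals (s : RealRAM.State) (A : Set ℝ) : Prop :=
  Set.BijOn (outputInterval s) (Set.Iio (s.ivar 2)) (maximalIntervals A)

namespace RealRAM

/-! ### A program logic for the real RAM -/

/-! By `rectHull_subset_interior_iff`, strict containment at `θ` means that each of the four open
quadrants at each blue point contains a red point. A blue point lies in its own hull, so pushing it
slightly into one of its quadrants keeps it in the red hull, and that quadrant cannot be free.
Conversely, finiteness of `B` gives a blue point in each closed quadrant at a point of the blue
hull. A red point beyond it lies in the open quadrant, and still does so after small perturbations.

It remains to find the angles at which a quadrant at a blue point `b` is free of red points. Turning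
the frame by right angles reduces this to the wedge between the directions `φ` and `φ + π / 2` with
`0 ≤ φ ≤ π / 2`. As `φ` grows, a point to the left of `b` can only enter this wedge and a point to
the right can only leave it. Hence the free angles form one closed interval (`freeAngles_eq_Icc`),
whose ends come from two extreme red points, one among those to the left of `b` and one among those
to the right. With four frames and four shifts there are at most `16 n` closed intervals of blocked
angles, and by `containmentAngles_eq` the answer is the complement of their union in `[0, 2π)`.

An extreme point to the left is a point of tangency from `b` to the hull of the red points swept so
far. A left-to-right sweep keeps one convex chain of that hull. Seen from a later point, the chain
first gets more extreme and then no longer does (`IsHullChain.below_of_lt`), so binary search finds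
the tangent. The same search tells where to cut the chain when a red point is added
(`IsHullChain.push`). The points to the right are treated in the reversed frame with the opposite
orientation.

Sorting uses a tournament tree stored in an array, which needs no recursion. A last scan over the
intervals, sorted by left endpoints, emits the gaps of their union, which are the connected
components of the answer (`IsGapList.bijOn`). Sorting and binary searches cost `O(n log n)`,
everything else is linear. -/

@[simp] theorem State.setI_ivar (s : State) (x v y : ℕ) :
    (s.setI x v).ivar y = if y = x then v else s.ivar y := by
  simp [State.setI, Function.update_apply]

@[simp] theorem State.setI_iarr (s : State) (x v : ℕ) : (s.setI x v).iarr = s.iarr := rfl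

@[simp] theorem State.setI_rvar (s : State) (x v : ℕ) : (s.setI x v).rvar = s.rvar := rfl

@[simp] theorem State.setI_rarr (s : State) (x v : ℕ) : (s.setI x v).rarr = s.rarr := rfl

@[simp] theorem State.putI_ivar (s : State) (a i v : ℕ) : (s.putI a i v).ivar = s.ivar := rfl

@[simp] theorem State.putI_iarr (s : State) (a i v b : ℕ) :
    (s.putI a i v).iarr b = if b = a then Function.update (s.iarr a) i v else s.iarr b := by
  simp [State.putI, Function.update_apply]

@[simp] theorem State.putI_rvar (s : State) (a i v : ℕ) : (s.putI a i v).rvar = s.rvar := rfl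

@[simp] theorem State.putI_rarr (s : State) (a i v : ℕ) : (s.putI a i v).rarr = s.rarr := rfl

@[simp] theorem State.setR_ivar (s : State) (x : ℕ) (v : ℝ) : (s.setR x v).ivar = s.ivar := rfl

@[simp] theorem State.setR_iarr (s : State) (x : ℕ) (v : ℝ) : (s.setR x v).iarr = s.iarr := rfl

@[simp] theorem State.setR_rvar (s : State) (x : ℕ) (v : ℝ) (y : ℕ) :
    (s.setR x v).rvar y = if y = x then v else s.rvar y := by
  simp [State.setR, Function.update_apply]

@[simp] theorem State.setR_rarr (s : State) (x : ℕ) (v : ℝ) : (s.setR x v).rarr = s.rarr := rfl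

@[simp] theorem State.putR_ivar (s : State) (a i : ℕ) (v : ℝ) : (s.putR a i v).ivar = s.ivar := rfl

@[simp] theorem State.putR_iarr (s : State) (a i : ℕ) (v : ℝ) : (s.putR a i v).iarr = s.iarr := rfl

@[simp] theorem State.putR_rvar (s : State) (a i : ℕ) (v : ℝ) : (s.putR a i v).rvar = s.rvar := rfl

@[simp] theorem State.putR_rarr (s : State) (a i : ℕ) (v : ℝ) (b : ℕ) :
    (s.putR a i v).rarr b = if b = a then Function.update (s.rarr a) i v else s.rarr b := by
  simp [State.putR, Function.update_apply]

attribute [simp] IExp.eval RExp.eval BExp.eval IExp.Ok RExp.Ok BExp.Ok IExp.cost RExp.cost BExp.cost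

/-- Started in the state `s` at time `k`, the program `c` halts without failure in a state and at a
time that satisfy `Q`. -/
def Wp (M : ℕ) (c : Stmt) (Q : State → ℕ → Prop) (s : State) (k : ℕ) : Prop :=
  ∃ s' t, Exec M c s s' t ∧ Q s' (k + t)

variable {M : ℕ} {Q : State → ℕ → Prop} {s : State} {k : ℕ}

-- The rules for loop-free code are equivalences, so that `simp` can execute such code symbolically
-- and leave only arithmetic goals.
@[simp] theorem wp_skip : Wp M .skip Q s k ↔ Q s (k + 1) :=
  ⟨by rintro ⟨s', t, h, hQ⟩; cases h; exact hQ, fun h => ⟨s, 1, .skip s, h⟩⟩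

@[simp] theorem wp_setI {x : ℕ} {e : IExp} :
    Wp M (.setI x e) Q s k ↔ e.Ok M s ∧ Q (s.setI x (e.eval s)) (k + (e.cost + 1)) :=
  ⟨by rintro ⟨s', t, h, hQ⟩; cases h; exact ⟨‹_›, hQ⟩, fun h => ⟨_, _, .setI s x e h.1, h.2⟩⟩

@[simp] theorem wp_putI {a : ℕ} {i e : IExp} :
    Wp M (.putI a i e) Q s k ↔ i.Ok M s ∧ i.eval s < M ∧ e.Ok M s ∧
      Q (s.putI a (i.eval s) (e.eval s)) (k + (i.cost + e.cost + 1)) :=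
  ⟨by rintro ⟨s', t, h, hQ⟩; cases h; exact ⟨‹_›, ‹_›, ‹_›, hQ⟩,
    fun h => ⟨_, _, .putI s a i e h.1 h.2.1 h.2.2.1, h.2.2.2⟩⟩

@[simp] theorem wp_setR {x : ℕ} {e : RExp} :
    Wp M (.setR x e) Q s k ↔ e.Ok M s ∧ Q (s.setR x (e.eval s)) (k + (e.cost + 1)) :=
  ⟨by rintro ⟨s', t, h, hQ⟩; cases h; exact ⟨‹_›, hQ⟩, fun h => ⟨_, _, .setR s x e h.1, h.2⟩⟩

@[simp] theorem wp_putR {a : ℕ} {i : IExp} {e : RExp} :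
    Wp M (.putR a i e) Q s k ↔ i.Ok M s ∧ i.eval s < M ∧ e.Ok M s ∧
      Q (s.putR a (i.eval s) (e.eval s)) (k + (i.cost + e.cost + 1)) :=
  ⟨by rintro ⟨s', t, h, hQ⟩; cases h; exact ⟨‹_›, ‹_›, ‹_›, hQ⟩,
    fun h => ⟨_, _, .putR s a i e h.1 h.2.1 h.2.2.1, h.2.2.2⟩⟩

@[simp] theorem wp_seq {c d : Stmt} :
    Wp M (.seq c d) Q s k ↔ Wp M c (fun s' k' => Wp M d Q s' k') s k := by
  constructor
  · rintro ⟨s', t, h, hQ⟩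
    cases h with
    | seq hc hd => exact ⟨_, _, hc, _, _, hd, by rwa [add_assoc]⟩
  · rintro ⟨s', t, hc, s'', t', hd, hQ⟩
    exact ⟨_, _, .seq hc hd, by rwa [← add_assoc]⟩

@[simp] theorem wp_cond {b : BExp} {c d : Stmt} :
    Wp M (.cond b c d) Q s k ↔ b.Ok M s ∧ (b.eval s → Wp M c Q s (k + (b.cost + 1))) ∧
      (¬ b.eval s → Wp M d Q s (k + (b.cost + 1))) := by
  constructor
  · rintro ⟨s', t, h, hQ⟩
    cases h with
    | condTrue hb h hc => exact ⟨hb, fun _ => ⟨_, _, hc, by rwa [add_assoc]⟩, fun h' => absurd h h'⟩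
    | condFalse hb h hc => exact ⟨hb, fun h' => absurd h' h, fun _ => ⟨_, _, hc, by rwa [add_assoc]⟩⟩
  · rintro ⟨hb, h1, h2⟩
    by_cases h : b.eval s
    · obtain ⟨s', t, hc, hQ⟩ := h1 h
      exact ⟨_, _, .condTrue hb h hc, by rwa [← add_assoc]⟩
    · obtain ⟨s', t, hc, hQ⟩ := h2 h
      exact ⟨_, _, .condFalse hb h hc, by rwa [← add_assoc]⟩

theorem Wp.mono {c : Stmt} {Q' : State → ℕ → Prop} (h : Wp M c Q s k)
    (hQ : ∀ s' k', Q s' k' → Q' s' k') : Wp M c Q' s k := by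
  obtain ⟨s', t, he, hq⟩ := h
  exact ⟨s', t, he, hQ _ _ hq⟩

/-- The program does not write to the index variable `x`. -/
def Stmt.keepsI (x : ℕ) : Stmt → Bool
  | .setI y _ => y != x
  | .seq c d => c.keepsI x && d.keepsI x
  | .cond _ c d => c.keepsI x && d.keepsI x
  | .loop _ c => c.keepsI x
  | _ => true

/-- The program does not write to the index array `a`. -/
def Stmt.keepsIA (a : ℕ) : Stmt → Bool
  | .putI b _ _ => b != a
  | .seq c d => c.keepsIA a && d.keepsIA a
  | .cond _ c d => c.keepsIA a && d.keepsIA a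
  | .loop _ c => c.keepsIA a
  | _ => true

/-- The program does not write to the real variable `x`. -/
def Stmt.keepsR (x : ℕ) : Stmt → Bool
  | .setR y _ => y != x
  | .seq c d => c.keepsR x && d.keepsR x
  | .cond _ c d => c.keepsR x && d.keepsR x
  | .loop _ c => c.keepsR x
  | _ => true

/-- The program does not write to the real array `a`. -/
def Stmt.keepsRA (a : ℕ) : Stmt → Bool
  | .putR b _ _ => b != a
  | .seq c d => c.keepsRA a && d.keepsRA a
  | .cond _ c d => c.keepsRA a && d.keepsRA a
  | .loop _ c => c.keepsRA a
  | _ => true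

/-- The states `s` and `s'` agree on everything that `c` does not write to. -/
structure Frame (c : Stmt) (s s' : State) : Prop where
  ivar : ∀ x, c.keepsI x = true → s'.ivar x = s.ivar x
  iarr : ∀ a, c.keepsIA a = true → s'.iarr a = s.iarr a
  rvar : ∀ x, c.keepsR x = true → s'.rvar x = s.rvar x
  rarr : ∀ a, c.keepsRA a = true → s'.rarr a = s.rarr a

theorem Frame.refl (c : Stmt) (s : State) : Frame c s s :=
  ⟨fun _ _ => rfl, fun _ _ => rfl, fun _ _ => rfl, fun _ _ => rfl⟩

theorem Frame.trans {c : Stmt} {s s' s'' : State} (h : Frame c s s') (h' : Frame c s' s'') :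
    Frame c s s'' :=
  ⟨fun x hx => (h'.ivar x hx).trans (h.ivar x hx), fun x hx => (h'.iarr x hx).trans (h.iarr x hx),
    fun x hx => (h'.rvar x hx).trans (h.rvar x hx), fun x hx => (h'.rarr x hx).trans (h.rarr x hx)⟩

/-- Which names a program writes to is decided by computation, so facts about untouched memory
follow by `rfl` and need not be carried in invariants. -/
theorem Exec.frame {c : Stmt} {s s' : State} {t : ℕ} (h : Exec M c s s' t) : Frame c s s' := by
  induction h with
  | skip | loopDone => exact Frame.refl _ _
  | setI | putI | setR | putR =>
    constructor <;> intro x hx <;>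
      simp only [Stmt.keepsI, Stmt.keepsIA, Stmt.keepsR, Stmt.keepsRA, bne_iff_ne, ne_eq] at hx <;>
      simp [eq_comm, hx]
  | seq _ _ ih ih' =>
    constructor <;> intro x hx <;>
      simp only [Stmt.keepsI, Stmt.keepsIA, Stmt.keepsR, Stmt.keepsRA, Bool.and_eq_true] at hx
    exacts [(ih'.ivar x hx.2).trans (ih.ivar x hx.1), (ih'.iarr x hx.2).trans (ih.iarr x hx.1),
      (ih'.rvar x hx.2).trans (ih.rvar x hx.1), (ih'.rarr x hx.2).trans (ih.rarr x hx.1)]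
  | condTrue _ _ _ ih =>
    constructor <;> intro x hx <;>
      simp only [Stmt.keepsI, Stmt.keepsIA, Stmt.keepsR, Stmt.keepsRA, Bool.and_eq_true] at hx
    exacts [ih.ivar x hx.1, ih.iarr x hx.1, ih.rvar x hx.1, ih.rarr x hx.1]
  | condFalse _ _ _ ih =>
    constructor <;> intro x hx <;>
      simp only [Stmt.keepsI, Stmt.keepsIA, Stmt.keepsR, Stmt.keepsRA, Bool.and_eq_true] at hx
    exacts [ih.ivar x hx.2, ih.iarr x hx.2, ih.rvar x hx.2, ih.rarr x hx.2]
  | loopStep _ _ _ _ ih ih' =>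
    exact Frame.trans ⟨ih.ivar, ih.iarr, ih.rvar, ih.rarr⟩ ih'

theorem Wp.frame {c : Stmt} (h : Wp M c Q s k) :
    Wp M c (fun s' k' => Q s' k' ∧ Frame c s s') s k := by
  obtain ⟨s', t, he, hq⟩ := h
  exact ⟨s', t, he, hq, he.frame⟩

/-- Total correctness of a loop with invariant `I` and variant `μ`. -/
theorem Wp.loop {b : BExp} {c : Stmt} (I : State → ℕ → Prop) (μ : State → ℕ) (hI : I s k)
    (h : ∀ s' k', Frame c s s' → I s' k' → b.Ok M s' ∧
      (b.eval s' → Wp M c (fun s'' k'' => I s'' k'' ∧ μ s'' < μ s') s' (k' + (b.cost + 1))) ∧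
      (¬ b.eval s' → Q s' (k' + (b.cost + 1)))) : Wp M (.loop b c) Q s k := by
  -- The frame relation to the initial state is added to the invariant, hence every iteration may
  -- use it.
  suffices H : ∀ n s' k', μ s' = n → Frame c s s' → I s' k' → Wp M (.loop b c) Q s' k' from
    H _ s k rfl (Frame.refl _ _) hI
  intro n
  induction n using Nat.strong_induction_on with
  | _ n ih =>
    intro s' k' hn hF hI'
    obtain ⟨hok, ht, hf⟩ := h s' k' hF hI'
    by_cases hb : b.eval s'
    · obtain ⟨s₁, t₁, he, hI₁, hμ⟩ := ht hb
      obtain ⟨s₂, t₂, he₂, hQ₂⟩ := ih _ (hn ▸ hμ) s₁ _ rfl (hF.trans he.frame) hI₁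
      exact ⟨s₂, _, .loopStep hok hb he he₂, by simpa only [add_assoc] using hQ₂⟩
    · exact ⟨s', _, .loopDone hok hb, hf hb⟩

/-! ### Sorting with a tournament tree -/

/-- The lexicographic order by increasing `X` and decreasing `Y`. -/
def LexLess (X Y : ℕ → ℝ) (i j : ℕ) : Prop :=
  X i < X j ∨ X i = X j ∧ Y j < Y i

theorem LexLess.trans_not {X Y : ℕ → ℝ} {i j l : ℕ} (h : ¬ LexLess X Y i j)
    (h' : ¬ LexLess X Y j l) : ¬ LexLess X Y i l := by
  unfold LexLess at *
  push Not at *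
  refine ⟨h'.1.trans h.1, fun e => ?_⟩
  have h1 := h.1
  have h2 := h'.1
  exact (h.2 (by linarith)).trans (h'.2 (by linarith))

theorem LexLess.not_refl {X Y : ℕ → ℝ} {i : ℕ} : ¬ LexLess X Y i i := by
  simp [LexLess]

theorem LexLess.asymm {X Y : ℕ → ℝ} {i j : ℕ} (h : LexLess X Y i j) : ¬ LexLess X Y j i := by
  unfold LexLess at *
  rcases h with h | h
  · rintro (h' | h')
    · linarith
    · linarith [h'.1]
  · rintro (h' | h')
    · linarith [h.1]
    · linarith [h.2, h'.2]

/-- The function `σ` lists the numbers below `N`, each once, in increasing order. -/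
structure IsSorting (X Y : ℕ → ℝ) (N : ℕ) (σ : ℕ → ℕ) : Prop where
  lt : ∀ i < N, σ i < N
  inj : ∀ i < N, ∀ j < N, σ i = σ j → i = j
  sorted : ∀ i j, i < j → j < N → ¬ LexLess X Y (σ j) (σ i)

theorem IsSorting.surj {X Y : ℕ → ℝ} {N : ℕ} {σ : ℕ → ℕ} (h : IsSorting X Y N σ) {i : ℕ}
    (hi : i < N) : ∃ j < N, σ j = i := by
  have := Finset.surj_on_of_inj_on_of_card_le (s := Finset.range N) (t := Finset.range N)
    (fun a _ => σ a) (fun a ha => by simpa using h.lt a (by simpa using ha))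
    (fun a b ha hb e => h.inj a (by simpa using ha) b (by simpa using hb) e) le_rfl i
    (by simpa using hi)
  obtain ⟨j, hj, e⟩ := this
  exact ⟨j, by simpa using hj, e.symm⟩

open Classical in
/-- The winner among `a` and `b`, where numbers that are at least `N` stand for empty places. -/
noncomputable def winner (X Y : ℕ → ℝ) (N a b : ℕ) : ℕ :=
  if a < N ∧ ¬ (b < N ∧ LexLess X Y b a) then a else b

/-- The node `v` of the tournament tree `T` holds the winner among its children. -/
def IsPlayed (X Y : ℕ → ℝ) (N : ℕ) (T : ℕ → ℕ) (v : ℕ) : Prop :=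
  T v = winner X Y N (T (v + v)) (T (v + v + 1))

/-! ### Tournament trees: node `v` has the children `2 v` and `2 v + 1`, and leaf `i` is node `N +
i`. -/

section Tournament

variable {X Y : ℕ → ℝ} {N : ℕ} {T : ℕ → ℕ}

theorem winner_left {a b : ℕ} (ha : a < N) :
    winner X Y N a b < N ∧ ¬ LexLess X Y a (winner X Y N a b) := by
  unfold winner
  split_ifs with h
  · exact ⟨ha, LexLess.not_refl⟩
  · simp only [ha, true_and, not_not] at h
    exact ⟨h.1, h.2.asymm⟩

theorem winner_right {a b : ℕ} (hb : b < N) :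
    winner X Y N a b < N ∧ ¬ LexLess X Y b (winner X Y N a b) := by
  unfold winner
  split_ifs with h
  · exact ⟨h.1, fun h' => h.2 ⟨hb, h'⟩⟩
  · exact ⟨hb, LexLess.not_refl⟩

/-- A label moves up from a leaf unchanged, and a leaf holds its own number or the mark `N` for an
empty place. Thus a label at the root names the leaf that has to be cleared. The induction goes from
the last node to the first. -/
theorem tree_le (hT : ∀ v, 1 ≤ v → v < N → IsPlayed X Y N T v)
    (hL : ∀ i < N, T (N + i) = N ∨ T (N + i) = i) (n : ℕ) :
    ∀ v, 2 * N = v + n → 1 ≤ v → v < 2 * N → T v ≤ N ∧ (T v < N → T (N + T v) = T v) := by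
  induction n using Nat.strong_induction_on with
  | _ n ih =>
    intro v hv h1 h2
    by_cases h : v < N
    · have e := hT v h1 h
      have ha := ih (2 * N - (v + v)) (by omega) (v + v) (by omega) (by omega) (by omega)
      have hb := ih (2 * N - (v + v + 1)) (by omega) (v + v + 1) (by omega) (by omega) (by omega)
      have : T v = T (v + v) ∨ T v = T (v + v + 1) := by
        rw [e]; unfold winner; split_ifs <;> simp
      rcases this with e | e <;> rw [e] <;> assumption
    · obtain ⟨i, rfl⟩ := Nat.exists_eq_add_of_le (not_lt.mp h)
      rcases hL i (by omega) with e | e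
      · simp [e]
      · rw [e]; exact ⟨by omega, fun _ => e⟩

/-- Climbing from `v` to the root, no match replaces a label by a worse one. -/
theorem root_dominates (hT : ∀ v, 1 ≤ v → v < N → IsPlayed X Y N T v) (v : ℕ) :
    1 ≤ v → v < 2 * N → T v < N → T 1 < N ∧ ¬ LexLess X Y (T v) (T 1) := by
  induction v using Nat.strong_induction_on with
  | _ v ih =>
    intro h1 h2 hv
    by_cases hv1 : v = 1
    · subst hv1; exact ⟨hv, LexLess.not_refl⟩
    · have e := hT (v / 2) (by omega) (by omega)
      have key : T (v / 2) < N ∧ ¬ LexLess X Y (T v) (T (v / 2)) := by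
        rw [e]
        rcases Nat.even_or_odd' v with ⟨c, hc | hc⟩
        · have : v / 2 + v / 2 = v := by omega
          rw [this]; exact winner_left hv
        · have : v / 2 + v / 2 + 1 = v := by omega
          rw [this]; exact winner_right hv
      obtain ⟨h3, h4⟩ := ih (v / 2) (by omega) (by omega) (by omega) key.1
      exact ⟨h3, LexLess.trans_not key.2 h4⟩

end Tournament

/-- Sequential composition. -/
local infixr:60 " ;; " => Stmt.seq

/-- Lexicographic comparison of the places in the index variables `x` and `y`. -/
def lexTest (k₁ k₂ x y : ℕ) : BExp :=
  .not (.and (.not (.rlt (.get k₁ (.var x)) (.get k₁ (.var y))))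
    (.not (.and (.req (.get k₁ (.var x)) (.get k₁ (.var y)))
      (.rlt (.get k₂ (.var y)) (.get k₂ (.var x))))))

/-- Play the match at the node in the index variable 5. -/
def playNode (k₁ k₂ : ℕ) : Stmt :=
  .setI 6 (.get 1 (.plus (.var 5) (.var 5))) ;;
  .setI 7 (.get 1 (.plus (.plus (.var 5) (.var 5)) (.lit 1))) ;;
  .cond (.and (.ilt (.var 6) (.var 3)) (.not (.and (.ilt (.var 7) (.var 3)) (lexTest k₁ k₂ 7 6))))
    (.putI 1 (.var 5) (.var 6)) (.putI 1 (.var 5) (.var 7))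

/-- Replay the matches on the path from the node in the index variable 5 to the root. -/
def replay (k₁ k₂ : ℕ) : Stmt :=
  .loop (.ilt (.lit 1) (.var 5)) (.setI 5 (.half (.var 5)) ;; playNode k₁ k₂)

/-- Place the numbers below `N`, which is in the index variable 3, on the leaves. -/
def plantLeaves : Stmt :=
  .setI 4 (.lit 0) ;;
  .loop (.ilt (.var 4) (.var 3))
    (.putI 1 (.plus (.var 3) (.var 4)) (.var 4) ;; .setI 4 (.plus (.var 4) (.lit 1)))

/-- Play all matches, bottom up. -/
def playAll (k₁ k₂ : ℕ) : Stmt :=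
  .setI 5 (.var 3) ;;
  .loop (.ilt (.lit 1) (.var 5)) (.setI 5 (.minus (.var 5) (.lit 1)) ;; playNode k₁ k₂)

/-- Repeatedly move the winner to the output array. -/
def extractAll (k₁ k₂ : ℕ) : Stmt :=
  .setI 4 (.lit 0) ;;
  .loop (.ilt (.var 4) (.var 3))
    (.setI 5 (.get 1 (.lit 1)) ;; .putI 2 (.var 4) (.var 5) ;; .setI 5 (.plus (.var 3) (.var 5)) ;;
      .putI 1 (.var 5) (.var 3) ;; replay k₁ k₂ ;; .setI 4 (.plus (.var 4) (.lit 1)))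

/-- Sort the numbers below `N`, which is in the index variable 3, by the keys in the real arrays
`k₁` and `k₂`; the result is the index array 2. -/
def sortProg (k₁ k₂ : ℕ) : Stmt :=
  plantLeaves ;; playAll k₁ k₂ ;; extractAll k₁ k₂

/-! ### Correctness and running time of the tournament sort. -/

section SortProg

variable {M : ℕ} {s : State} {k : ℕ} {k₁ k₂ : ℕ}

theorem wp_playNode (h1 : 1 < M) (hM : s.ivar 5 + s.ivar 5 + 1 < M) (hN : s.ivar 3 < M) :
    Wp M (playNode k₁ k₂) (fun s' k' => k' ≤ k + 60 ∧
      s'.iarr 1 = Function.update (s.iarr 1) (s.ivar 5)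
        (winner (s.rarr k₁) (s.rarr k₂) (s.ivar 3)
          (s.iarr 1 (s.ivar 5 + s.ivar 5)) (s.iarr 1 (s.ivar 5 + s.ivar 5 + 1)))) s k := by
  have hA : s.ivar 5 + s.ivar 5 < M := by omega
  have hB : s.ivar 5 < M := by omega
  simp only [playNode, lexTest, wp_seq, wp_setI, wp_cond, wp_putI, IExp.eval, RExp.eval, BExp.eval,
    IExp.Ok, RExp.Ok, BExp.Ok, IExp.cost, RExp.cost, BExp.cost]
  simp [h1, hM, hA, hB]
  generalize s.iarr 1 (s.ivar 5 + s.ivar 5) = a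
  generalize s.iarr 1 (s.ivar 5 + s.ivar 5 + 1) = b
  refine ⟨fun ha hb => ⟨⟨by omega, by omega⟩, fun _ => by omega⟩, fun ha hb => ?_, fun hb => ?_⟩
  · congr 1
    rw [winner, if_pos]
    refine ⟨ha, fun h => ?_⟩
    obtain ⟨h3, h4⟩ := hb h.1
    rcases h.2 with h5 | h5
    · exact absurd h5 (not_lt.mpr h3)
    · exact absurd h5.2 (not_lt.mpr (h4 h5.1))
  · congr 1
    rw [winner, if_neg]
    rintro ⟨ha, h⟩
    obtain ⟨h3, h4⟩ := hb ha
    refine h ⟨h3, ?_⟩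
    unfold LexLess
    by_cases h5 : s.rarr k₁ b < s.rarr k₁ a
    · exact Or.inl h5
    · exact Or.inr (h4 (not_lt.mp h5))

/-- Changing a leaf can spoil only the matches at its proper ancestors, which are the quotients by
the powers `2 ^ (j + 1)`. Replaying them upwards repairs the tree, and `f` bounds the length of the
path. -/
theorem wp_replay {N : ℕ} {X Y : ℕ → ℝ} (f : ℕ) (hN : s.ivar 3 = N) (hX : s.rarr k₁ = X)
    (hY : s.rarr k₂ = Y) (hM : 2 * N + 2 < M) (h1 : 1 ≤ s.ivar 5) (h2 : s.ivar 5 < 2 * N)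
    (hf : s.ivar 5 < 2 ^ f)
    (hp : ∀ v, 1 ≤ v → v < N → (∀ j, s.ivar 5 / 2 ^ (j + 1) ≠ v) →
      IsPlayed X Y N (s.iarr 1) v) :
    Wp M (replay k₁ k₂) (fun s' k' => k' ≤ k + 70 * f + 10 ∧
      (∀ v, 1 ≤ v → v < N → IsPlayed X Y N (s'.iarr 1) v) ∧
      ∀ i, s'.iarr 1 (N + i) = s.iarr 1 (N + i)) s k := by
  refine Wp.loop (fun s' k' => 1 ≤ s'.ivar 5 ∧ s'.ivar 5 < 2 * N ∧
    (∃ g, s'.ivar 5 < 2 ^ g ∧ k' + 70 * g ≤ k + 70 * f) ∧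
    (∀ v, 1 ≤ v → v < N → (∀ j, s'.ivar 5 / 2 ^ (j + 1) ≠ v) → IsPlayed X Y N (s'.iarr 1) v) ∧
    ∀ i, s'.iarr 1 (N + i) = s.iarr 1 (N + i)) (fun s' => s'.ivar 5)
    ⟨h1, h2, ⟨f, hf, le_rfl⟩, hp, fun _ => rfl⟩ ?_
  rintro s' k' hF ⟨h1, h2, ⟨g, hg, hk⟩, hp, hL⟩
  have hN' : s'.ivar 3 = N := (hF.ivar 3 rfl).trans hN
  have hX' : s'.rarr k₁ = X := (hF.rarr k₁ rfl).trans hX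
  have hY' : s'.rarr k₂ = Y := (hF.rarr k₂ rfl).trans hY
  refine ⟨by simp; omega, fun hb => ?_, fun hb => ?_⟩
  · simp only [BExp.eval, IExp.eval] at hb
    simp only [wp_seq, wp_setI, IExp.Ok, true_and, IExp.eval]
    refine (wp_playNode (by omega) (by simp; omega) (by simp; omega)).frame.mono ?_
    rintro s'' k'' ⟨⟨hk2, hT⟩, hF2⟩
    have e5 : s''.ivar 5 = s'.ivar 5 / 2 := by rw [hF2.ivar 5 rfl]; simp
    simp [hN', hX', hY'] at hT hk2
    generalize s'.ivar 5 = v at *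
    refine ⟨⟨by omega, by omega, ?_, ?_, ?_⟩, by omega⟩
    · obtain _ | g := g
      · omega
      · refine ⟨g, by rw [pow_succ] at hg; omega, by omega⟩
    · intro u hu1 hu2 hj
      rw [e5] at hj
      by_cases hu : u = v / 2
      · subst hu
        unfold IsPlayed
        rw [hT, Function.update_self, Function.update_of_ne (by omega),
          Function.update_of_ne (by omega)]
      -- A node `u` that is neither `v / 2` nor one of its ancestors does not have `v / 2` as a
      -- child, so the rewritten label does not concern its match.
      · have h3 : u + u ≠ v / 2 := fun h => hj 0 (by simp; omega)
        have h4 : u + u + 1 ≠ v / 2 := fun h => hj 0 (by simp; omega)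
        have := hp u hu1 hu2 (fun j hj' => by
          obtain _ | j := j
          · simp at hj'; omega
          · refine hj j ?_
            rw [Nat.div_div_eq_div_mul, ← pow_succ', hj'])
        unfold IsPlayed at *
        rw [hT, Function.update_of_ne hu, Function.update_of_ne h3, Function.update_of_ne h4, this]
    · intro i
      rw [hT, Function.update_of_ne (by omega), hL]
  · simp only [BExp.eval, IExp.eval] at hb
    have hv : s'.ivar 5 = 1 := by omega
    refine ⟨by simp; omega, fun v hv1 hv2 => hp v hv1 hv2 fun j => ?_, hL⟩
    rw [hv, Nat.div_eq_of_lt (Nat.one_lt_two_pow (by omega))]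
    omega

theorem wp_plantLeaves {N : ℕ} (hN : s.ivar 3 = N) (hM : 2 * N + 2 < M) :
    Wp M plantLeaves (fun s' k' => k' ≤ k + 20 * N + 20 ∧ ∀ i < N, s'.iarr 1 (N + i) = i) s k := by
  simp only [plantLeaves, wp_seq, wp_setI, IExp.Ok, IExp.eval]
  refine ⟨by omega, Wp.loop (fun s' k' => s'.ivar 4 ≤ N ∧ k' ≤ k + 20 * s'.ivar 4 + 10 ∧
    ∀ i < s'.ivar 4, s'.iarr 1 (N + i) = i) (fun s' => N - s'.ivar 4) (by simp) ?_⟩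
  rintro s' k' hF ⟨h1, h2, h3⟩
  have hN' : s'.ivar 3 = N := (hF.ivar 3 rfl).trans (by simpa using hN)
  refine ⟨by simp, fun hb => ?_, fun hb => ?_⟩
  · simp [hN'] at hb ⊢
    refine ⟨by omega, by omega, ⟨by omega, by omega, fun i hi => ?_⟩, by omega⟩
    rcases Nat.le_iff_lt_or_eq.mp hi with hi | rfl
    · rw [Function.update_of_ne (by omega), h3 i hi]
    · simp
  · simp [hN'] at hb ⊢
    exact ⟨by omega, fun i hi => h3 i (by omega)⟩

theorem wp_playAll {N : ℕ} {X Y : ℕ → ℝ} (hN : s.ivar 3 = N) (hX : s.rarr k₁ = X)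
    (hY : s.rarr k₂ = Y) (hM : 2 * N + 2 < M) :
    Wp M (playAll k₁ k₂) (fun s' k' => k' ≤ k + 80 * N + 20 ∧
      (∀ v, 1 ≤ v → v < N → IsPlayed X Y N (s'.iarr 1) v) ∧
      ∀ i, s'.iarr 1 (N + i) = s.iarr 1 (N + i)) s k := by
  simp only [playAll, wp_seq, wp_setI, IExp.Ok, true_and, IExp.eval]
  refine Wp.loop (fun s' k' => s'.ivar 5 ≤ N ∧ k' + 80 * s'.ivar 5 ≤ k + 80 * N + 10 ∧
    (∀ v, 1 ≤ v → s'.ivar 5 ≤ v → v < N → IsPlayed X Y N (s'.iarr 1) v) ∧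
    ∀ i, s'.iarr 1 (N + i) = s.iarr 1 (N + i)) (fun s' => s'.ivar 5)
    ⟨by simp [hN], by simp [hN]; omega, fun v _ h h' => ?_, by simp⟩ ?_
  · simp at h; omega
  rintro s' k' hF ⟨h1, h2, hp, hL⟩
  have hN' : s'.ivar 3 = N := (hF.ivar 3 rfl).trans (by simpa using hN)
  have hX' : s'.rarr k₁ = X := (hF.rarr k₁ rfl).trans hX
  have hY' : s'.rarr k₂ = Y := (hF.rarr k₂ rfl).trans hY
  refine ⟨by simp; omega, fun hb => ?_, fun hb => ?_⟩
  · simp only [BExp.eval, IExp.eval] at hb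
    simp only [wp_seq, wp_setI, IExp.Ok, true_and, IExp.eval]
    refine ⟨by omega, (wp_playNode (by omega) (by simp; omega) (by simp; omega)).frame.mono ?_⟩
    rintro s'' k'' ⟨⟨hk2, hT⟩, hF2⟩
    have e5 : s''.ivar 5 = s'.ivar 5 - 1 := by rw [hF2.ivar 5 rfl]; simp
    simp [hN', hX', hY'] at hT hk2
    refine ⟨⟨by omega, by omega, fun u hu1 hu2 hu3 => ?_, fun i => ?_⟩, by omega⟩
    · by_cases hu : u = s'.ivar 5 - 1
      · subst hu
        unfold IsPlayed
        rw [hT, Function.update_self, Function.update_of_ne (by omega),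
          Function.update_of_ne (by omega)]
      · have := hp u hu1 (by omega) hu3
        unfold IsPlayed at *
        rw [hT, Function.update_of_ne hu, Function.update_of_ne (by omega),
          Function.update_of_ne (by omega), this]
    · rw [hT, Function.update_of_ne (by omega), hL]
  · simp only [BExp.eval, IExp.eval] at hb
    exact ⟨by simp; omega, fun v hv1 hv2 => hp v hv1 (by omega) hv2, hL⟩

/-- The invariant says that each number has either been output and its leaf cleared, or is still on
its leaf and beats nothing that has been output. -/
theorem wp_extractAll {N : ℕ} {X Y : ℕ → ℝ} (f : ℕ) (hN : s.ivar 3 = N) (hX : s.rarr k₁ = X)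
    (hY : s.rarr k₂ = Y) (hM : 2 * N + 2 < M) (hf : 2 * N ≤ 2 ^ f)
    (hT : ∀ v, 1 ≤ v → v < N → IsPlayed X Y N (s.iarr 1) v)
    (hL : ∀ i < N, s.iarr 1 (N + i) = i) :
    Wp M (extractAll k₁ k₂) (fun s' k' => k' ≤ k + N * (70 * f + 60) + 20 ∧
      IsSorting X Y N (s'.iarr 2)) s k := by
  simp only [extractAll, wp_seq, wp_setI, IExp.Ok, IExp.eval]
  refine ⟨by omega, Wp.loop (fun s' k' => s'.ivar 4 ≤ N ∧
    k' ≤ k + s'.ivar 4 * (70 * f + 60) + 10 ∧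
    (∀ v, 1 ≤ v → v < N → IsPlayed X Y N (s'.iarr 1) v) ∧
    (∀ i < N, s'.iarr 1 (N + i) = N ∧ (∃ j < s'.ivar 4, s'.iarr 2 j = i) ∨
      s'.iarr 1 (N + i) = i ∧ ∀ j < s'.ivar 4, s'.iarr 2 j ≠ i ∧ ¬ LexLess X Y i (s'.iarr 2 j)) ∧
    (∀ i < s'.ivar 4, s'.iarr 2 i < N) ∧
    (∀ i j, i < j → j < s'.ivar 4 → s'.iarr 2 i ≠ s'.iarr 2 j ∧
      ¬ LexLess X Y (s'.iarr 2 j) (s'.iarr 2 i)))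
    (fun s' => N - s'.ivar 4) ⟨by simp, by simp, by simpa using hT, ?_, by simp, by simp⟩ ?_⟩
  · intro i hi; right; simpa using hL i hi
  rintro s' k' hF ⟨h1, h2, hp, hL, hlt, hs⟩
  have hN' : s'.ivar 3 = N := (hF.ivar 3 rfl).trans (by simpa using hN)
  have hX' : s'.rarr k₁ = X := (hF.rarr k₁ rfl).trans hX
  have hY' : s'.rarr k₂ = Y := (hF.rarr k₂ rfl).trans hY
  refine ⟨by simp, fun hb => ?_, fun hb => ?_⟩
  · simp only [BExp.eval, IExp.eval, hN'] at hb
    have hL' : ∀ i < N, s'.iarr 1 (N + i) = N ∨ s'.iarr 1 (N + i) = i := fun i hi =>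
      (hL i hi).imp And.left And.left
    -- By counting, some number has not been output yet; its leaf is occupied, hence so is the root.
    obtain ⟨i, hi, hi'⟩ : ∃ i < N, ∀ j < s'.ivar 4, s'.iarr 2 j ≠ i := by
      obtain ⟨i, hi, hi'⟩ := Finset.exists_mem_notMem_of_card_lt_card
        (s := (Finset.range (s'.ivar 4)).image (s'.iarr 2)) (t := Finset.range N)
        (by simpa using Finset.card_image_le.trans_lt (by simpa using hb))
      exact ⟨i, by simpa using hi, by simpa using hi'⟩
    have hdom := root_dominates hp
    have hroot : s'.iarr 1 1 < N := by
      rcases hL i hi with ⟨_, j, hj, e⟩ | ⟨e, _⟩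
      · exact absurd e (hi' j hj)
      · exact (hdom (N + i) (by omega) (by omega) (by omega)).1
    -- The label at the root sits on its own leaf, so it has not been output before.
    have hrl := (tree_le hp hL' (2 * N - 1) 1 (by omega) (by omega) (by omega)).2 hroot
    have hrt := (hL _ hroot).resolve_left (by omega)
    simp only [wp_seq, wp_setI, wp_putI, IExp.Ok, true_and, IExp.eval]
    simp [hN']
    generalize hx : s'.iarr 1 1 = x at *
    refine ⟨by omega, by omega, by omega,
      (wp_replay (N := N) (X := X) (Y := Y) f (by simpa using hN') (by simpa using hX')
        (by simpa using hY') hM (by simp; omega) (by simp; omega) (by simp; omega)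
          ?_).frame.mono ?_⟩
    · intro v hv1 hv2 hj
      have hv : v ≠ (N + x) / 2 := fun h => hj 0 (by simp [h])
      have := hp v hv1 hv2
      simp
      unfold IsPlayed at *
      rwa [Function.update_of_ne (by omega), Function.update_of_ne (by omega),
        Function.update_of_ne (by omega)]
    · rintro s'' k'' ⟨⟨hk2, hp2, hL2⟩, hF2⟩
      have e4 : s''.ivar 4 = s'.ivar 4 := by rw [hF2.ivar 4 rfl]; simp
      have eo : s''.iarr 2 = Function.update (s'.iarr 2) (s'.ivar 4) x := by
        rw [hF2.iarr 2 rfl]; simp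
      simp at hL2
      refine ⟨by omega, ⟨by omega, ?_, hp2, ?_, ?_, ?_⟩, by omega⟩
      · rw [e4, Nat.add_mul]; omega
      · intro i hi
        rw [hL2, e4, eo]
        by_cases hix : i = x
        · subst hix
          exact Or.inl ⟨by simp, s'.ivar 4, by omega, by simp⟩
        · rw [Function.update_of_ne (by omega)]
          rcases hL i hi with ⟨e, j, hj, e'⟩ | ⟨e, h⟩
          · exact Or.inl ⟨e, j, by omega, by rw [Function.update_of_ne (by omega), e']⟩
          · refine Or.inr ⟨e, fun j hj => ?_⟩
            rcases (by omega : j < s'.ivar 4 ∨ j = s'.ivar 4) with hj | rfl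
            · rw [Function.update_of_ne (by omega)]; exact h j hj
            · rw [Function.update_self]
              refine ⟨fun h => hix h.symm, ?_⟩
              have := (hdom (N + i) (by omega) (by omega) (by omega)).2
              rwa [e] at this
      · intro i hi
        rw [e4] at hi
        rw [eo]
        rcases (by omega : i < s'.ivar 4 ∨ i = s'.ivar 4) with hi | rfl
        · rw [Function.update_of_ne (by omega)]; exact hlt i hi
        · rwa [Function.update_self]
      · intro i j hij hj
        rw [e4] at hj
        rw [eo, Function.update_of_ne (by omega : i ≠ s'.ivar 4)]
        rcases (by omega : j < s'.ivar 4 ∨ j = s'.ivar 4) with hj | rfl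
        · rw [Function.update_of_ne (by omega)]; exact hs i j hij hj
        · rw [Function.update_self]
          exact hrt.2 i hij
  · simp only [BExp.eval, IExp.eval, hN'] at hb
    have e : s'.ivar 4 = N := by omega
    rw [e] at h2 hlt hs
    refine ⟨by simp; omega, hlt, fun i hi j hj h => ?_, fun i j hij hj => (hs i j hij hj).2⟩
    rcases lt_trichotomy i j with h' | h' | h'
    · exact absurd h (hs i j h' hj).1
    · exact h'
    · exact absurd h.symm (hs j i h' hi).1

theorem wp_sortProg {N : ℕ} (f : ℕ) (hN : s.ivar 3 = N) (hM : 2 * N + 2 < M)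
    (hf : 2 * N ≤ 2 ^ f) :
    Wp M (sortProg k₁ k₂) (fun s' k' => k' ≤ k + N * (70 * f + 160) + 60 ∧
      IsSorting (s.rarr k₁) (s.rarr k₂) N (s'.iarr 2)) s k := by
  simp only [sortProg, wp_seq]
  refine (wp_plantLeaves hN hM).frame.mono ?_
  rintro s₁ n₁ ⟨⟨hn₁, hL₁⟩, hF₁⟩
  have hN₁ : s₁.ivar 3 = N := (hF₁.ivar 3 rfl).trans hN
  refine (wp_playAll hN₁ (hF₁.rarr k₁ rfl) (hF₁.rarr k₂ rfl) hM).frame.mono ?_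
  rintro s₂ n₂ ⟨⟨hn₂, hp₂, hL₂⟩, hF₂⟩
  have hN₂ : s₂.ivar 3 = N := (hF₂.ivar 3 rfl).trans hN₁
  refine (wp_extractAll f hN₂ ((hF₂.rarr k₁ rfl).trans (hF₁.rarr k₁ rfl))
    ((hF₂.rarr k₂ rfl).trans (hF₁.rarr k₂ rfl)) hM hf hp₂
    (fun i hi => (hL₂ i).trans (hL₁ i hi))).mono ?_
  rintro s₃ n₃ ⟨hn₃, hs₃⟩
  refine ⟨?_, hs₃⟩
  simp only [Nat.mul_add] at hn₃ ⊢
  omega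

end SortProg

end RealRAM

/-! ### Convex chains and tangents -/

/-- The cross product of plane vectors, scaled by `σ`. -/
def crossBy (σ : ℝ) (z w : ℂ) : ℝ := σ * (z.re * w.im - z.im * w.re)

/-- The vector `z` points into the left half-plane, or straight up. -/
def IsLeft (z : ℂ) : Prop := z.re < 0 ∨ z.re = 0 ∧ 0 < z.im

theorem IsLeft.re_nonpos {z : ℂ} (h : IsLeft z) : z.re ≤ 0 :=
  h.elim le_of_lt fun h => h.1.le

/-- An open half-plane with one boundary ray is closed under addition and disjoint from its
negative, and the two cover all nonzero vectors. This makes `Precedes` a strict total order. -/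
theorem IsLeft.add {z w : ℂ} (hz : IsLeft z) (hw : IsLeft w) : IsLeft (z + w) := by
  rcases hz with hz | hz
  · exact Or.inl (by simpa using add_neg_of_neg_of_nonpos hz hw.re_nonpos)
  · rcases hw with hw | hw
    · exact Or.inl (by simp [hz.1, hw])
    · exact Or.inr (by simpa [hz.1, hw.1] using add_pos hz.2 hw.2)

theorem IsLeft.not_neg {z : ℂ} (hz : IsLeft z) : ¬ IsLeft (-z) := by
  intro h
  have h1 := hz.re_nonpos
  have h2 := h.re_nonpos
  rcases hz with hz | hz <;> rcases h with h | h <;> simp at h h2 <;> linarith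

theorem isLeft_or_neg {z : ℂ} (hz : z ≠ 0) : IsLeft z ∨ IsLeft (-z) := by
  rcases lt_trichotomy z.re 0 with h | h | h
  · exact Or.inl (Or.inl h)
  · rcases lt_trichotomy z.im 0 with h' | h' | h'
    · exact Or.inr (Or.inr (by simp [h, h']))
    · exact absurd (Complex.ext h h') hz
    · exact Or.inl (Or.inr ⟨h, h'⟩)
  · exact Or.inr (Or.inl (by simpa using h))

/-- The point `z` precedes `w` in the sweep from left to right (and, on vertical lines,
downwards). -/
def Precedes (z w : ℂ) : Prop := IsLeft (z - w)

theorem Precedes.trans {z w v : ℂ} (h : Precedes z w) (h' : Precedes w v) : Precedes z v := by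
  have := IsLeft.add h h'
  rwa [sub_add_sub_cancel] at this

/-- The identity `(a × b) c + (b × c) a + (c × a) b = 0` would be a relation with nonnegative
coefficients, one of them positive, among vectors of a cone that contains no line. -/
theorem not_isLeft_cycle {σ : ℝ} {a b c : ℂ} (ha : IsLeft a) (hb : IsLeft b) (hc : IsLeft c)
    (hab : 0 ≤ crossBy σ a b) (hbc : 0 ≤ crossBy σ b c) (hca : 0 < crossBy σ c a) : False := by
  have hre : crossBy σ a b * c.re + crossBy σ b c * a.re + crossBy σ c a * b.re = 0 := by
    unfold crossBy; ring
  have him : crossBy σ a b * c.im + crossBy σ b c * a.im + crossBy σ c a * b.im = 0 := by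
    unfold crossBy; ring
  generalize crossBy σ a b = α at *
  generalize crossBy σ b c = β at *
  generalize crossBy σ c a = γ at *
  have h1 := mul_nonpos_of_nonneg_of_nonpos hab hc.re_nonpos
  have h2 := mul_nonpos_of_nonneg_of_nonpos hbc ha.re_nonpos
  have h3 := mul_nonpos_of_nonneg_of_nonpos hca.le hb.re_nonpos
  have key : ∀ {t : ℝ} {z : ℂ}, 0 ≤ t → IsLeft z → t * z.re = 0 → 0 ≤ t * z.im := by
    intro t z ht hz h
    rcases mul_eq_zero.mp h with h | h
    · simp [h]
    · rcases hz with hz | hz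
      · exact absurd h hz.ne
      · exact mul_nonneg ht hz.2.le
  have h4 := key hab hc (by linarith)
  have h5 := key hbc ha (by linarith)
  have h6 : b.re = 0 := (mul_eq_zero.mp (by linarith : γ * b.re = 0)).resolve_left hca.ne'
  rcases hb with hb | hb
  · exact hb.ne h6
  · have := mul_pos hca hb.2
    linarith

theorem crossBy_neg_swap (σ : ℝ) (z w : ℂ) : crossBy σ w z = - crossBy σ z w := by
  unfold crossBy; ring

/-- Within the half-plane, "at least as extreme" is transitive, because a failure would be a
forbidden cycle. -/
theorem crossBy_trans {σ : ℝ} {a b c : ℂ} (ha : IsLeft a) (hb : IsLeft b) (hc : IsLeft c)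
    (hab : 0 ≤ crossBy σ a b) (hbc : 0 ≤ crossBy σ b c) : 0 ≤ crossBy σ a c := by
  by_contra h
  exact not_isLeft_cycle ha hb hc hab hbc (by rw [crossBy_neg_swap]; linarith)

/-- In a convex chain `a`, `h`, `q`, if `q` is more extreme than `h` as seen from a later point `p`
then so is `h` compared to `a`. -/
theorem crossBy_chain {σ : ℝ} {a h q p : ℂ} (hah : Precedes a h) (hhq : Precedes h q)
    (hqp : Precedes q p) (hc : 0 < crossBy σ (h - q) (a - q))
    (hq : 0 < crossBy σ (q - p) (h - p)) : 0 < crossBy σ (h - p) (a - p) := by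
  by_contra hn
  -- The cross products are rewritten so that the cycle `h - q`, `a - h`, `h - p` of left vectors
  -- appears.
  have e1 : crossBy σ (h - q) (a - q) = crossBy σ (h - q) (a - h) := by
    simp only [crossBy, Complex.sub_re, Complex.sub_im]; ring
  have e2 : crossBy σ (q - p) (h - p) = crossBy σ (h - p) (h - q) := by
    simp only [crossBy, Complex.sub_re, Complex.sub_im]; ring
  have e3 : crossBy σ (h - p) (a - p) = - crossBy σ (a - h) (h - p) := by
    simp only [crossBy, Complex.sub_re, Complex.sub_im]; ring
  exact not_isLeft_cycle hhq hah (hhq.trans hqp) (e1 ▸ hc).le (by linarith) (e2 ▸ hq)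

/-- If `a` is at least as extreme as `h` as seen from `q`, then, as seen from a later point `p`,
`a` or `q` is at least as extreme as `h`. -/
theorem crossBy_cover {σ : ℝ} {a h q p : ℂ} (hah : Precedes a h) (hhq : Precedes h q)
    (hqp : Precedes q p) (hc : 0 ≤ crossBy σ (a - q) (h - q)) :
    0 ≤ crossBy σ (a - p) (h - p) ∨ 0 ≤ crossBy σ (q - p) (h - p) := by
  by_contra! hn
  have e1 : crossBy σ (a - q) (h - q) = crossBy σ (a - h) (h - q) := by
    simp only [crossBy, Complex.sub_re, Complex.sub_im]; ring
  have e2 : crossBy σ (q - p) (h - p) = - crossBy σ (h - q) (h - p) := by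
    simp only [crossBy, Complex.sub_re, Complex.sub_im]; ring
  have e3 : crossBy σ (a - p) (h - p) = - crossBy σ (h - p) (a - h) := by
    simp only [crossBy, Complex.sub_re, Complex.sub_im]; ring
  exact not_isLeft_cycle hah hhq (hhq.trans hqp) (e1 ▸ hc) (by linarith) (by linarith)

/-- The points `h 0, …, h (n - 1)` of `S` form a convex chain which, as seen from any point to the
right of `S`, contains an extreme point of `S`. -/
structure IsHullChain (σ : ℝ) (S : Set ℂ) (n : ℕ) (h : ℕ → ℂ) : Prop where
  mem : ∀ i < n, h i ∈ S
  step : ∀ i, i + 1 < n → Precedes (h i) (h (i + 1))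
  turn : ∀ i, i + 2 < n → 0 < crossBy σ (h (i + 1) - h (i + 2)) (h i - h (i + 2))
  cover : ∀ r ∈ S, ∀ p, (∀ z ∈ S, Precedes z p) → ∃ i < n, 0 ≤ crossBy σ (h i - p) (r - p)

/-- Along the chain `h`, the points get more extreme up to the index `t`, and not from there on, as
seen from `q`. -/
structure IsTangentIndex (σ : ℝ) (n : ℕ) (h : ℕ → ℂ) (q : ℂ) (t : ℕ) : Prop where
  lt : t < n
  below : ∀ i < t, 0 < crossBy σ (h (i + 1) - q) (h i - q)
  above : ∀ i, t ≤ i → i + 1 < n → crossBy σ (h (i + 1) - q) (h i - q) ≤ 0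

section HullChain

variable {σ : ℝ} {S : Set ℂ} {n : ℕ} {h : ℕ → ℂ}

theorem IsHullChain.precedes (H : IsHullChain σ S n h) {i j : ℕ} (hij : i < j) (hj : j < n) :
    Precedes (h i) (h j) := by
  induction j, hij using Nat.le_induction with
  | base => exact H.step i hj
  | succ j hij ih => exact (ih (by omega)).trans (H.step j hj)

/-- This is the unimodality behind the binary search: by convexity an improving step of the chain is
preceded by improving steps only. -/
theorem IsHullChain.below_of_lt (H : IsHullChain σ S n h) {q : ℂ} (hq : ∀ z ∈ S, Precedes z q)
    {m : ℕ} (hm : m + 1 < n) (h0 : 0 < crossBy σ (h (m + 1) - q) (h m - q)) :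
    ∀ i ≤ m, 0 < crossBy σ (h (i + 1) - q) (h i - q) := by
  induction m with
  | zero => intro i hi; obtain rfl : i = 0 := by omega
            exact h0
  | succ m ih =>
    intro i hi
    rcases Nat.le_succ_iff.mp hi with hi | rfl
    · exact ih (by omega) (crossBy_chain (H.step m (by omega)) (H.step (m + 1) hm)
        (hq _ (H.mem _ hm)) (H.turn m hm) h0) i hi
    · exact h0

theorem IsHullChain.above_of_le (H : IsHullChain σ S n h) {q : ℂ} (hq : ∀ z ∈ S, Precedes z q)
    {m : ℕ} (h0 : crossBy σ (h (m + 1) - q) (h m - q) ≤ 0) (i : ℕ) (hi : m ≤ i) (hn : i + 1 < n) :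
    crossBy σ (h (i + 1) - q) (h i - q) ≤ 0 := by
  by_contra! hc
  exact absurd (H.below_of_lt hq hn hc m hi) (not_lt.mpr h0)

/-- Walking along the chain from index `t` in either direction never leads to a more extreme point;
transitivity adds up the steps. -/
theorem IsTangentIndex.extreme_chain {q : ℂ} {t : ℕ} (T : IsTangentIndex σ n h q t)
    (H : IsHullChain σ S n h) (hq : ∀ z ∈ S, Precedes z q) (i : ℕ) (hi : i < n) :
    0 ≤ crossBy σ (h t - q) (h i - q) := by
  have hl : ∀ i < n, IsLeft (h i - q) := fun i hi => hq _ (H.mem i hi)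
  have hs : ∀ z, 0 ≤ crossBy σ z z := fun z => le_of_eq (by unfold crossBy; ring)
  rcases le_total t i with hti | hti
  · induction i, hti using Nat.le_induction with
    | base => exact hs _
    | succ i hti ih =>
      have := T.above i hti hi
      refine crossBy_trans (hl _ T.lt) (hl i (by omega)) (hl _ hi) (ih (by omega)) ?_
      rw [crossBy_neg_swap]; linarith
  · induction t, hti using Nat.le_induction with
    | base => exact hs _
    | succ t hit ih =>
      have ht := T.lt
      refine crossBy_trans (hl _ ht) (hl t (by omega)) (hl _ hi) (T.below t (by omega)).le ?_
      clear ih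
      have hb := T.below
      clear T
      induction t, hit using Nat.le_induction with
      | base => exact hs _
      | succ t hit ih =>
        exact crossBy_trans (hl _ (by omega)) (hl t (by omega)) (hl _ hi) (hb t (by omega)).le
          (ih (by omega) fun j hj => hb j (by omega))

theorem IsTangentIndex.extreme {q : ℂ} {t : ℕ} (T : IsTangentIndex σ n h q t)
    (H : IsHullChain σ S n h) (hq : ∀ z ∈ S, Precedes z q) {r : ℂ} (hr : r ∈ S) :
    0 ≤ crossBy σ (h t - q) (r - q) := by
  obtain ⟨i, hi, hc⟩ := H.cover r hr q hq
  exact crossBy_trans (hq _ (H.mem _ T.lt)) (hq _ (H.mem i hi)) (hq _ hr)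
    (T.extreme_chain H hq i hi) hc

/-- The chain is cut after the tangent index `t` and continued by `q`. The new turn is convex
because the step to `t` was improving, and by `crossBy_cover` a discarded point is dominated, from
any later viewpoint, by `h t` or by `q`. -/
theorem IsHullChain.push {q : ℂ} {t : ℕ} (H : IsHullChain σ S n h)
    (T : IsTangentIndex σ n h q t) (hq : ∀ z ∈ S, Precedes z q) :
    IsHullChain σ (insert q S) (t + 2) (Function.update h (t + 1) q) := by
  have ht := T.lt
  have ho : ∀ i ≤ t, Function.update h (t + 1) q i = h i := fun i hi =>
    Function.update_of_ne (by omega) _ _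
  have hs : Function.update h (t + 1) q (t + 1) = q := Function.update_self _ _ _
  refine ⟨fun i hi => ?_, fun i hi => ?_, fun i hi => ?_, fun r hr p hp => ?_⟩
  · rcases (by omega : i ≤ t ∨ i = t + 1) with h' | rfl
    · rw [ho i h']; exact Or.inr (H.mem i (by omega))
    · rw [hs]; exact Or.inl rfl
  · rcases (by omega : i + 1 ≤ t ∨ i = t) with h' | rfl
    · rw [ho i (by omega), ho _ h']; exact H.step i (by omega)
    · rw [hs, ho i le_rfl]; exact hq _ (H.mem i ht)
  · rcases (by omega : i + 2 ≤ t ∨ i + 1 = t) with h' | rfl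
    · rw [ho i (by omega), ho _ h', ho _ (by omega)]; exact H.turn i (by omega)
    · rw [hs, ho i (by omega), ho _ le_rfl]; exact T.below i (by omega)
  · have hpS : ∀ z ∈ S, Precedes z p := fun z hz => hp z (Or.inr hz)
    have hpq : Precedes q p := hp q (Or.inl rfl)
    rcases hr with rfl | hr
    · exact ⟨t + 1, by omega, by rw [hs]; exact le_of_eq (by unfold crossBy; ring)⟩
    · obtain ⟨i, hi, hc⟩ := H.cover r hr p hpS
      rcases le_or_gt i t with h' | h'
      · exact ⟨i, by omega, by rwa [ho i h']⟩
      · have hi' := hpS _ (H.mem i hi)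
        rcases crossBy_cover (H.precedes h' hi) (hq _ (H.mem i hi)) hpq
          (T.extreme_chain H hq i hi) with h2 | h2
        · exact ⟨t, by omega, by
            rw [ho t le_rfl]; exact crossBy_trans (hpS _ (H.mem t ht)) hi' (hpS _ hr) h2 hc⟩
        · exact ⟨t + 1, by omega, by rw [hs]; exact crossBy_trans hpq hi' (hpS _ hr) h2 hc⟩

theorem isHullChain_empty (σ : ℝ) (h : ℕ → ℂ) : IsHullChain σ ∅ 0 h :=
  ⟨by simp, by simp, by simp, by simp⟩

theorem IsHullChain.push_empty (H : IsHullChain σ S 0 h) {q : ℂ} (hq : ∀ z ∈ S, Precedes z q) :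
    IsHullChain σ (insert q S) 1 (Function.update h 0 q) := by
  refine ⟨fun i hi => ?_, fun i hi => by omega, fun i hi => by omega, fun r hr p hp => ?_⟩
  · obtain rfl : i = 0 := by omega
    simp
  · rcases hr with rfl | hr
    · exact ⟨0, by omega, by simp [crossBy, mul_comm]⟩
    · obtain ⟨i, hi, _⟩ := H.cover r hr q hq
      omega

end HullChain

namespace RealRAM

/-! ### Extreme points by a sweep with a convex chain -/

/-- Sequential composition. -/
local infixr:60 " ;; " => Stmt.seq

/-- The point with number `i` in the frame coordinates, which are in the real arrays 6 and 7. -/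
def State.point (s : State) (i : ℕ) : ℂ := ⟨s.rarr 6 i, s.rarr 7 i⟩

/-- The scaled cross product of the points in the index variables `a` and `b`, as seen from that in
the index variable `p`. -/
def crossExp (σ : ℚ) (a b p : ℕ) : RExp :=
  .times (.lit σ) (.minus
    (.times (.minus (.get 6 (.var a)) (.get 6 (.var p))) (.minus (.get 7 (.var b)) (.get 7 (.var p))))
    (.times (.minus (.get 7 (.var a)) (.get 7 (.var p)))
      (.minus (.get 6 (.var b)) (.get 6 (.var p)))))

/-- Binary search for the tangent from the point in the index variable 8 to the chain, which is in
the index array 3 and whose length is in the index variable 12. -/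
def searchTangent (σ : ℚ) : Stmt :=
  .setI 9 (.lit 0) ;; .setI 10 (.minus (.var 12) (.lit 1)) ;;
  .loop (.ilt (.var 9) (.var 10))
    (.setI 11 (.half (.plus (.var 9) (.var 10))) ;; .setI 6 (.get 3 (.plus (.var 11) (.lit 1))) ;;
      .setI 7 (.get 3 (.var 11)) ;;
      .cond (.rlt (.lit 0) (crossExp σ 6 7 8)) (.setI 9 (.plus (.var 11) (.lit 1)))
        (.setI 10 (.var 11)))

/-- Push the red point in the index variable 8 to the chain, at its tangent. -/
def pushPoint : Stmt :=
  .cond (.ilt (.lit 0) (.var 12)) (.setI 9 (.plus (.var 9) (.lit 1))) .skip ;;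
  .putI 3 (.var 9) (.var 8) ;; .setI 12 (.plus (.var 9) (.lit 1))

/-- Record the tangent point of the blue point in the index variable 8 in the index array `e`. -/
def recordTangent (e : ℕ) : Stmt :=
  .cond (.ilt (.lit 0) (.var 12)) (.putI e (.var 8) (.get 3 (.var 9))) (.putI e (.var 8) (.var 0))

/-- Sweep over all points in the order of the index array 2, and record the extreme red points as
seen from the blue points in the index array `e`. -/
def sweep (σ : ℚ) (e : ℕ) : Stmt :=
  .setI 12 (.lit 0) ;; .setI 4 (.lit 0) ;;
  .loop (.ilt (.var 4) (.var 13))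
    (.setI 8 (.get 2 (.var 4)) ;; searchTangent σ ;;
      .cond (.ilt (.var 8) (.var 0)) pushPoint (recordTangent e) ;;
      .setI 4 (.plus (.var 4) (.lit 1)))

/-- Among the points with a number `r < m` that precede the point number `b`, that with the number
`c` is an extreme one as seen from `b`; if there are none then `c = m`. -/
def IsExtremeIndex (σ : ℝ) (P : ℕ → ℂ) (m b c : ℕ) : Prop :=
  (c = m ∧ ∀ r < m, ¬ Precedes (P r) (P b)) ∨
  (c < m ∧ Precedes (P c) (P b) ∧
    ∀ r < m, Precedes (P r) (P b) → 0 ≤ crossBy σ (P c - P b) (P r - P b))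

section Sweep

variable {M : ℕ} {s : State} {k : ℕ} {σ : ℚ}

theorem point_eq_of_rarr {s s' : State} (h : s'.rarr 6 = s.rarr 6) (h' : s'.rarr 7 = s.rarr 7) :
    s'.point = s.point := by
  funext i; simp [State.point, h, h']

theorem crossExp_eval (a b p : ℕ) : (crossExp σ a b p).eval s =
    crossBy σ (s.point (s.ivar a) - s.point (s.ivar p))
      (s.point (s.ivar b) - s.point (s.ivar p)) := by
  simp [crossExp, crossBy, State.point]

/-- All steps before index variable 9 are improving, none from index variable 10 on are, and the
distance between the two is halved each time. -/
theorem wp_searchTangent {S : Set ℂ} {P : ℕ → ℂ} {n p : ℕ} {h : ℕ → ℕ} (f : ℕ)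
    (hP : s.point = P) (hn : s.ivar 12 = n) (hp : s.ivar 8 = p) (hh : s.iarr 3 = h)
    (H : IsHullChain σ S n (P ∘ h)) (hq : ∀ z ∈ S, Precedes z (P p)) (hM : 2 * n + 2 < M)
    (hpM : p < M) (hhM : ∀ i < n, h i < M) (hf : n ≤ 2 ^ f) :
    Wp M (searchTangent σ) (fun s' k' => k' ≤ k + 80 * f + 20 ∧
      (n = 0 → s'.ivar 9 = 0) ∧ (0 < n → IsTangentIndex σ n (P ∘ h) (P p) (s'.ivar 9))) s k := by
  simp only [searchTangent, wp_seq, wp_setI, IExp.Ok, IExp.eval, true_and]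
  refine ⟨by omega, by omega, Wp.loop (fun s' k' => s'.ivar 9 ≤ s'.ivar 10 ∧ s'.ivar 10 ≤ n - 1 ∧
    (∃ g, s'.ivar 10 - s'.ivar 9 < 2 ^ g ∧ k' + 80 * g ≤ k + 80 * f + 10) ∧
    (∀ i < s'.ivar 9, 0 < crossBy σ (P (h (i + 1)) - P p) (P (h i) - P p)) ∧
    (∀ i, s'.ivar 10 ≤ i → i + 1 < n → crossBy σ (P (h (i + 1)) - P p) (P (h i) - P p) ≤ 0))
    (fun s' => s'.ivar 10 - s'.ivar 9) ?_ ?_⟩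
  -- For an empty chain the truncated `n - 1` is `0`, so the search stops at once.
  · refine ⟨by simp, by simp [hn], ⟨f, ?_, by simp; omega⟩, by simp, fun i hi hi' => ?_⟩
    · have : 0 < 2 ^ f := by positivity
      simp [hn]; omega
    · simp [hn] at hi; omega
  rintro s' k' hF ⟨h1, h2, ⟨g, hg, hk⟩, hlo, hhi⟩
  have hP' : s'.point = P := (point_eq_of_rarr (hF.rarr 6 rfl) (hF.rarr 7 rfl)).trans hP
  have hp' : s'.ivar 8 = p := (hF.ivar 8 rfl).trans (by simpa using hp)
  have hh' : s'.iarr 3 = h := (hF.iarr 3 rfl).trans (by simpa using hh)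
  refine ⟨by simp, fun hb => ?_, fun hb => ?_⟩
  · simp only [BExp.eval, IExp.eval] at hb
    simp only [wp_seq, wp_setI, wp_cond, BExp.eval, crossExp_eval]
    generalize hl : s'.ivar 9 = l at *
    generalize hu : s'.ivar 10 = u at *
    have ha := hhM ((l + u) / 2) (by omega)
    have hb' := hhM ((l + u) / 2 + 1) (by omega)
    have hP'' : ∀ i, (⟨s'.rarr 6 i, s'.rarr 7 i⟩ : ℂ) = P i := fun i => by rw [← hP']; rfl
    obtain _ | g := g
    · omega
    rw [pow_succ] at hg
    simp [crossExp, State.point, hP'', hl, hu, hh', hp', ha, hb', hpM]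
    refine ⟨by omega, by omega, by omega, fun hc => ⟨by omega, ⟨by omega, h2, ?_, ?_, hhi⟩,
      by omega⟩,
      fun hc => ⟨⟨by omega, by omega, ?_, hlo, ?_⟩, by omega⟩⟩
    · exact ⟨g, by omega, by omega⟩
    · intro i hi
      exact H.below_of_lt hq (m := (l + u) / 2) (by omega) hc i (by omega)
    · exact ⟨g, by omega, by omega⟩
    · exact fun i hi hi' => H.above_of_le hq hc i hi hi'
  · simp only [BExp.eval, IExp.eval] at hb
    refine ⟨by simp; omega, fun h0 => by omega, fun h0 => ⟨by omega, hlo, fun i hi => ?_⟩⟩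
    exact hhi i (by omega)

/-- The chain kept in memory belongs to the red points visited so far. These are exactly the red
points that precede the current point, so its tangent is taken with respect to the right set. -/
theorem wp_sweep {P : ℕ → ℂ} {m n e : ℕ} {o : ℕ → ℕ} (f : ℕ) (he : e = 4 ∨ e = 5)
    (hP : s.point = P) (hm : s.ivar 0 = m) (hn : s.ivar 13 = n) (ho : s.iarr 2 = o)
    (hmn : m ≤ n) (hinj : ∀ i < n, ∀ j < n, P i = P j → i = j)
    (hs : IsSorting (s.rarr 6) (s.rarr 7) n o) (hM : 2 * n + 2 < M) (hf : n ≤ 2 ^ f) :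
    Wp M (sweep σ e) (fun s' k' => k' ≤ k + n * (80 * f + 80) + 20 ∧
      ∀ b, m ≤ b → b < n → IsExtremeIndex σ P m b (s'.iarr e b)) s k := by
  -- Unsorted pairs of `LexLess` are exactly violations of `Precedes`; distinctness of the points
  -- excludes ties.
  have hord : ∀ i j, i < j → j < n → Precedes (P (o i)) (P (o j)) := by
    intro i j hij hj
    refine (isLeft_or_neg (sub_ne_zero.mpr fun h => ?_)).resolve_right fun h => ?_
    · exact hij.ne (hs.inj i (by omega) j hj (hinj _ (hs.lt i (by omega)) _ (hs.lt j hj) h))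
    · refine hs.sorted i j hij hj ?_
      rw [← hP] at h
      simpa [IsLeft, State.point, LexLess, sub_eq_zero] using h
  have hpred : ∀ i < n, ∀ j < n, Precedes (P (o i)) (P (o j)) → i < j := by
    intro i hi j hj h
    by_contra hij
    rcases (not_lt.mp hij).lt_or_eq with h' | rfl
    · refine IsLeft.not_neg h ?_
      rw [neg_sub]
      exact hord j i h' hi
    · simp [Precedes, IsLeft] at h
  simp only [sweep, wp_seq, wp_setI, IExp.Ok, IExp.eval]
  refine ⟨by omega, by omega, Wp.loop (fun s' k' => s'.ivar 4 ≤ n ∧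
    k' ≤ k + s'.ivar 4 * (80 * f + 80) + 10 ∧ s'.ivar 12 ≤ s'.ivar 4 ∧
    (∀ i < s'.ivar 12, s'.iarr 3 i < m) ∧
    IsHullChain σ {z | ∃ j < s'.ivar 4, o j < m ∧ P (o j) = z} (s'.ivar 12) (P ∘ s'.iarr 3) ∧
    ∀ j < s'.ivar 4, m ≤ o j → IsExtremeIndex σ P m (o j) (s'.iarr e (o j)))
    (fun s' => n - s'.ivar 4) ?_ ?_⟩
  · refine ⟨by simp, by simp, by simp, by simp, ?_, by simp⟩
    simpa using isHullChain_empty _ _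
  rintro s' k' hF ⟨h1, h2, h3, h4, H, hout⟩
  have hF1 : s'.point = P ∧ s'.ivar 0 = m ∧ s'.ivar 13 = n ∧ s'.iarr 2 = o := by
    have hm' : (s.setI 12 0 |>.setI 4 0).ivar 0 = m := by simpa using hm
    have hn' : (s.setI 12 0 |>.setI 4 0).ivar 13 = n := by simpa using hn
    rcases he with rfl | rfl <;>
    exact ⟨(point_eq_of_rarr (hF.rarr 6 rfl) (hF.rarr 7 rfl)).trans hP, (hF.ivar 0 rfl).trans hm',
      (hF.ivar 13 rfl).trans hn', (hF.iarr 2 rfl).trans ho⟩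
  obtain ⟨hP', hm', hn', ho'⟩ := hF1
  refine ⟨by simp, fun hb => ?_, fun hb => ?_⟩
  · simp only [BExp.eval, IExp.eval, hn'] at hb
    simp only [wp_seq, wp_setI, IExp.Ok, true_and, IExp.eval, ho']
    generalize hi : s'.ivar 4 = i at *
    generalize hsz : s'.ivar 12 = sz at *
    generalize hst : s'.iarr 3 = st at *
    have hoi := hs.lt i hb
    set S : Set ℂ := {z | ∃ j < i, o j < m ∧ P (o j) = z} with hS
    have hq : ∀ z ∈ S, Precedes z (P (o i)) := by
      rintro z ⟨j, hj, _, rfl⟩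
      exact hord j i hj hb
    refine ⟨by omega, (wp_searchTangent (M := M) (s := s'.setI 8 (o i)) (S := S) (P := P)
      (n := sz) (p := o i) (h := st) f
      hP' (by simpa using hsz) (by simp) (by simpa using hst) H hq
      (by omega) (by omega) (fun j hj => by have := h4 j hj; omega) (by omega)).frame.mono ?_⟩
    rintro s₂ k₂ ⟨⟨hk₂, h0, hT⟩, hF₂⟩
    simp only [BExp.cost, IExp.cost] at hk₂
    have e0 : s₂.ivar 0 = m := by rw [hF₂.ivar 0 rfl]; simpa using hm'
    have e4 : s₂.ivar 4 = i := by rw [hF₂.ivar 4 rfl]; simpa using hi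
    have e8 : s₂.ivar 8 = o i := by rw [hF₂.ivar 8 rfl]; simp
    have e12 : s₂.ivar 12 = sz := by rw [hF₂.ivar 12 rfl]; simpa using hsz
    have e3 : s₂.iarr 3 = st := by rw [hF₂.iarr 3 rfl]; simpa using hst
    have ee : s₂.iarr e = s'.iarr e := by rw [hF₂.iarr e (by rcases he with rfl | rfl <;> rfl)]; simp
    have h3e : ¬ (3 = e) := by omega
    have h9 : s₂.ivar 9 ≤ i := by
      rcases Nat.eq_zero_or_pos sz with h | h
      · rw [h0 h]; omega
      · have := (hT h).lt; omega
    have htime : i * (80 * f + 80) + (80 * f + 80) = (i + 1) * (80 * f + 80) := by ring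
    have h9' : 0 < sz → s₂.ivar 9 + 1 ≤ i := fun h => by have := (hT h).lt; omega
    rcases Nat.lt_or_ge (o i) m with hred | hblue
    · have hSi : {z | ∃ j < i + 1, o j < m ∧ P (o j) = z} = insert (P (o i)) S := by
        ext z
        simp only [hS, Set.mem_ofPred_eq, Set.mem_insert_iff]
        constructor
        · rintro ⟨j, hj, h, rfl⟩
          rcases Nat.lt_succ_iff_lt_or_eq.mp hj with hj | rfl
          · exact Or.inr ⟨j, hj, h, rfl⟩
          · exact Or.inl rfl
        · rintro (rfl | ⟨j, hj, h, rfl⟩)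
          · exact ⟨i, by omega, hred, rfl⟩
          · exact ⟨j, by omega, h, rfl⟩
      have hout' : ∀ j < i + 1, m ≤ o j → IsExtremeIndex σ P m (o j) (s'.iarr e (o j)) := by
        intro j hj hmj
        rcases Nat.lt_succ_iff_lt_or_eq.mp hj with hj | rfl
        · exact hout j hj hmj
        · omega
      rw [wp_cond]
      refine ⟨by simp, fun _ => ?_, fun h => absurd (by simpa [e8, e0] using hred) h⟩
      simp only [pushPoint, wp_seq, wp_cond]
      refine ⟨by simp; omega, fun hpos => ?_, fun hpos => ?_⟩
      · simp [e12] at hpos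
        have T := hT hpos
        have h9' := h9' hpos
        have := H.push T hq
        rw [← Function.comp_update, ← hSi] at this
        simp [-Order.lt_add_one_iff, e4, e8, e3, ee, (Ne.symm h3e : e ≠ 3)]
        generalize s₂.ivar 9 = t at *
        refine ⟨by omega, by omega, by omega, by omega, ⟨by omega, by omega, by omega, ?_, this, ?_⟩,
          by omega⟩
        · intro j hj
          by_cases hjt : j = t + 1
          · subst hjt; simpa using hred
          · rw [Function.update_of_ne hjt]; exact h4 j (by have := T.lt; omega)
        · exact hout'
      · simp [e12] at hpos
        subst hpos
        have := H.push_empty hq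
        rw [← Function.comp_update, ← hSi] at this
        simp [-Order.lt_add_one_iff, e4, e8, e3, ee, h0 rfl, (Ne.symm h3e : e ≠ 3)]
        refine ⟨by omega, by omega, by omega, ⟨by omega, by omega, hred, this, ?_⟩, by omega⟩
        exact hout'
    · have hSi : {z | ∃ j < i + 1, o j < m ∧ P (o j) = z} = S := by
        ext z
        simp only [hS, Set.mem_ofPred_eq]
        constructor
        · rintro ⟨j, hj, h, rfl⟩
          rcases Nat.lt_succ_iff_lt_or_eq.mp hj with hj | rfl
          · exact ⟨j, hj, h, rfl⟩
          · omega
        · rintro ⟨j, hj, h, rfl⟩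
          exact ⟨j, by omega, h, rfl⟩
      have hmem : ∀ r < m, Precedes (P r) (P (o i)) → P r ∈ S := by
        intro r hr h
        obtain ⟨j, hj, rfl⟩ := hs.surj (hr.trans_le hmn)
        exact ⟨j, hpred j hj i hb h, hr, rfl⟩
      have hout' : ∀ c, IsExtremeIndex σ P m (o i) c → ∀ j < i + 1, m ≤ o j →
          IsExtremeIndex σ P m (o j) (Function.update (s'.iarr e) (o i) c (o j)) := by
        intro c hc j hj hmj
        rcases Nat.lt_succ_iff_lt_or_eq.mp hj with hj | rfl
        · rw [Function.update_of_ne]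
          · exact hout j hj hmj
          · exact fun h => hj.ne (hs.inj _ (by omega) _ (by omega) h)
        · rwa [Function.update_self]
      rw [← hSi] at H
      rw [wp_cond]
      refine ⟨by simp, fun h => absurd hblue (by simpa [e8, e0] using h), fun _ => ?_⟩
      simp only [recordTangent, wp_cond]
      refine ⟨by simp; omega, fun hpos => ?_, fun hpos => ?_⟩
      · simp [e12] at hpos
        have T := hT hpos
        have h9' := h9' hpos
        rw [hSi] at H
        have hex := fun r hr => T.extreme H hq (r := r) hr
        have hmt := hq _ (H.mem _ T.lt)
        have hst := h4 _ T.lt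
        rw [← hSi] at H
        simp [-Order.lt_add_one_iff, e4, e8, e12, e3, ee, h3e]
        generalize s₂.ivar 9 = t at *
        refine ⟨by omega, by omega, by omega, ⟨by omega, by omega, by omega, h4, H, ?_⟩, by omega⟩
        exact hout' _ (Or.inr ⟨hst, hmt, fun r hr h => hex _ (hmem r hr h)⟩)
      · simp [e12] at hpos
        subst hpos
        simp [-Order.lt_add_one_iff, e0, e4, e8, e12, e3, ee, h3e]
        refine ⟨by omega, by omega, ⟨by omega, by omega, H, ?_⟩, by omega⟩
        refine hout' _ (Or.inl ⟨rfl, fun r hr h => ?_⟩)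
        rw [hSi] at H
        obtain ⟨i', hi', _⟩ := H.cover _ (hmem r hr h) _ hq
        omega
  · simp only [BExp.eval, IExp.eval, hn'] at hb
    have hi : s'.ivar 4 = n := by omega
    rw [hi] at h2 hout
    refine ⟨by simp; omega, fun b hmb hbn => ?_⟩
    obtain ⟨j, hj, rfl⟩ := hs.surj hbn
    exact hout j hj hmb

end Sweep

end RealRAM

/-! ### Wedges, and strict containment of hulls in terms of quadrants at blue points. -/

/-- The vector `z` lies strictly between the directions `φ` and `φ + π / 2`. -/
def InWedge (φ : ℝ) (z : ℂ) : Prop :=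
  0 < z.re * Real.cos φ + z.im * Real.sin φ ∧ 0 < z.im * Real.cos φ - z.re * Real.sin φ

section Wedge

open Filter Topology ComplexConjugate

theorem InWedge.add {φ : ℝ} {z w : ℂ} (hz : InWedge φ z) (hw : InWedge φ w) :
    InWedge φ (z + w) := by
  obtain ⟨h1, h2⟩ := hz
  obtain ⟨h3, h4⟩ := hw
  constructor <;> simp only [Complex.add_re, Complex.add_im] <;> linarith

theorem InWedge.smul {φ ε : ℝ} {z : ℂ} (hz : InWedge φ z) (hε : 0 < ε) : InWedge φ (ε * z) := by
  obtain ⟨h1, h2⟩ := hz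
  have h3 := mul_pos hε h1
  have h4 := mul_pos hε h2
  constructor <;> simp <;> linarith

theorem isOpen_inWedge (φ : ℝ) : IsOpen {z | InWedge φ z} := by
  have h1 : IsOpen {z : ℂ | 0 < z.re * Real.cos φ + z.im * Real.sin φ} :=
    isOpen_lt continuous_const (by fun_prop)
  have h2 : IsOpen {z : ℂ | 0 < z.im * Real.cos φ - z.re * Real.sin φ} :=
    isOpen_lt continuous_const (by fun_prop)
  exact h1.inter h2

theorem inWedge_iff_exp (φ : ℝ) (z : ℂ) :
    InWedge φ z ↔ 0 < (z * conj (Complex.exp (φ * Complex.I))).re ∧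
      0 < (z * conj (Complex.exp (φ * Complex.I))).im := by
  simp only [InWedge, Complex.mul_re, Complex.mul_im, Complex.conj_re, Complex.conj_im,
    Complex.exp_ofReal_mul_I_re, Complex.exp_ofReal_mul_I_im]
  rw [show z.re * Real.cos φ - z.im * -Real.sin φ = z.re * Real.cos φ + z.im * Real.sin φ by ring,
    show z.re * -Real.sin φ + z.im * Real.cos φ = z.im * Real.cos φ - z.re * Real.sin φ by ring]

theorem inWedge_add_pi_div_two (φ : ℝ) (z : ℂ) :
    InWedge (φ + Real.pi / 2) z ↔ InWedge φ (z * conj Complex.I) := by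
  simp only [InWedge, Real.cos_add_pi_div_two, Real.sin_add_pi_div_two, Complex.mul_re,
    Complex.mul_im, Complex.conj_re, Complex.conj_im, Complex.I_re, Complex.I_im]
  constructor <;> rintro ⟨h1, h2⟩ <;> constructor <;> linarith

theorem inWedge_add_mul_pi_div_two (φ : ℝ) (j : ℕ) (z : ℂ) :
    InWedge (φ + j * (Real.pi / 2)) z ↔ InWedge φ (z * conj (Complex.I ^ j)) := by
  induction j generalizing z with
  | zero => simp
  | succ j ih =>
    rw [show φ + ((j + 1 : ℕ) : ℝ) * (Real.pi / 2) = (φ + j * (Real.pi / 2)) + Real.pi / 2 by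
      push_cast; ring, inWedge_add_pi_div_two, ih, pow_succ', map_mul, mul_assoc]

/-- Up to the factor `|d|²`, the coordinates of `p - v` along `d` and `I * d` are the real and
imaginary parts of `(p - v) * conj d`. -/
theorem mem_openQuadrant {v d p : ℂ} (hd : d ≠ 0) :
    p ∈ openQuadrant v d ↔ 0 < ((p - v) * conj d).re ∧ 0 < ((p - v) * conj d).im := by
  have hn : 0 < Complex.normSq d := Complex.normSq_pos.mpr hd
  have hc : d * conj d = Complex.normSq d := Complex.mul_conj d
  constructor
  · rintro ⟨s, t, hs, ht, rfl⟩
    have : (v + s * d + t * (Complex.I * d) - v) * conj d =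
        (s + t * Complex.I) * Complex.normSq d := by rw [← hc]; ring
    rw [this]
    simp [hs, ht, hn]
  · rintro ⟨h1, h2⟩
    refine ⟨_, _, div_pos h1 hn, div_pos h2 hn, ?_⟩
    have hne : (Complex.normSq d : ℂ) ≠ 0 := by exact_mod_cast hn.ne'
    have : (p - v) * conj d * d = (p - v) * Complex.normSq d := by rw [← hc]; ring
    rw [add_assoc, ← sub_eq_iff_eq_add']
    refine mul_right_cancel₀ hne ?_
    rw [← this]
    conv_lhs => rw [← Complex.re_add_im ((p - v) * conj d)]
    push_cast
    field_simp

theorem mem_openQuadrant_rotateBy {u : ℂ} (hu : u ≠ 0) (θ : ℝ) (k : ℕ) (v p : ℂ) :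
    p ∈ openQuadrant v (rotateBy (θ + k * (Real.pi / 2)) u) ↔
      InWedge θ ((p - v) * conj (u * Complex.I ^ k)) := by
  rw [rotateBy, mem_openQuadrant (mul_ne_zero (Complex.exp_ne_zero _) hu), map_mul, map_mul,
    mul_comm (conj (Complex.exp _)), ← mul_assoc, ← inWedge_iff_exp, inWedge_add_mul_pi_div_two,
    mul_assoc]

theorem mem_rectHull {u : ℂ} (hu : u ≠ 0) {θ : ℝ} {P : Set ℂ} {x : ℂ} :
    x ∈ rectHull u θ P ↔ ∀ v, ∀ k < 4, InWedge θ ((x - v) * conj (u * Complex.I ^ k)) →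
      ∃ p ∈ P, InWedge θ ((p - v) * conj (u * Complex.I ^ k)) := by
  simp only [rectHull, IsQuadrant, Set.mem_sdiff, Set.mem_univ, true_and, Set.mem_sUnion, not_exists,
    not_and]
  constructor
  · intro h v k hk hx
    by_contra! hp
    refine h _ ⟨⟨v, ⟨k, hk⟩, rfl⟩, ?_⟩ ((mem_openQuadrant_rotateBy hu θ k v x).mpr hx)
    ext p
    simp only [Set.mem_inter_iff, Set.mem_empty_iff_false, iff_false, not_and]
    exact fun h1 h2 => hp p h2 ((mem_openQuadrant_rotateBy hu θ k v p).mp h1)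
  · rintro h q ⟨⟨v, k, rfl⟩, hq⟩ hx
    obtain ⟨p, hp, hw⟩ := h v k k.2 ((mem_openQuadrant_rotateBy hu θ k v x).mp hx)
    exact Set.eq_empty_iff_forall_notMem.mp hq p
      ⟨(mem_openQuadrant_rotateBy hu θ k v p).mpr hw, hp⟩

/-- The bisector of the wedge, divided by `c`, provides a direction for perturbing points into a
quadrant. -/
theorem exists_inWedge_mul {c : ℂ} (hc : c ≠ 0) (θ : ℝ) : ∃ w, InWedge θ (w * c) := by
  refine ⟨(1 + Complex.I) * Complex.exp (θ * Complex.I) / c, ?_⟩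
  rw [div_mul_cancel₀ _ hc, inWedge_iff_exp, mul_assoc, Complex.mul_conj, Complex.normSq_eq_norm_sq,
    Complex.norm_exp_ofReal_mul_I]
  simp

/-- Strict containment of the hulls means that all four quadrants at each point of `B` contain
points of `R`. -/
theorem rectHull_subset_interior_iff {u : ℂ} (hu : u ≠ 0) (θ : ℝ) (R B : Finset ℂ) :
    rectHull u θ B ⊆ interior (rectHull u θ R) ↔
      ∀ b ∈ B, ∀ k < 4, ∃ r ∈ R, InWedge θ ((r - b) * conj (u * Complex.I ^ k)) := by
  have hc : ∀ k, conj (u * Complex.I ^ k) ≠ 0 := fun k => by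
    simpa using hu
  constructor
  · intro h b hb k hk
    have hbB : b ∈ rectHull u θ B := (mem_rectHull hu).mpr fun v k hk hx => ⟨b, hb, hx⟩
    obtain ⟨w, hw⟩ := exists_inWedge_mul (hc k) θ
    have hcont : Tendsto (fun ε : ℝ => b + ε * w) (𝓝[>] 0) (𝓝 b) := by
      have : Continuous fun ε : ℝ => b + ε * w := by fun_prop
      simpa using (this.tendsto 0).mono_left nhdsWithin_le_nhds
    obtain ⟨ε, hε, hpos⟩ := ((hcont.eventually (mem_interior_iff_mem_nhds.mp (h hbB))).and
      self_mem_nhdsWithin).exists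
    refine (mem_rectHull hu).mp hε b k hk ?_
    have := hw.smul hpos
    rwa [add_sub_cancel_left, mul_assoc]
  · intro h x hx
    have key : ∀ k < 4, ∃ r ∈ R, InWedge θ ((r - x) * conj (u * Complex.I ^ k)) := by
      intro k hk
      obtain ⟨w, hw⟩ := exists_inWedge_mul (hc k) θ
      -- Some blue `b` lies in the closed quadrant at `x`. Otherwise each `b` is missed by the
      -- quadrant at `x - ε b * w` for some `ε b > 0`. The quadrant for the least of these contains
      -- `x`, hence a blue point, which then also lies in its own larger quadrant.
      obtain ⟨b, hb, hbε⟩ : ∃ b ∈ B, ∀ ε : ℝ, 0 < ε →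
          InWedge θ ((b - (x - ε * w)) * conj (u * Complex.I ^ k)) := by
        by_contra! hcon
        choose! ε hε hεw using hcon
        have hne : B.Nonempty := by
          obtain ⟨p, hp, _⟩ := (mem_rectHull hu).mp hx (x - w) k hk (by simpa using hw)
          exact ⟨p, hp⟩
        obtain ⟨b₀, hb₀, hmin⟩ := B.exists_min_image ε hne
        obtain ⟨b, hb, hbw⟩ := (mem_rectHull hu).mp hx (x - ε b₀ * w) k hk (by
          have := hw.smul (hε b₀ hb₀)
          rwa [sub_sub_cancel, mul_assoc])
        refine hεw b hb ?_
        rcases (hmin b hb).lt_or_eq with hlt | heq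
        · have := hbw.add (hw.smul (sub_pos.mpr hlt))
          convert this using 1
          push_cast; ring
        · rwa [heq] at hbw
      obtain ⟨r, hr, hrb⟩ := h b hb k hk
      refine ⟨r, hr, ?_⟩
      -- The red point lies in the open quadrant at `b`, so there is room to absorb the perturbation
      -- `ε * w` and add the two vectors.
      have hcont : Tendsto (fun ε : ℝ => (r - b - ε * w) * conj (u * Complex.I ^ k)) (𝓝[>] 0)
          (𝓝 ((r - b) * conj (u * Complex.I ^ k))) := by
        have : Continuous fun ε : ℝ => (r - b - ε * w) * conj (u * Complex.I ^ k) := by fun_prop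
        simpa using (this.tendsto 0).mono_left nhdsWithin_le_nhds
      obtain ⟨ε, hε, hpos⟩ := ((hcont.eventually ((isOpen_inWedge θ).mem_nhds hrb)).and
        self_mem_nhdsWithin).exists
      have := InWedge.add hε (hbε ε hpos)
      convert this using 1
      ring
    choose! r hr hrw using key
    rw [mem_interior_iff_mem_nhds]
    -- The same four red points serve all `y` near `x`, so a whole neighbourhood of `x` lies in the
    -- red hull.
    have hev : ∀ k < 4, ∀ᶠ y in 𝓝 x, InWedge θ ((r k - y) * conj (u * Complex.I ^ k)) := by
      intro k hk
      have : Continuous fun y : ℂ => (r k - y) * conj (u * Complex.I ^ k) := by fun_prop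
      exact this.tendsto x ((isOpen_inWedge θ).mem_nhds (hrw k hk))
    have hall : ∀ᶠ y in 𝓝 x, ∀ k ∈ Finset.range 4,
        InWedge θ ((r k - y) * conj (u * Complex.I ^ k)) :=
      (Finset.eventually_all _).mpr fun k hk => hev k (Finset.mem_range.mp hk)
    filter_upwards [hall] with y hy
    refine (mem_rectHull hu).mpr fun v k hk hyv => ⟨r k, hr k hk, ?_⟩
    have := (hy k (Finset.mem_range.mpr hk)).add hyv
    rwa [← add_mul, sub_add_sub_cancel] at this

end Wedge

/-! ### Empty quadrants in terms of angles -/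

/-- For a vector to the left, the largest angle in `[0, π / 2]` up to which the wedge avoids it. -/
noncomputable def upperAngle (z : ℂ) : ℝ :=
  if 0 < z.im then Real.arctan (-z.re / z.im) else Real.pi / 2

/-- For a vector to the right, the least angle in `[0, π / 2]` from which the wedge avoids it. -/
noncomputable def lowerAngle (z : ℂ) : ℝ :=
  if 0 < z.re ∧ 0 < z.im then Real.arctan (z.im / z.re) else 0

section Angles

variable {φ : ℝ} {z h : ℂ}

theorem upperAngle_le (z : ℂ) : upperAngle z ≤ Real.pi / 2 := by
  unfold upperAngle
  split_ifs
  · exact (Real.arctan_lt_pi_div_two _).le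
  · exact le_rfl

theorem lowerAngle_nonneg (z : ℂ) : 0 ≤ lowerAngle z := by
  unfold lowerAngle
  split_ifs with h
  · exact Real.arctan_nonneg.mpr (div_pos h.2 h.1).le
  · exact le_rfl

/-- Turns comparisons of angles into the linear inequalities that define `InWedge`. -/
theorem le_arctan_div_iff {x y : ℝ} (h0 : 0 ≤ φ) (h1 : φ < Real.pi / 2) (hy : 0 < y) :
    φ ≤ Real.arctan (x / y) ↔ Real.sin φ * y ≤ x * Real.cos φ := by
  have hc : 0 < Real.cos φ := Real.cos_pos_of_mem_Ioo ⟨by linarith [Real.pi_pos], h1⟩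
  rw [← Real.arctan_tan (x := φ) (by linarith [Real.pi_pos]) h1, Real.arctan_le_arctan_iff,
    Real.arctan_tan (by linarith [Real.pi_pos]) h1, Real.tan_eq_sin_div_cos, div_le_div_iff₀ hc hy]

theorem not_inWedge_of_le_upperAngle (hz : IsLeft z) (h0 : 0 ≤ φ) (h1 : φ ≤ Real.pi / 2)
    (h : φ ≤ upperAngle z) : ¬ InWedge φ z := by
  rintro ⟨hw, -⟩
  unfold upperAngle at h
  split_ifs at h with him
  · have hlt := h.trans_lt (Real.arctan_lt_pi_div_two _)
    rw [le_arctan_div_iff h0 hlt him] at h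
    linarith
  · have hs := Real.sin_nonneg_of_nonneg_of_le_pi h0 (by linarith [Real.pi_pos])
    have hc := Real.cos_nonneg_of_mem_Icc ⟨by linarith [Real.pi_pos], h1⟩
    have := mul_nonpos_of_nonpos_of_nonneg hz.re_nonpos hc
    have := mul_nonpos_of_nonpos_of_nonneg (not_lt.mp him) hs
    linarith

theorem inWedge_of_upperAngle_lt (hz : IsLeft z) (h0 : 0 ≤ φ) (h1 : φ < Real.pi / 2)
    (h : upperAngle z < φ) : InWedge φ z := by
  unfold upperAngle at h
  split_ifs at h with him
  · have hs := Real.sin_nonneg_of_nonneg_of_le_pi h0 (by linarith [Real.pi_pos])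
    have hc := Real.cos_pos_of_mem_Ioo ⟨by linarith [Real.pi_pos], h1⟩
    rw [← not_le, le_arctan_div_iff h0 h1 him, not_le] at h
    have := mul_pos him hc
    have := mul_nonpos_of_nonpos_of_nonneg hz.re_nonpos hs
    constructor <;> linarith
  · linarith

theorem not_inWedge_of_lowerAngle_le (hz : IsLeft (-z)) (h0 : 0 ≤ φ) (h1 : φ ≤ Real.pi / 2)
    (h : lowerAngle z ≤ φ) : ¬ InWedge φ z := by
  rintro ⟨-, hw⟩
  have hs := Real.sin_nonneg_of_nonneg_of_le_pi h0 (by linarith [Real.pi_pos])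
  have hc := Real.cos_nonneg_of_mem_Icc ⟨by linarith [Real.pi_pos], h1⟩
  have hre : 0 ≤ z.re := by simpa using hz.re_nonpos
  unfold lowerAngle at h
  split_ifs at h with hpos
  · rcases h1.lt_or_eq with h1 | rfl
    · by_cases h' : φ ≤ Real.arctan (z.im / z.re)
      · have e : Real.arctan (z.im / z.re) = φ := le_antisymm h h'
        have ht : Real.tan φ = z.im / z.re := by rw [← e, Real.tan_arctan]
        have hc' := Real.cos_pos_of_mem_Ioo ⟨by linarith [Real.pi_pos], h1⟩
        rw [Real.tan_eq_sin_div_cos, div_eq_div_iff hc'.ne' hpos.1.ne'] at ht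
        linarith
      · rw [le_arctan_div_iff h0 h1 hpos.1] at h'
        linarith
    · simp at hw
      linarith
  · have h3 := mul_nonneg hre hs
    rcases hz with hz | hz
    · have : z.im ≤ 0 := by
        by_contra hi
        exact hpos ⟨by simpa using hz, by linarith⟩
      have := mul_nonpos_of_nonpos_of_nonneg this hc
      linarith
    · have : z.im ≤ 0 := by have := hz.2; simp at this; linarith
      have := mul_nonpos_of_nonpos_of_nonneg this hc
      linarith

theorem inWedge_of_lt_lowerAngle (h0 : 0 ≤ φ) (h : φ < lowerAngle z) : InWedge φ z := by
  unfold lowerAngle at h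
  split_ifs at h with hpos
  · have h1 := h.trans (Real.arctan_lt_pi_div_two _)
    have hs := Real.sin_nonneg_of_nonneg_of_le_pi h0 (by linarith [Real.pi_pos])
    have hc := Real.cos_pos_of_mem_Ioo ⟨by linarith [Real.pi_pos], h1⟩
    have h2 := (le_arctan_div_iff h0 h1 hpos.1).mp h.le
    have h3 := mul_pos hpos.1 hc
    have h4 := mul_nonneg hpos.2.le hs
    refine ⟨by linarith, ?_⟩
    refine lt_of_le_of_ne (by linarith) fun e => h.ne ?_
    rw [← Real.arctan_tan (x := φ) (by linarith [Real.pi_pos]) h1, Real.tan_eq_sin_div_cos,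
      (div_eq_div_iff hc.ne' hpos.1.ne').mpr (show _ = z.im * Real.cos φ by linarith)]
  · linarith

/-- The most extreme left vector, the one closest to straight up, enters the wedge first. -/
theorem upperAngle_mono (hh : IsLeft h) (hz : IsLeft z) (hc : 0 ≤ crossBy 1 h z) :
    upperAngle h ≤ upperAngle z := by
  simp only [crossBy, one_mul] at hc
  by_cases hzi : 0 < z.im
  · have hhi : 0 < h.im := by
      by_contra hhi
      have h1 := mul_nonneg_of_nonpos_of_nonpos (not_lt.mp hhi) hz.re_nonpos
      rcases hh with hh | hh
      · have := mul_neg_of_neg_of_pos hh hzi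
        linarith
      · exact hhi hh.2
    rw [upperAngle, if_pos hhi, upperAngle, if_pos hzi, Real.arctan_le_arctan_iff,
      div_le_div_iff₀ hhi hzi]
    linarith
  · refine (upperAngle_le h).trans ?_
    rw [upperAngle, if_neg hzi]

/-- Among the right vectors, the one closest to straight up leaves the wedge last. -/
theorem lowerAngle_mono (hh : IsLeft (-h)) (hc : 0 ≤ crossBy 1 z h) :
    lowerAngle z ≤ lowerAngle h := by
  simp only [crossBy, one_mul] at hc
  by_cases hz : 0 < z.re ∧ 0 < z.im
  · have hre : 0 < h.re := by
      rcases hh with hh | hh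
      · simpa using hh
      · simp at hh
        rw [hh.1] at hc
        have := mul_neg_of_pos_of_neg hz.1 hh.2
        linarith
    have him : 0 < h.im := by
      have h1 := mul_pos hz.2 hre
      exact pos_of_mul_pos_right (by linarith : 0 < z.re * h.im) hz.1.le
    rw [lowerAngle, if_pos hz, lowerAngle, if_pos ⟨hre, him⟩, Real.arctan_le_arctan_iff,
      div_le_div_iff₀ hz.1 hre]
    linarith
  · rw [lowerAngle, if_neg hz]
    exact lowerAngle_nonneg h

end Angles

/-! ### Free and blocked angles. -/

/-- The angles in `[0, π / 2]` at which the wedge at the point number `b` contains none of the first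
`m` points, as far as this can be told by `upperAngle` and `lowerAngle`. -/
def freeAngles (P : ℕ → ℂ) (m b : ℕ) : Set ℝ :=
  {φ | 0 ≤ φ ∧ φ ≤ Real.pi / 2 ∧ (∀ r < m, Precedes (P r) (P b) → φ ≤ upperAngle (P r - P b)) ∧
    ∀ r < m, Precedes (P b) (P r) → lowerAngle (P r - P b) ≤ φ}

theorem not_inWedge_of_mem_freeAngles {P : ℕ → ℂ} {m b : ℕ} {φ : ℝ} (h : φ ∈ freeAngles P m b)
    (r : ℕ) (hr : r < m) : ¬ InWedge φ (P r - P b) := by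
  obtain ⟨h0, h1, hu, hl⟩ := h
  by_cases hz : P r - P b = 0
  · rw [hz]; rintro ⟨h, -⟩; simp at h
  rcases isLeft_or_neg hz with hz | hz
  · exact not_inWedge_of_le_upperAngle hz h0 h1 (hu r hr hz)
  · exact not_inWedge_of_lowerAngle_le hz h0 h1 (hl r hr (by rwa [neg_sub] at hz))

/-- The angle `π / 2` must be left out: there a point straight above `b` is on the boundary of the
wedge again, although its `upperAngle` is `0`. -/
theorem mem_freeAngles_of_not_inWedge {P : ℕ → ℂ} {m b : ℕ} {φ : ℝ} (h0 : 0 ≤ φ)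
    (h1 : φ < Real.pi / 2) (h : ∀ r < m, ¬ InWedge φ (P r - P b)) : φ ∈ freeAngles P m b := by
  refine ⟨h0, h1.le, fun r hr hp => ?_, fun r hr hp => ?_⟩
  · by_contra hn
    exact h r hr (inWedge_of_upperAngle_lt hp h0 h1 (not_le.mp hn))
  · by_contra hn
    exact h r hr (inWedge_of_lt_lowerAngle h0 (not_le.mp hn))

open ComplexConjugate in
/-- The coordinates of the points `p` in the frame of `u`, rotated by `k` right angles. -/
noncomputable def framePoints (u : ℂ) (p : ℕ → ℂ) (k : ℕ) (i : ℕ) : ℂ :=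
  p i * conj (u * Complex.I ^ k)

theorem framePoints_add_four (u : ℂ) (p : ℕ → ℂ) (k : ℕ) :
    framePoints u p (k + 4) = framePoints u p k := by
  funext i; simp [framePoints, pow_add]

theorem framePoints_mod_four (u : ℂ) (p : ℕ → ℂ) (k : ℕ) :
    framePoints u p (k % 4) = framePoints u p k := by
  induction k using Nat.strong_induction_on with
  | _ k ih =>
    rcases Nat.lt_or_ge k 4 with h | h
    · rw [Nat.mod_eq_of_lt h]
    · obtain ⟨l, rfl⟩ := Nat.exists_eq_add_of_le' h
      rw [Nat.add_mod_right, ih l (by omega), framePoints_add_four]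

/-- A right angle can be moved from the wedge to the frame, which confines `φ` to `[0, π / 2]`. -/
theorem inWedge_framePoints_add (u : ℂ) (p : ℕ → ℂ) (k j : ℕ) (φ : ℝ) (r b : ℕ) :
    InWedge (φ + j * (Real.pi / 2)) (framePoints u p k r - framePoints u p k b) ↔
      InWedge φ (framePoints u p (k + j) r - framePoints u p (k + j) b) := by
  rw [inWedge_add_mul_pi_div_two]
  simp only [framePoints, pow_add, map_mul]
  ring_nf

/-- The angles at which some quadrant at a blue point is empty. -/
def blockedAngles (u : ℂ) (p : ℕ → ℂ) (m n : ℕ) (K : ℕ) : Set ℝ :=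
  {θ | ∃ k < K, ∃ b, m ≤ b ∧ b < n ∧ ∃ j < 4,
    θ - (j : ℕ) * (Real.pi / 2) ∈ freeAngles (framePoints u p k) m b}

theorem containmentAngles_eq {u : ℂ} (hu : u ≠ 0) {R B : Finset ℂ} {p : ℕ → ℂ} {m n : ℕ}
    (hR : ∀ z, z ∈ R ↔ ∃ i < m, p i = z) (hB : ∀ z, z ∈ B ↔ ∃ i, m ≤ i ∧ i < n ∧ p i = z) :
    containmentAngles u (R : Set ℂ) (B : Set ℂ) =
      Set.Ico 0 (2 * Real.pi) \ blockedAngles u p m n 4 := by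
  ext θ
  simp only [containmentAngles, Set.mem_ofPred_eq, Set.mem_sdiff, and_congr_right_iff]
  rintro ⟨h0, h2⟩
  rw [rectHull_subset_interior_iff hu]
  have hpi := Real.pi_pos
  constructor
  · rintro h ⟨k, hk, b, hmb, hbn, j, hj, hfree⟩
    -- Frame `k` with shift `j` describes the quadrant number `k - j` modulo 4.
    have hmod : (k + 4 - j) % 4 + j = k ∨ (k + 4 - j) % 4 + j = k + 4 := by omega
    obtain ⟨r, hr, hw⟩ := h (p b) ((hB _).mpr ⟨b, hmb, hbn, rfl⟩) ((k + 4 - j) % 4) (by omega)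
    obtain ⟨i, hi, rfl⟩ := (hR r).mp hr
    refine not_inWedge_of_mem_freeAngles hfree i hi ?_
    have e : framePoints u p k = framePoints u p ((k + 4 - j) % 4 + j) := by
      rcases hmod with e | e <;> rw [e]
      rw [framePoints_add_four]
    rw [e, ← inWedge_framePoints_add, sub_add_cancel]
    rwa [sub_mul] at hw
  · intro h b hb k hk
    by_contra! hr
    obtain ⟨b, hmb, hbn, rfl⟩ := (hB _).mp hb
    refine h ?_
    have hj0 : 0 ≤ θ / (Real.pi / 2) := by positivity
    -- Rounding down leaves a remainder strictly below `π / 2`, as `mem_freeAngles_of_not_inWedge`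
    -- requires.
    set j := ⌊θ / (Real.pi / 2)⌋₊ with hj
    have hj1 : (j : ℝ) * (Real.pi / 2) ≤ θ := by
      have := Nat.floor_le hj0
      rwa [le_div_iff₀ (by linarith)] at this
    have hj2 : θ < (j + 1) * (Real.pi / 2) := by
      have := Nat.lt_floor_add_one (θ / (Real.pi / 2))
      rwa [div_lt_iff₀ (by linarith)] at this
    have hj4 : j < 4 := by
      have : (j : ℝ) < 4 := by nlinarith
      exact_mod_cast this
    refine ⟨(k + j) % 4, by omega, b, hmb, hbn, j, hj4,
      mem_freeAngles_of_not_inWedge (by linarith) (by linarith) fun r hrm => ?_⟩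
    rw [framePoints_mod_four, ← inWedge_framePoints_add, sub_add_cancel]
    have := hr (p r) ((hR _).mpr ⟨r, hrm, rfl⟩)
    rwa [sub_mul] at this

/-! ### The gaps between intervals -/

/-- The interval from `a j` to `b j`, which contains its left endpoint if `g j ≠ 0`. -/
def gapInterval (a b : ℕ → ℝ) (g : ℕ → ℕ) (j : ℕ) : Set ℝ :=
  {x | x < b j ∧ (a j < x ∨ g j ≠ 0 ∧ a j = x)}

/-- The first `c` of the intervals given by `a`, `b`, `g` are the gaps of `U` in `[0, ∞)`, except
for a last gap which starts at `x₀` (and contains it if `f ≠ 0`). -/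
structure IsGapList (U : Set ℝ) (c : ℕ) (a b : ℕ → ℝ) (g : ℕ → ℕ) (x₀ : ℝ) (f : ℕ) : Prop where
  nonneg : 0 ≤ x₀
  lt : ∀ j < c, a j < b j
  le : ∀ j < c, b j ≤ x₀
  apart : ∀ i j, i < j → j < c → b i ≤ a j
  right : ∀ j < c, b j ∈ U
  left : ∀ j < c, 0 ≤ a j ∧ (g j ≠ 0 ∧ a j = 0 ∨ g j = 0 ∧ a j ∈ U)
  start : f ≠ 0 ∧ x₀ = 0 ∨ f = 0 ∧ x₀ ∈ U
  cover : ∀ x, 0 ≤ x → (x ∉ U ↔ (∃ j < c, x ∈ gapInterval a b g j) ∨ x₀ < x ∨ f ≠ 0 ∧ x₀ = x)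

section GapList

variable {U : Set ℝ} {c : ℕ} {a b : ℕ → ℝ} {g : ℕ → ℕ} {x₀ : ℝ} {f : ℕ} {l r : ℝ}

/-- The pending gap starts at `0` and contains it; only such a gap can be closed on the left. -/
theorem isGapList_empty (a b : ℕ → ℝ) (g : ℕ → ℕ) : IsGapList ∅ 0 a b g 0 1 := by
  refine ⟨le_rfl, by simp, by simp, by simp, by simp, by simp, by simp, fun x hx => ?_⟩
  simpa using hx.lt_or_eq

/-- The new interval starts beyond `x₀`, so the pending gap is complete; the next one is open at
`r`. -/
theorem IsGapList.append (H : IsGapList U c a b g x₀ f) (hl : x₀ < l) (hr : l ≤ r) :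
    IsGapList (U ∪ Set.Icc l r) (c + 1) (Function.update a c x₀) (Function.update b c l)
      (Function.update g c f) r 0 := by
  have hx₀ := H.nonneg
  have hne : ∀ j < c, j ≠ c := fun j hj => hj.ne
  have hg : ∀ j < c, gapInterval (Function.update a c x₀) (Function.update b c l)
      (Function.update g c f) j = gapInterval a b g j := fun j hj => by
    simp [gapInterval, Function.update_of_ne (hne j hj)]
  have hgc : gapInterval (Function.update a c x₀) (Function.update b c l)
      (Function.update g c f) c = {x | x < l ∧ (x₀ < x ∨ f ≠ 0 ∧ x₀ = x)} := by
    simp [gapInterval]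
  refine ⟨by linarith, fun j hj => ?_, fun j hj => ?_, fun i j hij hj => ?_, fun j hj => ?_,
    fun j hj => ?_, Or.inr ⟨rfl, Or.inr ⟨hr, le_rfl⟩⟩, fun x hx => ?_⟩
  · rcases Nat.lt_succ_iff_lt_or_eq.mp hj with hj | rfl
    · simpa [Function.update_of_ne (hne j hj)] using H.lt j hj
    · simpa using hl
  · rcases Nat.lt_succ_iff_lt_or_eq.mp hj with hj | rfl
    · have := H.le j hj
      simp only [Function.update_of_ne (hne j hj)]
      linarith
    · simpa using hr
  · have hi : i < c := by omega
    rcases Nat.lt_succ_iff_lt_or_eq.mp hj with hj | rfl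
    · simpa [Function.update_of_ne (hne j hj), Function.update_of_ne (hne i hi)]
        using H.apart i j hij hj
    · simpa [Function.update_of_ne (hne i hi)] using H.le i hi
  · rcases Nat.lt_succ_iff_lt_or_eq.mp hj with hj | rfl
    · simpa [Function.update_of_ne (hne j hj)] using Or.inl (H.right j hj)
    · right; simpa using hr
  · rcases Nat.lt_succ_iff_lt_or_eq.mp hj with hj | rfl
    · simp only [Function.update_of_ne (hne j hj)]
      exact ⟨(H.left j hj).1, (H.left j hj).2.imp id fun h => ⟨h.1, Or.inl h.2⟩⟩
    · simp only [Function.update_self]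
      exact ⟨hx₀, H.start.imp id fun h => ⟨h.1, Or.inl h.2⟩⟩
  · rw [Set.mem_union, not_or, H.cover x hx, Set.mem_Icc, not_and_or, not_le, not_le]
    constructor
    · rintro ⟨⟨j, hj, h⟩ | h, h'⟩
      · exact Or.inl ⟨j, by omega, by rwa [hg j hj]⟩
      · rcases h' with h' | h'
        · exact Or.inl ⟨c, by omega, by rw [hgc]; exact ⟨h', h⟩⟩
        · exact Or.inr (Or.inl h')
    · rintro (⟨j, hj, h⟩ | h | h)
      · rcases Nat.lt_succ_iff_lt_or_eq.mp hj with hj | rfl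
        · rw [hg j hj] at h
          exact ⟨Or.inl ⟨j, hj, h⟩, Or.inl (by linarith [h.1, H.le j hj])⟩
        · rw [hgc] at h
          exact ⟨Or.inr h.2, Or.inl h.1⟩
      · exact ⟨Or.inr (Or.inl (by linarith)), Or.inr h⟩
      · exact absurd rfl h.1

/-- The new interval leaves every recorded gap intact and swallows the start of the pending one. -/
theorem IsGapList.extend (H : IsGapList U c a b g x₀ f) (hb : ∀ j < c, b j ≤ l) (hl : l ≤ x₀)
    (hr : x₀ ≤ r) : IsGapList (U ∪ Set.Icc l r) c a b g r 0 := by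
  refine ⟨H.nonneg.trans hr, H.lt, fun j hj => (H.le j hj).trans hr, H.apart,
    fun j hj => Or.inl (H.right j hj),
    fun j hj => ⟨(H.left j hj).1, (H.left j hj).2.imp id fun h => ⟨h.1, Or.inl h.2⟩⟩,
    Or.inr ⟨rfl, Or.inr ⟨hl.trans hr, le_rfl⟩⟩, fun x hx => ?_⟩
  rw [Set.mem_union, not_or, H.cover x hx, Set.mem_Icc, not_and_or, not_le, not_le]
  constructor
  · rintro ⟨h | h, h'⟩
    · exact Or.inl h
    · rcases h' with h' | h'
      · rcases h with h | h <;> [linarith; linarith [h.2]]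
      · exact Or.inr (Or.inl h')
  · rintro (⟨j, hj, h⟩ | h | h)
    · exact ⟨Or.inl ⟨j, hj, h⟩, Or.inl (by linarith [h.1, hb j hj])⟩
    · exact ⟨Or.inr (Or.inl (by linarith)), Or.inr h⟩
    · exact absurd rfl h.1

theorem IsGapList.skip (H : IsGapList U c a b g x₀ f) (hb : ∀ j < c, b j ≤ l) (hr : r < x₀) :
    IsGapList (U ∪ Set.Icc l r) c a b g x₀ f := by
  refine ⟨H.nonneg, H.lt, H.le, H.apart, fun j hj => Or.inl (H.right j hj),
    fun j hj => ⟨(H.left j hj).1, (H.left j hj).2.imp id fun h => ⟨h.1, Or.inl h.2⟩⟩,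
    H.start.imp id fun h => ⟨h.1, Or.inl h.2⟩, fun x hx => ?_⟩
  rw [Set.mem_union, not_or, H.cover x hx, Set.mem_Icc, not_and_or, not_le, not_le]
  constructor
  · exact And.left
  · rintro (⟨j, hj, h⟩ | h)
    · exact ⟨Or.inl ⟨j, hj, h⟩, Or.inl (by linarith [h.1, hb j hj])⟩
    · exact ⟨Or.inr h, Or.inr (by rcases h with h | h <;> [linarith; linarith [h.2]])⟩

/-- Each gap is connected. It is maximal because its right end is in `U` and its left end is either
in `U` or the end `0` of the domain. Disjoint nonempty gaps are distinct. -/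
theorem IsGapList.bijOn (H : IsGapList U c a b g x₀ f) :
    Set.BijOn (gapInterval a b g) (Set.Iio c) (maximalIntervals (Set.Ico 0 x₀ \ U)) := by
  have hA : ∀ x, x ∈ Set.Ico 0 x₀ \ U ↔ ∃ j < c, x ∈ gapInterval a b g j := by
    intro x
    constructor
    · rintro ⟨⟨h0, h1⟩, hU⟩
      refine ((H.cover x h0).mp hU).resolve_right ?_
      rintro (h | h)
      · linarith
      · linarith [h.2]
    · rintro ⟨j, hj, h⟩
      have h0 : 0 ≤ x := by
        have := (H.left j hj).1
        rcases h.2 with h | h <;> [linarith; linarith [h.2]]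
      exact ⟨⟨h0, h.1.trans_le (H.le j hj)⟩, (H.cover x h0).mpr (Or.inl ⟨j, hj, h⟩)⟩
  have hcomp : ∀ j < c, ∀ x ∈ gapInterval a b g j,
      connectedComponentIn (Set.Ico 0 x₀ \ U) x = gapInterval a b g j := by
    intro j hj x hx
    have hxA := (hA x).mpr ⟨j, hj, hx⟩
    apply Set.Subset.antisymm
    · have hord := (isPreconnected_connectedComponentIn (F := Set.Ico 0 x₀ \ U) (x := x)).ordConnected
      have hxC := mem_connectedComponentIn hxA
      have hsub := connectedComponentIn_subset (Set.Ico 0 x₀ \ U) x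
      intro y hy
      have hyb : y < b j := by
        by_contra hn
        exact (hsub (hord.out hxC hy ⟨hx.1.le, not_lt.mp hn⟩)).2 (H.right j hj)
      refine ⟨hyb, ?_⟩
      have hax : a j ≤ x := by rcases hx.2 with h | h <;> [exact h.le; exact h.2.le]
      rcases (H.left j hj).2 with h | h
      · rcases (hsub hy).1.1.lt_or_eq with h' | h'
        · exact Or.inl (h.2 ▸ h')
        · exact Or.inr ⟨h.1, h.2.trans h'⟩
      · left
        by_contra hn
        exact (hsub (hord.out hy hxC ⟨not_lt.mp hn, hax⟩)).2 h.2
    · refine IsPreconnected.subset_connectedComponentIn ?_ hx fun y hy => (hA y).mpr ⟨j, hj, hy⟩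
      refine Set.OrdConnected.isPreconnected ⟨fun y hy z hz w hw => ⟨hw.2.trans_lt hz.1, ?_⟩⟩
      rcases hy.2 with h | h
      · exact Or.inl (h.trans_le hw.1)
      · rcases hw.1.lt_or_eq with h' | h'
        · exact Or.inl (h.2.trans_lt h')
        · exact Or.inr ⟨h.1, h.2.trans h'⟩
  have hmid : ∀ j < c, (a j + b j) / 2 ∈ gapInterval a b g j := by
    intro j hj
    have := H.lt j hj
    exact ⟨by linarith, Or.inl (by linarith)⟩
  have hdisj : ∀ i j, i < j → j < c → gapInterval a b g i ≠ gapInterval a b g j := by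
    intro i j hij hj h
    have h1 := hmid j hj
    have h2 := H.apart i j hij hj
    have h3 := H.lt j hj
    rw [← h] at h1
    linarith [h1.1]
  refine ⟨fun j hj => ?_, fun i hi j hj h => ?_, ?_⟩
  · exact ⟨_, (hA _).mpr ⟨j, hj, hmid j hj⟩, (hcomp j hj _ (hmid j hj)).symm⟩
  · rcases lt_trichotomy i j with h' | h' | h'
    · exact absurd h (hdisj i j h' hj)
    · exact h'
    · exact absurd h.symm (hdisj j i h' hi)
  · rintro J ⟨x, hx, rfl⟩
    obtain ⟨j, hj, hxj⟩ := (hA x).mp hx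
    exact ⟨j, hj, (hcomp j hj x hxj).symm⟩

end GapList

theorem outputInterval_eq (s : RealRAM.State) :
    outputInterval s = gapInterval (s.rarr 4) (s.rarr 5) (s.iarr 0) := rfl

/-! ### The scan that lists the gaps. -/

namespace RealRAM

/-- Sequential composition. -/
local infixr:60 " ;; " => Stmt.seq

/-- Append the gap that ends at `e` to the output. -/
def emitGap (e : RExp) : Stmt :=
  .putR 4 (.var 2) (.var 5) ;; .putR 5 (.var 2) e ;; .putI 0 (.var 2) (.var 15) ;;
  .setI 2 (.plus (.var 2) (.lit 1))

/-- Process the interval whose number is in the index variable 5. -/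
def scanStep : Stmt :=
  .cond (.rlt (.var 5) (.get 8 (.var 5))) (emitGap (.get 8 (.var 5))) .skip ;;
  .cond (.rlt (.get 9 (.var 5)) (.var 5)) .skip (.setR 5 (.get 9 (.var 5)) ;; .setI 15 (.lit 0))

/-- List the gaps in `[0, 2π)` between the intervals in the real arrays 8 and 9, in the order of the
index array 2. -/
def scan : Stmt :=
  .setI 2 (.lit 0) ;; .setI 15 (.lit 1) ;; .setR 5 (.lit 0) ;; .setI 4 (.lit 0) ;;
  .loop (.ilt (.var 4) (.var 14))
    (.setI 5 (.get 2 (.var 4)) ;; scanStep ;; .setI 4 (.plus (.var 4) (.lit 1))) ;;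
  .cond (.rlt (.var 5) (.times (.lit 4) (.var 6))) (emitGap (.times (.lit 4) (.var 6))) .skip

section Scan

variable {M : ℕ} {s : State} {k : ℕ}

/-- The gaps recorded in the memory. -/
def State.HasGaps (s : State) (U : Set ℝ) : Prop :=
  IsGapList U (s.ivar 2) (s.rarr 4) (s.rarr 5) (s.iarr 0) (s.rvar 5) (s.ivar 15)

theorem wp_scanStep {U : Set ℝ} {i : ℕ} {l r : ℝ} (hi : s.ivar 5 = i) (hl : s.rarr 8 i = l)
    (hr : s.rarr 9 i = r) (hlr : l ≤ r) (H : s.HasGaps U) (hb : ∀ j < s.ivar 2, s.rarr 5 j ≤ l)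
    (hiM : i < M) (hM : s.ivar 2 + 2 < M) :
    Wp M scanStep (fun s' k' => k' ≤ k + 40 ∧ s'.HasGaps (U ∪ Set.Icc l r) ∧
      s'.ivar 2 ≤ s.ivar 2 + 1 ∧ s'.rvar 5 ≤ max (s.rvar 5) r ∧
      ∀ j < s'.ivar 2, s'.rarr 5 j ≤ l) s k := by
  unfold State.HasGaps at *
  simp only [scanStep, emitGap, wp_seq, wp_cond, BExp.eval, RExp.eval, IExp.eval, BExp.Ok,
    RExp.Ok, IExp.Ok]
  refine ⟨⟨trivial, trivial, by omega⟩, fun h => ?_, fun h => ?_⟩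
  · rw [hi, hl] at h
    have h2 : ¬ r < s.rvar 5 := by linarith
    simp [hi, hl, hr, h2, hiM]
    refine ⟨by omega, by omega, fun _ => ⟨by omega, H.append h hlr, fun j hj => ?_⟩⟩
    by_cases hj' : j = s.ivar 2
    · simp [hj']
    · rw [Function.update_of_ne hj']; exact hb j (by omega)
  · rw [hi, hl, not_lt] at h
    simp [hi, hr, hiM]
    refine ⟨fun h2 => ?_, fun h2 => ⟨by omega, H.extend hb h h2, hb⟩⟩
    exact ⟨H.skip hb h2, hb⟩

theorem wp_scan {N : ℕ} {Y : ℕ → ℝ} {o : ℕ → ℕ} (hN : s.ivar 14 = N)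
    (hpi : s.rvar 6 = Real.pi / 2) (ho : s.iarr 2 = o) (hs : IsSorting (s.rarr 8) Y N o)
    (hint : ∀ i < N, 0 ≤ s.rarr 8 i ∧ s.rarr 8 i ≤ s.rarr 9 i ∧ s.rarr 9 i ≤ 2 * Real.pi)
    (hM : N + 4 < M) :
    Wp M scan (fun s' k' => k' ≤ k + 60 * N + 60 ∧
      ReportsIntervals s' (Set.Ico 0 (2 * Real.pi) \
        {x | ∃ i < N, s.rarr 8 i ≤ x ∧ x ≤ s.rarr 9 i})) s k := by
  have hpos := Real.pi_pos
  simp only [scan, wp_seq, wp_setI, wp_setR, IExp.Ok, IExp.eval, RExp.Ok, RExp.eval]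
  refine ⟨by omega, by omega, trivial, by omega, Wp.loop (fun s' k' => s'.ivar 4 ≤ N ∧
    k' ≤ k + 60 * s'.ivar 4 + 20 ∧ s'.ivar 2 ≤ s'.ivar 4 ∧
    s'.HasGaps {x | ∃ i < s'.ivar 4, s.rarr 8 (o i) ≤ x ∧ x ≤ s.rarr 9 (o i)} ∧
    s'.rvar 5 ≤ 2 * Real.pi ∧
    ∀ j < s'.ivar 2, ∃ i < s'.ivar 4, s'.rarr 5 j ≤ s.rarr 8 (o i)) (fun s' => N - s'.ivar 4)
    ?_ ?_⟩
  · refine ⟨by simp, by simp, by simp, ?_, by simp; positivity, by simp⟩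
    simpa [State.HasGaps] using isGapList_empty _ _ _
  rintro s' k' hF ⟨h1, h2, h3, H, hcur, hb⟩
  have hN' : s'.ivar 14 = N := (hF.ivar 14 rfl).trans (by simpa using hN)
  have hpi' : s'.rvar 6 = Real.pi / 2 := (hF.rvar 6 rfl).trans (by simpa using hpi)
  have ho' : s'.iarr 2 = o := (hF.iarr 2 rfl).trans ho
  have h8' : s'.rarr 8 = s.rarr 8 := hF.rarr 8 rfl
  have h9' : s'.rarr 9 = s.rarr 9 := hF.rarr 9 rfl
  refine ⟨by simp, fun hc => ?_, fun hc => ?_⟩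
  · simp only [BExp.eval, IExp.eval, hN'] at hc
    simp only [wp_seq, wp_setI, IExp.Ok, true_and, IExp.eval, ho', BExp.cost, IExp.cost]
    have hoi := hs.lt _ hc
    obtain ⟨hl0, hlr, hr2⟩ := hint _ hoi
    refine ⟨by omega, (wp_scanStep (M := M) (s := s'.setI 5 (o (s'.ivar 4))) (i := o (s'.ivar 4))
      (l := s.rarr 8 (o (s'.ivar 4))) (r := s.rarr 9 (o (s'.ivar 4))) (by simp) (by simp [h8'])
      (by simp [h9']) hlr (by simpa [State.HasGaps] using H) ?_ (by omega)
      (by simp; omega)).frame.mono ?_⟩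
    · intro j hj
      obtain ⟨i, hi, hle⟩ := hb j (by simpa using hj)
      refine hle.trans ?_
      -- Recorded gaps end at left endpoints of earlier intervals, and these are at most the current
      -- left endpoint.
      have := hs.sorted i _ hi hc
      unfold LexLess at this
      push Not at this
      exact this.1
    · rintro s₂ k₂ ⟨⟨hk₂, H₂, h2₂, hc₂, hb₂⟩, hF₂⟩
      have e4 : s₂.ivar 4 = s'.ivar 4 := by rw [hF₂.ivar 4 rfl]; simp
      simp at h2₂ hc₂
      have hU : {x | ∃ i < s'.ivar 4, s.rarr 8 (o i) ≤ x ∧ x ≤ s.rarr 9 (o i)} ∪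
          Set.Icc (s.rarr 8 (o (s'.ivar 4))) (s.rarr 9 (o (s'.ivar 4))) =
          {x | ∃ i < s'.ivar 4 + 1, s.rarr 8 (o i) ≤ x ∧ x ≤ s.rarr 9 (o i)} := by
        ext x
        simp only [Set.mem_union, Set.mem_ofPred_eq, Set.mem_Icc]
        constructor
        · rintro (⟨i, hi, h⟩ | h)
          · exact ⟨i, by omega, h⟩
          · exact ⟨_, by omega, h⟩
        · rintro ⟨i, hi, h⟩
          rcases Nat.lt_succ_iff_lt_or_eq.mp hi with hi | rfl
          · exact Or.inl ⟨i, hi, h⟩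
          · exact Or.inr h
      rw [hU] at H₂
      simp [-Order.lt_add_one_iff, e4]
      refine ⟨⟨by omega, by omega⟩, ⟨by omega, by omega, by omega, H₂, ?_, fun j hj => ?_⟩,
        by omega⟩
      · rcases hc₂ with h | h <;> linarith
      · exact ⟨s'.ivar 4, by omega, hb₂ j hj⟩
  · simp only [BExp.eval, IExp.eval, hN'] at hc
    have e4 : s'.ivar 4 = N := by omega
    rw [e4] at H h2 h3
    have hU : {x | ∃ i < N, s.rarr 8 (o i) ≤ x ∧ x ≤ s.rarr 9 (o i)} =
        {x | ∃ i < N, s.rarr 8 i ≤ x ∧ x ≤ s.rarr 9 i} := by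
      ext x
      simp only [Set.mem_ofPred_eq]
      constructor
      · rintro ⟨i, hi, h⟩; exact ⟨o i, hs.lt i hi, h⟩
      · rintro ⟨i, hi, h⟩
        obtain ⟨j, hj, rfl⟩ := hs.surj hi
        exact ⟨j, hj, h⟩
    rw [hU] at H
    set U := {x | ∃ i < N, s.rarr 8 i ≤ x ∧ x ≤ s.rarr 9 i}
    have e2pi : (4 : ℝ) * (Real.pi / 2) = 2 * Real.pi := by ring
    simp only [wp_cond, BExp.eval, RExp.eval, hpi', BExp.Ok, RExp.Ok, true_and, Rat.cast_ofNat,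
      e2pi, BExp.cost, IExp.cost, RExp.cost]
    unfold State.HasGaps at H
    refine ⟨fun hlt => ?_, fun hlt => ?_⟩
    -- The last gap is closed by the degenerate interval at `2π`, which does not meet `[0, 2π)`.
    · have hG := (H.append hlt le_rfl).bijOn
      have hA : Set.Ico 0 (2 * Real.pi) \ (U ∪ Set.Icc (2 * Real.pi) (2 * Real.pi)) =
          Set.Ico 0 (2 * Real.pi) \ U := by
        ext x
        simp only [Set.mem_sdiff, Set.mem_Ico, Set.mem_union, Set.mem_Icc, not_or]
        exact ⟨fun h => ⟨h.1, h.2.1⟩, fun h => ⟨h.1, h.2, fun h' => by linarith [h.1.2, h'.1]⟩⟩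
      rw [hA] at hG
      simp only [emitGap, wp_seq, wp_putR, wp_putI, wp_setI, IExp.Ok, IExp.eval, RExp.Ok, RExp.eval]
      simp [hpi', e2pi]
      refine ⟨by omega, ⟨by omega, by omega⟩, by omega, ?_⟩
      simpa [ReportsIntervals, outputInterval_eq] using hG
    · have e : s'.rvar 5 = 2 * Real.pi := le_antisymm hcur (not_lt.mp hlt)
      simp only [wp_skip]
      refine ⟨by omega, ?_⟩
      have hG := H.bijOn
      rw [e] at hG
      exact hG

end Scan

/-! ### The intervals of blocked angles -/

/-- Write the product of the point in cell `i` of the real arrays `x` and `y` with the conjugate of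
the direction in the real variables 0 and 1 to cell `j` of the real arrays 6 and 7. -/
def fillCell (x y : ℕ) (i j : IExp) : Stmt :=
  .putR 6 j (.plus (.times (.get x i) (.var 0)) (.times (.get y i) (.var 1))) ;;
  .putR 7 j (.minus (.times (.get y i) (.var 0)) (.times (.get x i) (.var 1)))

/-- Compute the frame coordinates of all points. -/
def fillFrame : Stmt :=
  .setI 4 (.lit 0) ;;
  .loop (.ilt (.var 4) (.var 0)) (fillCell 0 1 (.var 4) (.var 4) ;;
    .setI 4 (.plus (.var 4) (.lit 1))) ;;
  .setI 4 (.lit 0) ;;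
  .loop (.ilt (.var 4) (.var 1)) (fillCell 2 3 (.var 4) (.plus (.var 0) (.var 4)) ;;
    .setI 4 (.plus (.var 4) (.lit 1)))

/-- Find extreme red points, as seen from the blue points, among those to the left in the frame. -/
def findExtreme (σ : ℚ) (e : ℕ) : Stmt :=
  fillFrame ;; .setI 3 (.var 13) ;; sortProg 6 7 ;; sweep σ e

/-- Reverse the direction. -/
def negateFrame : Stmt :=
  .setR 0 (.minus (.lit 0) (.var 0)) ;; .setR 1 (.minus (.lit 0) (.var 1))

/-- Turn the direction by a right angle. -/
def turnFrame : Stmt :=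
  .setR 2 (.var 0) ;; .setR 0 (.minus (.lit 0) (.var 1)) ;; .setR 1 (.var 2)

/-- The vector from the point in the index variable 4 to that in the index variable `a`. -/
def loadVector (a : ℕ) : Stmt :=
  .setR 7 (.minus (.get 6 (.var a)) (.get 6 (.var 4))) ;;
  .setR 8 (.minus (.get 7 (.var a)) (.get 7 (.var 4)))

/-- Compute the upper end of the interval of free angles of a blue point. -/
def computeUpper : Stmt :=
  .setR 2 (.var 6) ;; .setI 6 (.get 4 (.var 4)) ;;
  .cond (.ilt (.var 6) (.var 0))
    (loadVector 6 ;; .cond (.rlt (.lit 0) (.var 8))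
      (.setR 2 (.arctan (.quot (.minus (.lit 0) (.var 7)) (.var 8)))) .skip)
    .skip

/-- Compute the lower end of the interval of free angles of a blue point. -/
def computeLower : Stmt :=
  .setR 3 (.lit 0) ;; .setI 7 (.get 5 (.var 4)) ;;
  .cond (.ilt (.var 7) (.var 0))
    (loadVector 7 ;; .cond (.and (.rlt (.lit 0) (.var 7)) (.rlt (.lit 0) (.var 8)))
      (.setR 3 (.arctan (.quot (.var 8) (.var 7)))) .skip)
    .skip

/-- Store the interval of free angles, shifted by `j` right angles. -/
def storeShifted (j : ℕ) : Stmt :=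
  .putR 8 (.var 14) (.plus (.var 3) (.times (.lit j) (.var 6))) ;;
  .putR 9 (.var 14) (.plus (.var 2) (.times (.lit j) (.var 6))) ;;
  .setI 14 (.plus (.var 14) (.lit 1))

/-- Store the intervals of free angles of all blue points. -/
def storeIntervals : Stmt :=
  .setI 4 (.var 0) ;;
  .loop (.ilt (.var 4) (.var 13))
    (computeUpper ;; computeLower ;;
      .cond (.rlt (.var 2) (.var 3)) .skip
        (storeShifted 0 ;; storeShifted 1 ;; storeShifted 2 ;; storeShifted 3) ;;
      .setI 4 (.plus (.var 4) (.lit 1)))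

/-- Store the intervals of free angles in one frame, and turn the frame. -/
def processFrame : Stmt :=
  negateFrame ;; findExtreme (-1) 5 ;; negateFrame ;; findExtreme 1 4 ;; storeIntervals ;; turnFrame

/-- The memory holds the points `p`, of which the first `m` are red and the other ones, up to `n`,
are blue, and some constants. -/
structure HasInput (s : State) (p : ℕ → ℂ) (m n : ℕ) : Prop where
  red : s.ivar 0 = m
  blue : m + s.ivar 1 = n
  total : s.ivar 13 = n
  rightAngle : s.rvar 6 = Real.pi / 2
  redPoint : ∀ i < m, s.rarr 0 i = (p i).re ∧ s.rarr 1 i = (p i).im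
  bluePoint : ∀ i, m + i < n → s.rarr 2 i = (p (m + i)).re ∧ s.rarr 3 i = (p (m + i)).im

/-- The program does not write to the memory that `HasInput` is about. -/
def Stmt.keepsInput (c : Stmt) : Bool :=
  c.keepsI 0 && (c.keepsI 1 && (c.keepsI 13 && (c.keepsR 6 &&
    (c.keepsRA 0 && (c.keepsRA 1 && (c.keepsRA 2 && c.keepsRA 3))))))

theorem HasInput.frame {s s' : State} {p : ℕ → ℂ} {m n : ℕ} {c : Stmt} (h : HasInput s p m n)
    (hF : Frame c s s') (hc : c.keepsInput = true) : HasInput s' p m n := by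
  simp only [Stmt.keepsInput, Bool.and_eq_true] at hc
  obtain ⟨h0, h1, h13, h6, a0, a1, a2, a3⟩ := hc
  refine ⟨?_, ?_, ?_, ?_, ?_, ?_⟩
  · rw [hF.ivar 0 h0, h.red]
  · rw [hF.ivar 1 h1, h.blue]
  · rw [hF.ivar 13 h13, h.total]
  · rw [hF.rvar 6 h6, h.rightAngle]
  · rw [hF.rarr 0 a0, hF.rarr 1 a1]; exact h.redPoint
  · rw [hF.rarr 2 a2, hF.rarr 3 a3]; exact h.bluePoint

/-! ### Extreme points in a given frame. -/

section Frames

open ComplexConjugate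

variable {M : ℕ} {s : State} {k : ℕ} {p : ℕ → ℂ} {m n : ℕ}

theorem wp_fillFrame {w : ℂ} (h : HasInput s p m n) (h0 : s.rvar 0 = w.re) (h1 : s.rvar 1 = w.im)
    (hM : n + 1 < M) :
    Wp M fillFrame (fun s' k' => k' ≤ k + 60 * n + 60 ∧ ∀ i < n, s'.point i = p i * conj w) s k := by
  have hmn : m ≤ n := h.blue ▸ Nat.le_add_right _ _
  have hpt : ∀ (s : State) i, s.point i = p i * conj w ↔
      s.rarr 6 i = (p i).re * w.re + (p i).im * w.im ∧
        s.rarr 7 i = (p i).im * w.re - (p i).re * w.im := by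
    intro s i
    rw [Complex.ext_iff]
    simp only [State.point, Complex.mul_re, Complex.mul_im, Complex.conj_re, Complex.conj_im]
    constructor <;> rintro ⟨h1, h2⟩ <;> constructor <;> linarith
  simp only [hpt, fillFrame, wp_seq, wp_setI, IExp.Ok, IExp.eval]
  refine ⟨by omega, Wp.loop (fun s' k' => s'.ivar 4 ≤ m ∧ k' ≤ k + 60 * s'.ivar 4 + 20 ∧
    ∀ i < s'.ivar 4, s'.rarr 6 i = (p i).re * w.re + (p i).im * w.im ∧
        s'.rarr 7 i = (p i).im * w.re - (p i).re * w.im) (fun s' => m - s'.ivar 4)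
    (by simp) ?_⟩
  rintro s' k' hF ⟨hm', hk', hP⟩
  have h' : HasInput s' p m n := HasInput.frame (s := s.setI 4 0) ⟨by simpa using h.red,
    by simpa using h.blue, by simpa using h.total, h.rightAngle, h.redPoint, h.bluePoint⟩ hF rfl
  have h0' : s'.rvar 0 = w.re := (hF.rvar 0 rfl).trans h0
  have h1' : s'.rvar 1 = w.im := (hF.rvar 1 rfl).trans h1
  refine ⟨by simp, fun hc => ?_, fun hc => ?_⟩
  · simp only [BExp.eval, IExp.eval, h'.red] at hc
    obtain ⟨hx, hy⟩ := h'.redPoint _ hc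
    simp [-Order.lt_add_one_iff, fillCell, h0', h1', hx, hy]
    refine ⟨by omega, by omega, ⟨by omega, by omega, fun i hi => ?_⟩, by omega⟩
    rcases Nat.lt_succ_iff_lt_or_eq.mp hi with hi | rfl
    · rw [Function.update_of_ne hi.ne, Function.update_of_ne hi.ne]; exact hP i hi
    · rw [Function.update_self, Function.update_self]; exact ⟨rfl, rfl⟩
  · simp only [BExp.eval, IExp.eval, h'.red] at hc
    have e4 : s'.ivar 4 = m := by omega
    rw [e4] at hP hk'
    clear hc
    have h : HasInput s' p m n := h'
    simp only [BExp.cost, IExp.cost]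
    refine ⟨by omega, Wp.loop (fun s₂ k₂ => m + s₂.ivar 4 ≤ n ∧
      k₂ ≤ k + 60 * m + 60 * s₂.ivar 4 + 40 ∧
      ∀ i < m + s₂.ivar 4, s₂.rarr 6 i = (p i).re * w.re + (p i).im * w.im ∧
          s₂.rarr 7 i = (p i).im * w.re - (p i).re * w.im) (fun s₂ => n - s₂.ivar 4)
      ⟨by simpa using hmn, by simp; omega, by simpa using hP⟩ ?_⟩
    rintro s₂ k₂ hF₂ ⟨hm₂, hk₂, hP₂⟩
    have h₂ : HasInput s₂ p m n := HasInput.frame (s := s'.setI 4 0) ⟨by simpa using h.red,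
      by simpa using h.blue, by simpa using h.total, h.rightAngle, h.redPoint, h.bluePoint⟩ hF₂ rfl
    have h0₂ : s₂.rvar 0 = w.re := (hF₂.rvar 0 rfl).trans h0'
    have h1₂ : s₂.rvar 1 = w.im := (hF₂.rvar 1 rfl).trans h1'
    have hb := h₂.blue
    refine ⟨by simp, fun hc => ?_, fun hc => ?_⟩
    · simp only [BExp.eval, IExp.eval] at hc
      obtain ⟨hx, hy⟩ := h₂.bluePoint (s₂.ivar 4) (by omega)
      simp [-Order.lt_add_one_iff, fillCell, h0₂, h1₂, hx, hy, h₂.red]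
      refine ⟨by omega, by omega, by omega, by omega, by omega, ⟨by omega, by omega, fun i hi => ?_⟩, by omega⟩
      rcases (by omega : i < m + s₂.ivar 4 ∨ i = m + s₂.ivar 4) with hi | rfl
      · rw [Function.update_of_ne hi.ne, Function.update_of_ne hi.ne]; exact hP₂ i hi
      · rw [Function.update_self, Function.update_self]; exact ⟨rfl, rfl⟩
    · simp only [BExp.eval, IExp.eval] at hc
      have e : m + s₂.ivar 4 = n := by omega
      rw [e] at hP₂
      exact ⟨by simp; omega, hP₂⟩

theorem IsExtremeIndex.congr {σ : ℝ} {P P' : ℕ → ℂ} {b c : ℕ} (hmn : m ≤ n) (hb : b < n)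
    (hP : ∀ i < n, P i = P' i) (h : IsExtremeIndex σ P m b c) : IsExtremeIndex σ P' m b c := by
  have hP' : ∀ r < m, P r = P' r := fun r hr => hP r (by omega)
  rcases h with ⟨hc, h⟩ | ⟨hc, h1, h2⟩
  · exact Or.inl ⟨hc, fun r hr => by rw [← hP' r hr, ← hP b hb]; exact h r hr⟩
  · refine Or.inr ⟨hc, by rwa [← hP' c hc, ← hP b hb], fun r hr => ?_⟩
    rw [← hP' r hr, ← hP' c hc, ← hP b hb]
    exact h2 r hr

theorem wp_findExtreme {σ : ℚ} {e : ℕ} {w : ℂ} (f : ℕ) (he : e = 4 ∨ e = 5)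
    (h : HasInput s p m n) (h0 : s.rvar 0 = w.re) (h1 : s.rvar 1 = w.im) (hw : w ≠ 0)
    (hinj : ∀ i < n, ∀ j < n, p i = p j → i = j) (hM : 2 * n + 2 < M) (hf : 2 * n ≤ 2 ^ f) :
    Wp M (findExtreme σ e) (fun s' k' => k' ≤ k + n * (150 * f + 300) + 150 ∧
      (∀ i < n, s'.point i = p i * conj w) ∧
      ∀ b, m ≤ b → b < n → IsExtremeIndex σ (fun i => p i * conj w) m b (s'.iarr e b)) s k := by
  have hmn : m ≤ n := h.blue ▸ Nat.le_add_right _ _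
  simp only [findExtreme, wp_seq]
  refine (wp_fillFrame h h0 h1 (by omega)).frame.mono ?_
  rintro s₁ k₁ ⟨⟨hk₁, hP₁⟩, hF₁⟩
  have hI₁ := h.frame hF₁ rfl
  rw [wp_setI]
  refine ⟨by simp, (wp_sortProg (N := n) f (by simpa using hI₁.total) hM hf).frame.mono ?_⟩
  rintro s₂ k₂ ⟨⟨hk₂, hs₂⟩, hF₂⟩
  have e6 : s₂.rarr 6 = s₁.rarr 6 := hF₂.rarr 6 rfl
  have e7 : s₂.rarr 7 = s₁.rarr 7 := hF₂.rarr 7 rfl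
  have hp₂ : s₂.point = s₁.point := point_eq_of_rarr e6 e7
  have hw' : conj w ≠ 0 := by simpa using hw
  refine (wp_sweep (M := M) (s := s₂) (P := s₁.point) (m := m) (n := n) (o := s₂.iarr 2) f he hp₂ ?_ ?_
    rfl hmn ?_ ?_ hM (by omega)).frame.mono ?_
  · rw [hF₂.ivar 0 rfl]; simpa using hI₁.red
  · rw [hF₂.ivar 13 rfl]; simpa using hI₁.total
  · intro i hi j hj hij
    rw [hP₁ i hi, hP₁ j hj] at hij
    exact hinj i hi j hj (mul_right_cancel₀ hw' hij)
  · rw [e6, e7]; exact hs₂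
  · rintro s₃ k₃ ⟨⟨hk₃, hx₃⟩, hF₃⟩
    have hp₃ : s₃.point = s₁.point := by
      rw [← hp₂]
      exact point_eq_of_rarr (hF₃.rarr 6 rfl) (hF₃.rarr 7 rfl)
    refine ⟨?_, by rwa [hp₃], fun b hmb hb => (hx₃ b hmb hb).congr hmn hb hP₁⟩
    simp only [IExp.cost] at hk₂
    simp only [Nat.mul_add] at hk₂ hk₃ ⊢
    have e1 : n * (150 * f) = n * (70 * f) + n * (80 * f) := by ring
    omega

end Frames

/-! ### From extreme points to intervals of free angles. -/

section Intervals

/-- The interval of free angles is determined by two extreme points. -/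
theorem freeAngles_eq_Icc {P : ℕ → ℂ} {m b c d : ℕ} (hc : IsExtremeIndex 1 P m b c)
    (hd : IsExtremeIndex (-1) (fun i => - P i) m b d) :
    freeAngles P m b = Set.Icc (if d < m then lowerAngle (P d - P b) else 0)
      (if c < m then upperAngle (P c - P b) else Real.pi / 2) := by
  have hneg : ∀ r, Precedes (-P r) (-P b) ↔ Precedes (P b) (P r) := fun r => by
    unfold Precedes; rw [neg_sub_neg]
  simp only [IsExtremeIndex, hneg] at hd
  have hU : ∀ φ ≤ Real.pi / 2, (φ ≤ if c < m then upperAngle (P c - P b) else Real.pi / 2) ↔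
      ∀ r < m, Precedes (P r) (P b) → φ ≤ upperAngle (P r - P b) := by
    intro φ hφ
    rcases hc with ⟨rfl, h⟩ | ⟨h1, h2, h3⟩
    · simp only [lt_irrefl, if_false]
      exact ⟨fun _ r hr h' => absurd h' (h r hr), fun _ => hφ⟩
    · rw [if_pos h1]
      exact ⟨fun hu r hr h' => hu.trans (upperAngle_mono h2 h' (h3 r hr h')), fun h => h c h1 h2⟩
  have hL : ∀ φ, 0 ≤ φ → ((if d < m then lowerAngle (P d - P b) else 0) ≤ φ ↔
      ∀ r < m, Precedes (P b) (P r) → lowerAngle (P r - P b) ≤ φ) := by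
    intro φ hφ
    rcases hd with ⟨rfl, h⟩ | ⟨h1, h2, h3⟩
    · simp only [lt_irrefl, if_false]
      exact ⟨fun _ r hr h' => absurd h' (h r hr), fun _ => hφ⟩
    · rw [if_pos h1]
      refine ⟨fun hu r hr h' => le_trans (lowerAngle_mono ?_ ?_) hu, fun h => h d h1 h2⟩
      · rwa [neg_sub]
      -- Reflection in the origin preserves cross products, so the factor `-1` swaps the two
      -- vectors.
      · have := h3 r hr h'
        simp only [crossBy, Complex.sub_re, Complex.sub_im, Complex.neg_re, Complex.neg_im] at this ⊢
        linarith
  ext φ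
  simp only [freeAngles, Set.mem_ofPred_eq, Set.mem_Icc]
  constructor
  · rintro ⟨h0, h1, h2, h3⟩
    exact ⟨(hL φ h0).mpr h3, (hU φ h1).mpr h2⟩
  · rintro ⟨h1, h2⟩
    have h0 : 0 ≤ φ := by
      refine le_trans ?_ h1
      split_ifs
      exacts [lowerAngle_nonneg _, le_rfl]
    have h0' : φ ≤ Real.pi / 2 := by
      refine le_trans h2 ?_
      split_ifs
      exacts [upperAngle_le _, le_rfl]
    exact ⟨h0, h0', (hU φ h0').mp h2, (hL φ h0).mp h1⟩

variable {M : ℕ} {s : State} {k : ℕ} {p : ℕ → ℂ} {m n : ℕ}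

/-- The intervals in the memory lie in `[0, 2π]` and have the union `V`. -/
def State.HasUnion (s : State) (V : Set ℝ) : Prop :=
  (∀ i < s.ivar 14, 0 ≤ s.rarr 8 i ∧ s.rarr 8 i ≤ s.rarr 9 i ∧ s.rarr 9 i ≤ 2 * Real.pi) ∧
    V = {x | ∃ i < s.ivar 14, s.rarr 8 i ≤ x ∧ x ≤ s.rarr 9 i}

theorem State.HasUnion.congr {s s' : State} {V : Set ℝ} (h : s.HasUnion V)
    (h14 : s'.ivar 14 = s.ivar 14) (h8 : s'.rarr 8 = s.rarr 8) (h9 : s'.rarr 9 = s.rarr 9) :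
    s'.HasUnion V := by
  unfold State.HasUnion
  rwa [h14, h8, h9]

theorem wp_storeShifted {V : Set ℝ} {j : ℕ} {lo hi : ℝ} (hpi : s.rvar 6 = Real.pi / 2)
    (hlo : s.rvar 3 = lo) (hhi : s.rvar 2 = hi) (h0 : 0 ≤ lo) (hle : lo ≤ hi)
    (h1 : hi ≤ Real.pi / 2) (hj : j < 4) (hV : s.HasUnion V) (hM : s.ivar 14 + 2 < M) :
    Wp M (storeShifted j) (fun s' k' => k' ≤ k + 30 ∧ s'.ivar 14 = s.ivar 14 + 1 ∧
      s'.HasUnion (V ∪ {θ | θ - (j : ℕ) * (Real.pi / 2) ∈ Set.Icc lo hi})) s k := by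
  obtain ⟨hb, rfl⟩ := hV
  have hpos := Real.pi_pos
  have hj' : (j : ℝ) ≤ 3 := by exact_mod_cast (by omega : j ≤ 3)
  have hj0 : (0 : ℝ) ≤ j := by positivity
  have hj1 : (0 : ℝ) ≤ j * (Real.pi / 2) := by positivity
  have hj2 : (j : ℝ) * (Real.pi / 2) ≤ 3 * (Real.pi / 2) := by gcongr
  simp only [storeShifted, wp_seq, wp_putR, wp_setI, IExp.Ok, IExp.eval, RExp.Ok, RExp.eval,
    State.HasUnion]
  simp [-Order.lt_add_one_iff, hpi, hlo, hhi]
  refine ⟨by omega, by omega, fun i hi => ?_, ?_⟩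
  · rcases Nat.lt_succ_iff_lt_or_eq.mp hi with hi | rfl
    · rw [Function.update_of_ne hi.ne, Function.update_of_ne hi.ne]; exact hb i hi
    · rw [Function.update_self, Function.update_self]
      exact ⟨by linarith, by linarith, by linarith⟩
  · ext x
    simp only [Set.mem_union, Set.mem_ofPred_eq]
    constructor
    · rintro (⟨i, hi, h⟩ | h)
      · exact ⟨i, by omega, by
          rwa [Function.update_of_ne hi.ne, Function.update_of_ne hi.ne]⟩
      · refine ⟨s.ivar 14, by omega, ?_⟩
        rw [Function.update_self, Function.update_self]
        exact ⟨by linarith [h.1], by linarith [h.2]⟩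
    · rintro ⟨i, hi, h⟩
      rcases Nat.lt_succ_iff_lt_or_eq.mp hi with hi | rfl
      · rw [Function.update_of_ne hi.ne, Function.update_of_ne hi.ne] at h
        exact Or.inl ⟨i, hi, h⟩
      · rw [Function.update_self, Function.update_self] at h
        exact Or.inr ⟨by linarith [h.1], by linarith [h.2]⟩

theorem wp_computeUpper {P : ℕ → ℂ} {b c : ℕ} (hpi : s.rvar 6 = Real.pi / 2) (hm : s.ivar 0 = m)
    (hb : s.ivar 4 = b) (hc : s.iarr 4 b = c) (hPb : s.point b = P b)
    (hPc : c < m → s.point c = P c) (hM : b < M) (hmM : m ≤ M) :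
    Wp M computeUpper (fun s' k' => k' ≤ k + 60 ∧
      s'.rvar 2 = if c < m then upperAngle (P c - P b) else Real.pi / 2) s k := by
  have hx : s.rarr 6 b = (P b).re := by rw [← hPb]; rfl
  have hy : s.rarr 7 b = (P b).im := by rw [← hPb]; rfl
  simp only [computeUpper, loadVector, wp_seq, wp_setI, wp_setR, wp_cond, IExp.Ok, IExp.eval,
    RExp.Ok, RExp.eval, BExp.Ok, BExp.eval]
  simp [hb, hc, hpi, hm, hM]
  refine ⟨fun h => ⟨by omega, fun h' => ?_, fun h' => ?_⟩, fun h h' => by omega⟩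
  all_goals
    have hx' : s.rarr 6 c = (P c).re := by rw [← hPc h]; rfl
    have hy' : s.rarr 7 c = (P c).im := by rw [← hPc h]; rfl
    simp only [hx, hy, hx', hy', upperAngle, Complex.sub_im, Complex.sub_re, sub_pos] at h' ⊢
  · rw [if_pos h, if_pos h']
    exact ⟨by linarith, by rw [neg_sub]⟩
  · intro _
    rw [if_neg (not_lt.mpr h')]

theorem wp_computeLower {P : ℕ → ℂ} {b d : ℕ} (hm : s.ivar 0 = m)
    (hb : s.ivar 4 = b) (hd : s.iarr 5 b = d) (hPb : s.point b = P b)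
    (hPd : d < m → s.point d = P d) (hM : b < M) (hmM : m ≤ M) :
    Wp M computeLower (fun s' k' => k' ≤ k + 60 ∧
      s'.rvar 3 = if d < m then lowerAngle (P d - P b) else 0) s k := by
  have hx : s.rarr 6 b = (P b).re := by rw [← hPb]; rfl
  have hy : s.rarr 7 b = (P b).im := by rw [← hPb]; rfl
  simp only [computeLower, loadVector, wp_seq, wp_setI, wp_setR, wp_cond, IExp.Ok, IExp.eval,
    RExp.Ok, RExp.eval, BExp.Ok, BExp.eval]
  simp [hb, hd, hm, hM]
  refine ⟨fun h => ⟨by omega, fun h' h'' => ?_, fun h' => ?_⟩, fun h h' => by omega⟩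
  all_goals
    have hx' : s.rarr 6 d = (P d).re := by rw [← hPd h]; rfl
    have hy' : s.rarr 7 d = (P d).im := by rw [← hPd h]; rfl
    simp only [hx, hy, hx', hy', lowerAngle, Complex.sub_im, Complex.sub_re, sub_pos] at h' ⊢
  · simp only [hy, hy'] at h''
    rw [if_pos h, if_pos ⟨h', h''⟩]
    exact ⟨by linarith, rfl⟩
  · intro _
    rw [if_neg fun h'' => not_lt.mpr (h' h''.1) h''.2]

end Intervals

/-! ### The four frames and the whole program. -/

section Main

open ComplexConjugate

variable {M : ℕ} {s : State} {k : ℕ} {p : ℕ → ℂ} {m n : ℕ}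

theorem wp_storeIntervals {P : ℕ → ℂ} {V : Set ℝ} {c : ℕ} (h : HasInput s p m n)
    (hP : ∀ i < n, s.point i = P i)
    (hu : ∀ b, m ≤ b → b < n → IsExtremeIndex 1 P m b (s.iarr 4 b))
    (hl : ∀ b, m ≤ b → b < n → IsExtremeIndex (-1) (fun i => - P i) m b (s.iarr 5 b))
    (hV : s.HasUnion V) (hc : s.ivar 14 = c) (hM : c + 4 * n + 8 < M) :
    Wp M storeIntervals (fun s' k' => k' ≤ k + 300 * n + 20 ∧ s'.ivar 14 ≤ c + 4 * n ∧
      s'.HasUnion (V ∪ {θ | ∃ b, m ≤ b ∧ b < n ∧ ∃ j < 4,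
        θ - (j : ℕ) * (Real.pi / 2) ∈ freeAngles P m b})) s k := by
  have hmn : m ≤ n := h.blue ▸ Nat.le_add_right _ _
  simp only [storeIntervals, wp_seq, wp_setI, IExp.Ok, IExp.eval, true_and]
  refine Wp.loop (fun s' k' => m ≤ s'.ivar 4 ∧ s'.ivar 4 ≤ n ∧
    k' + 300 * m ≤ k + 300 * s'.ivar 4 + 10 ∧ s'.ivar 14 + 4 * m ≤ c + 4 * s'.ivar 4 ∧
    s'.HasUnion (V ∪ {θ | ∃ b, m ≤ b ∧ b < s'.ivar 4 ∧ ∃ j < 4,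
        θ - (j : ℕ) * (Real.pi / 2) ∈ freeAngles P m b})) (fun s' => n - s'.ivar 4) ?_ ?_
  · refine ⟨by simp [h.red], by simp [h.red, hmn], by simp [h.red]; omega, by simp [h.red, hc], ?_⟩
    have : {θ : ℝ | ∃ b, m ≤ b ∧ b < s.ivar 0 ∧ ∃ j < 4,
        θ - (j : ℕ) * (Real.pi / 2) ∈ freeAngles P m b} = ∅ := by
      ext θ
      simp only [Set.mem_ofPred_eq, Set.mem_empty_iff_false, iff_false]
      rintro ⟨b, hb, hb', -⟩
      rw [h.red] at hb'
      omega
    simp only [State.setI_ivar, if_true, this, Set.union_empty]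
    exact hV
  rintro s' k' hF ⟨h1, h2, hk', hc', hV'⟩
  have h' : HasInput s' p m n := HasInput.frame (s := s.setI 4 (s.ivar 0)) ⟨by simpa using h.red,
    by simpa using h.blue, by simpa using h.total, h.rightAngle, h.redPoint, h.bluePoint⟩ hF rfl
  have e4 : s'.iarr 4 = s.iarr 4 := hF.iarr 4 rfl
  have e5 : s'.iarr 5 = s.iarr 5 := hF.iarr 5 rfl
  have hpt : s'.point = s.point := point_eq_of_rarr (hF.rarr 6 rfl) (hF.rarr 7 rfl)
  refine ⟨by simp, fun hb => ?_, fun hb => ?_⟩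
  · simp only [BExp.eval, IExp.eval, h'.total] at hb
    simp only [wp_seq, BExp.cost, IExp.cost]
    generalize hbe : s'.ivar 4 = b at *
    have hfree := freeAngles_eq_Icc (hu b h1 hb) (hl b h1 hb)
    refine (wp_computeUpper (s := s') (P := P) h'.rightAngle h'.red hbe (congrFun e4 b)
      (by rw [hpt, hP b hb]) (fun hc => by rw [hpt, hP _ (by omega)]) (by omega)
      (by omega)).frame.mono ?_
    rintro s₁ k₁ ⟨⟨hk₁, hu₁⟩, hF₁⟩
    have hI₁ := h'.frame hF₁ rfl
    have hpt₁ : s₁.point = s.point :=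
      (point_eq_of_rarr (hF₁.rarr 6 rfl) (hF₁.rarr 7 rfl)).trans hpt
    refine (wp_computeLower (s := s₁) (P := P) hI₁.red ((hF₁.ivar 4 rfl).trans hbe)
      (congrFun ((hF₁.iarr 5 rfl).trans e5) b) (by rw [hpt₁, hP b hb])
      (fun hc => by rw [hpt₁, hP _ (by omega)]) (by omega) (by omega)).frame.mono ?_
    rintro s₂ k₂ ⟨⟨hk₂, hl₂⟩, hF₂⟩
    have hI₂ := hI₁.frame hF₂ rfl
    have hu₂ := (hF₂.rvar 2 rfl).trans hu₁
    have e14 : s₂.ivar 14 = s'.ivar 14 := (hF₂.ivar 14 rfl).trans (hF₁.ivar 14 rfl)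
    have e4₂ : s₂.ivar 4 = b := ((hF₂.ivar 4 rfl).trans (hF₁.ivar 4 rfl)).trans hbe
    have hV₂ := hV'.congr e14 ((hF₂.rarr 8 rfl).trans (hF₁.rarr 8 rfl))
      ((hF₂.rarr 9 rfl).trans (hF₁.rarr 9 rfl))
    rw [← hl₂, ← hu₂] at hfree
    have hlo : 0 ≤ s₂.rvar 3 := by
      rw [hl₂]; split_ifs
      exacts [lowerAngle_nonneg _, le_rfl]
    have hhi : s₂.rvar 2 ≤ Real.pi / 2 := by
      rw [hu₂]; split_ifs
      exacts [upperAngle_le _, le_rfl]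
    clear hl₂ hu₂ hu₁
    -- The increment is treated once for both branches: an empty interval is skipped, a nonempty one
    -- is stored with its four shifts.
    have hstep : ∀ s₃ k₃, s₃.ivar 4 = b → s₃.ivar 14 ≤ s'.ivar 14 + 4 → k₃ ≤ k' + 280 →
        s₃.HasUnion (V ∪ {θ | ∃ b', m ≤ b' ∧ b' < b ∧ ∃ j < 4,
          θ - (j : ℕ) * (Real.pi / 2) ∈ freeAngles P m b'} ∪
          {θ | ∃ j < 4, θ - (j : ℕ) * (Real.pi / 2) ∈ freeAngles P m b}) →
        Wp M (.setI 4 (.plus (.var 4) (.lit 1))) (fun s'' k'' => (m ≤ s''.ivar 4 ∧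
          s''.ivar 4 ≤ n ∧ k'' + 300 * m ≤ k + 300 * s''.ivar 4 + 10 ∧
          s''.ivar 14 + 4 * m ≤ c + 4 * s''.ivar 4 ∧
          s''.HasUnion (V ∪ {θ | ∃ b', m ≤ b' ∧ b' < s''.ivar 4 ∧ ∃ j < 4,
            θ - (j : ℕ) * (Real.pi / 2) ∈ freeAngles P m b'})) ∧
          n - s''.ivar 4 < n - b) s₃ k₃ := by
      intro s₃ k₃ h4 h14 hk₃ hV₃
      have hset : V ∪ {θ | ∃ b', m ≤ b' ∧ b' < b + 1 ∧ ∃ j < 4,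
          θ - (j : ℕ) * (Real.pi / 2) ∈ freeAngles P m b'} =
          V ∪ {θ | ∃ b', m ≤ b' ∧ b' < b ∧ ∃ j < 4,
          θ - (j : ℕ) * (Real.pi / 2) ∈ freeAngles P m b'} ∪
          {θ | ∃ j < 4, θ - (j : ℕ) * (Real.pi / 2) ∈ freeAngles P m b} := by
        rw [Set.union_assoc]
        congr 1
        ext θ
        simp only [Set.mem_union, Set.mem_ofPred_eq]
        constructor
        · rintro ⟨b', hm', hb', hj⟩
          rcases Nat.lt_succ_iff_lt_or_eq.mp hb' with hb' | rfl
          · exact Or.inl ⟨b', hm', hb', hj⟩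
          · exact Or.inr hj
        · rintro (⟨b', hm', hb', hj⟩ | hj)
          · exact ⟨b', hm', by omega, hj⟩
          · exact ⟨b, h1, by omega, hj⟩
      rw [← hset] at hV₃
      simp only [wp_setI, IExp.Ok, IExp.eval, IExp.cost, State.setI_ivar, if_true, h4, true_and]
      refine ⟨by omega, ⟨by omega, by omega, by omega, ?_, ?_⟩, by omega⟩
      · simp; omega
      · exact hV₃.congr (by simp) rfl rfl
    rw [wp_cond]
    refine ⟨by simp, fun hlt => ?_, fun hlt => ?_⟩
    · simp only [BExp.eval, RExp.eval] at hlt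
      rw [wp_skip]
      simp only [BExp.cost, RExp.cost]
      refine hstep s₂ _ e4₂ (by omega) (by omega) ?_
      rw [hfree, Set.Icc_eq_empty (not_le.mpr hlt)]
      simpa using hV₂
    · simp only [BExp.eval, RExp.eval, not_lt] at hlt
      simp only [wp_seq, BExp.cost, RExp.cost]
      refine (wp_storeShifted (j := 0) hI₂.rightAngle rfl rfl hlo hlt hhi (by omega) hV₂
        (by omega)).frame.mono ?_
      rintro t₀ k₀ ⟨⟨hk₀, hc₀, hV₀⟩, hG₀⟩
      have lo₀ : t₀.rvar 3 = s₂.rvar 3 := hG₀.rvar 3 rfl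
      have hi₀ : t₀.rvar 2 = s₂.rvar 2 := hG₀.rvar 2 rfl
      have hJ₀ := hI₂.frame hG₀ rfl
      refine (wp_storeShifted (j := 1) hJ₀.rightAngle lo₀ hi₀ hlo hlt hhi (by omega) hV₀
        (by omega)).frame.mono ?_
      rintro t₁ k₁' ⟨⟨hk₁', hc₁, hV₁⟩, hG₁⟩
      have lo₁ : t₁.rvar 3 = s₂.rvar 3 := (hG₁.rvar 3 rfl).trans lo₀
      have hi₁ : t₁.rvar 2 = s₂.rvar 2 := (hG₁.rvar 2 rfl).trans hi₀
      have hJ₁ := hJ₀.frame hG₁ rfl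
      refine (wp_storeShifted (j := 2) hJ₁.rightAngle lo₁ hi₁ hlo hlt hhi (by omega) hV₁
        (by omega)).frame.mono ?_
      rintro t₂ k₂' ⟨⟨hk₂', hc₂, hV₂'⟩, hG₂⟩
      have lo₂ : t₂.rvar 3 = s₂.rvar 3 := (hG₂.rvar 3 rfl).trans lo₁
      have hi₂ : t₂.rvar 2 = s₂.rvar 2 := (hG₂.rvar 2 rfl).trans hi₁
      have hJ₂ := hJ₁.frame hG₂ rfl
      refine (wp_storeShifted (j := 3) hJ₂.rightAngle lo₂ hi₂ hlo hlt hhi (by omega) hV₂'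
        (by omega)).frame.mono ?_
      rintro t₃ k₃ ⟨⟨hk₃, hc₃, hV₃⟩, hG₃⟩
      refine hstep t₃ k₃ ?_ (by omega) (by omega) ?_
      · rw [hG₃.ivar 4 rfl, hG₂.ivar 4 rfl, hG₁.ivar 4 rfl, hG₀.ivar 4 rfl, e4₂]
      · convert hV₃ using 1
        simp only [Set.union_assoc]
        congr 2
        rw [hfree]
        ext θ
        simp only [Set.mem_union, Set.mem_ofPred_eq]
        constructor
        · rintro ⟨j, hj, h⟩
          interval_cases j
          exacts [Or.inl h, Or.inr (Or.inl h), Or.inr (Or.inr (Or.inl h)),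
            Or.inr (Or.inr (Or.inr h))]
        · rintro (h | h | h | h)
          exacts [⟨0, by omega, h⟩, ⟨1, by omega, h⟩, ⟨2, by omega, h⟩, ⟨3, by omega, h⟩]
  · simp only [BExp.eval, IExp.eval, h'.total] at hb
    have e : s'.ivar 4 = n := by omega
    rw [e] at hV' hc' hk'
    exact ⟨by simp only [BExp.cost, IExp.cost]; omega, by omega, hV'⟩

theorem blockedAngles_zero (u : ℂ) (p : ℕ → ℂ) (m n : ℕ) : blockedAngles u p m n 0 = ∅ := by
  ext θ; simp [blockedAngles]

theorem blockedAngles_succ (u : ℂ) (p : ℕ → ℂ) (m n K : ℕ) :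
    blockedAngles u p m n (K + 1) = blockedAngles u p m n K ∪ {θ | ∃ b, m ≤ b ∧ b < n ∧ ∃ j < 4,
      θ - (j : ℕ) * (Real.pi / 2) ∈ freeAngles (framePoints u p K) m b} := by
  ext θ
  simp only [blockedAngles, Set.mem_union, Set.mem_ofPred_eq]
  constructor
  · rintro ⟨k, hk, h⟩
    rcases Nat.lt_succ_iff_lt_or_eq.mp hk with hk | rfl
    · exact Or.inl ⟨k, hk, h⟩
    · exact Or.inr h
  · rintro (⟨k, hk, h⟩ | h)
    · exact ⟨k, by omega, h⟩
    · exact ⟨K, by omega, h⟩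

/-- After `K` frames have been processed, the memory holds the intervals of angles that are blocked
in these frames, and the direction of the next frame. -/
structure FramesDone (s : State) (u : ℂ) (p : ℕ → ℂ) (m n K : ℕ) : Prop where
  input : HasInput s p m n
  re : s.rvar 0 = (u * Complex.I ^ K).re
  im : s.rvar 1 = (u * Complex.I ^ K).im
  count : s.ivar 14 ≤ 4 * n * K
  union : s.HasUnion (blockedAngles u p m n K)

theorem wp_negateFrame : Wp M negateFrame (fun s' k' => k' ≤ k + 10 ∧ s'.rvar 0 = -s.rvar 0 ∧
    s'.rvar 1 = -s.rvar 1) s k := by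
  simp [negateFrame]

/-- The reversed frame comes first, so that real arrays 6 and 7 hold the unreversed coordinates when
the intervals are computed; the indices found in the reversed frame stay valid in index array 5. -/
theorem wp_processFrame {u : ℂ} {K : ℕ} (f : ℕ) (h : FramesDone s u p m n K) (hu : u ≠ 0)
    (hinj : ∀ i < n, ∀ j < n, p i = p j → i = j) (hM : 4 * n * (K + 1) + 8 < M)
    (hM' : 2 * n + 2 < M) (hf : 2 * n ≤ 2 ^ f) :
    Wp M processFrame (fun s' k' => k' ≤ k + n * (300 * f + 900) + 400 ∧
      FramesDone s' u p m n (K + 1)) s k := by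
  obtain ⟨hI, h0, h1, hc, hV⟩ := h
  set w := u * Complex.I ^ K with hw
  have hw0 : w ≠ 0 := mul_ne_zero hu (pow_ne_zero _ Complex.I_ne_zero)
  simp only [processFrame, wp_seq]
  refine wp_negateFrame.frame.mono ?_
  rintro t₁ l₁ ⟨⟨hl₁, h0t, h1t⟩, hG₁⟩
  refine (wp_findExtreme (w := -w) f (Or.inr rfl) (hI.frame hG₁ rfl)
    (by simp [h0t, h0]) (by simp [h1t, h1]) (neg_ne_zero.mpr hw0) hinj hM' hf).frame.mono ?_
  rintro s₁ k₁ ⟨⟨hk₁, -, hx₁⟩, hF₁⟩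
  have hI₁ := (hI.frame hG₁ rfl).frame hF₁ rfl
  have h0₁ : s₁.rvar 0 = -w.re := by rw [hF₁.rvar 0 rfl, h0t, h0]
  have h1₁ : s₁.rvar 1 = -w.im := by rw [hF₁.rvar 1 rfl, h1t, h1]
  refine wp_negateFrame.frame.mono ?_
  rintro t₂ l₂ ⟨⟨hl₂, h0t₂, h1t₂⟩, hG₂⟩
  have h0t₂ : t₂.rvar 0 = w.re := by rw [h0t₂, h0₁, neg_neg]
  have h1t₂ : t₂.rvar 1 = w.im := by rw [h1t₂, h1₁, neg_neg]
  refine (wp_findExtreme (w := w) f (Or.inl rfl) (hI₁.frame hG₂ rfl) h0t₂ h1t₂ hw0 hinj hM'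
    hf).frame.mono ?_
  rintro s₂ k₂ ⟨⟨hk₂, hp₂, hx₂⟩, hF₂⟩
  have hI₂ := (hI₁.frame hG₂ rfl).frame hF₂ rfl
  have h0₂ : s₂.rvar 0 = w.re := (hF₂.rvar 0 rfl).trans h0t₂
  have h1₂ : s₂.rvar 1 = w.im := (hF₂.rvar 1 rfl).trans h1t₂
  have e14 : s₂.ivar 14 = s.ivar 14 := by
    rw [hF₂.ivar 14 rfl, hG₂.ivar 14 rfl, hF₁.ivar 14 rfl, hG₁.ivar 14 rfl]
  have e8 : s₂.rarr 8 = s.rarr 8 := by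
    rw [hF₂.rarr 8 rfl, hG₂.rarr 8 rfl, hF₁.rarr 8 rfl, hG₁.rarr 8 rfl]
  have e9 : s₂.rarr 9 = s.rarr 9 := by
    rw [hF₂.rarr 9 rfl, hG₂.rarr 9 rfl, hF₁.rarr 9 rfl, hG₁.rarr 9 rfl]
  have hV₂ := hV.congr e14 e8 e9
  have e5 : s₂.iarr 5 = s₁.iarr 5 := (hF₂.iarr 5 rfl).trans (hG₂.iarr 5 rfl)
  have hmul : 4 * n * (K + 1) = 4 * n * K + 4 * n := by ring
  refine (wp_storeIntervals (P := framePoints u p K) hI₂ hp₂ ?_ ?_ hV₂ e14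
    (by omega)).frame.mono ?_
  · intro b hmb hb
    have := hx₂ b hmb hb
    rwa [Rat.cast_one] at this
  · intro b hmb hb
    have := hx₁ b hmb hb
    simp only [map_neg, mul_neg, Rat.cast_neg, Rat.cast_one] at this
    rw [e5]
    exact this
  · rintro s₃ k₃ ⟨⟨hk₃, hc₃, hV₃⟩, hF₃⟩
    have hI₃ := hI₂.frame hF₃ rfl
    have h0₃ : s₃.rvar 0 = w.re := (hF₃.rvar 0 rfl).trans h0₂
    have h1₃ : s₃.rvar 1 = w.im := (hF₃.rvar 1 rfl).trans h1₂
    simp only [turnFrame, wp_seq, wp_setR, RExp.Ok, RExp.eval, true_and, RExp.cost]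
    have htime : n * (300 * f + 900) = n * (150 * f + 300) + n * (150 * f + 300) + 300 * n := by
      ring
    refine ⟨by omega, ⟨hI₃.red, hI₃.blue, hI₃.total, by simpa using hI₃.rightAngle, hI₃.redPoint,
      hI₃.bluePoint⟩, ?_, ?_, ?_, ?_⟩
    · rw [pow_succ, ← mul_assoc, ← hw]; simp [h1₃]
    · rw [pow_succ, ← mul_assoc, ← hw]; simp [h0₃]
    · simp only [State.setR_ivar]; omega
    · rw [blockedAngles_succ]
      exact hV₃.congr rfl rfl rfl

/-- The program that lists the intervals of angles of strict containment of rectilinear convex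
hulls. For each of the four frames and each blue point, the extreme red points to the left and to
the right bound the interval of angles at which a quadrant at the blue point contains no red point;
the answer consists of the gaps between these intervals. -/
def hullContainment : Stmt :=
  .setI 13 (.plus (.var 0) (.var 1)) ;; .setR 6 (.times (.lit 2) (.arctan (.lit 1))) ;;
  processFrame ;; processFrame ;; processFrame ;; processFrame ;;
  .setI 3 (.var 14) ;; sortProg 8 9 ;; scan

/-- The points in the order of the input. -/
def inputPoint (rs bs : List ℂ) (i : ℕ) : ℂ :=
  if i < rs.length then rs.getD i 0 else bs.getD (i - rs.length) 0

theorem mem_red_iff {rs : List ℂ} (bs : List ℂ) {R : Finset ℂ} (hR : Enumerates rs R) (z : ℂ) :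
    z ∈ R ↔ ∃ i < rs.length, inputPoint rs bs i = z := by
  rw [← hR.2, List.mem_iff_getElem]
  constructor
  · rintro ⟨i, hi, rfl⟩
    exact ⟨i, hi, by simp [inputPoint, hi]⟩
  · rintro ⟨i, hi, rfl⟩
    exact ⟨i, hi, by simp [inputPoint, hi]⟩

theorem mem_blue_iff (rs : List ℂ) {bs : List ℂ} {B : Finset ℂ} (hB : Enumerates bs B) (z : ℂ) :
    z ∈ B ↔ ∃ i, rs.length ≤ i ∧ i < rs.length + bs.length ∧ inputPoint rs bs i = z := by
  rw [← hB.2, List.mem_iff_getElem]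
  constructor
  · rintro ⟨i, hi, rfl⟩
    exact ⟨rs.length + i, by omega, by omega, by simp [inputPoint, hi]⟩
  · rintro ⟨i, hi, hi', rfl⟩
    have hlt : i - rs.length < bs.length := by omega
    exact ⟨i - rs.length, hlt, by simp [inputPoint, hlt, not_lt.mpr hi]⟩

theorem inputPoint_injective {rs bs : List ℂ} {R B : Finset ℂ} (hR : Enumerates rs R)
    (hB : Enumerates bs B) (hd : Disjoint R B) : ∀ i < rs.length + bs.length,
    ∀ j < rs.length + bs.length, inputPoint rs bs i = inputPoint rs bs j → i = j := by
  have hne : ∀ i < rs.length, ∀ j, rs.length ≤ j → j < rs.length + bs.length →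
      inputPoint rs bs i ≠ inputPoint rs bs j := fun i hi j hj hj' h =>
    Finset.disjoint_left.mp hd ((mem_red_iff bs hR _).mpr ⟨i, hi, rfl⟩)
      ((mem_blue_iff rs hB _).mpr ⟨j, hj, hj', h.symm⟩)
  intro i hi j hj h
  rcases Nat.lt_or_ge i rs.length with hi' | hi' <;> rcases Nat.lt_or_ge j rs.length with hj' | hj'
  · simp only [inputPoint, hi', hj', if_true, List.getD_eq_getElem] at h
    exact (hR.1.getElem_inj_iff).mp h
  · exact absurd h (hne i hi' j hj' hj)
  · exact absurd h.symm (hne j hj' i hi' hi)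
  · have h1 : i - rs.length < bs.length := by omega
    have h2 : j - rs.length < bs.length := by omega
    simp only [inputPoint, not_lt.mpr hi', not_lt.mpr hj', if_false, h1, h2,
      List.getD_eq_getElem] at h
    have := (hB.1.getElem_inj_iff).mp h
    omega

theorem wp_hullContainment {u : ℂ} {R B : Finset ℂ} {rs bs : List ℂ} (f : ℕ) (hu : u ≠ 0)
    (hd : Disjoint R B) (hR : Enumerates rs R) (hB : Enumerates bs B)
    (hn : rs.length + bs.length = n) (hM : 50 * n + 50 < M) (hf : 2 * n ≤ 2 ^ f) :
    Wp M hullContainment (fun s' k' => k' ≤ n * (3000 * f + 20000) + 3000 ∧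
      ReportsIntervals s' (containmentAngles u (R : Set ℂ) (B : Set ℂ)))
      (inputState u rs bs) 0 := by
  set p := inputPoint rs bs with hp
  have hinj : ∀ i < n, ∀ j < n, p i = p j → i = j := hn ▸ inputPoint_injective hR hB hd
  have harctan : (2 : ℝ) * Real.arctan 1 = Real.pi / 2 := by rw [Real.arctan_one]; ring
  simp only [hullContainment, wp_seq, wp_setI, wp_setR, IExp.Ok, IExp.eval, RExp.Ok, RExp.eval,
    true_and, RExp.cost, IExp.cost, Rat.cast_ofNat, Rat.cast_one, harctan]
  have e0 : (inputState u rs bs).ivar 0 = rs.length := rfl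
  have e1 : (inputState u rs bs).ivar 1 = bs.length := rfl
  rw [e0, e1]
  refine ⟨by omega, ?_⟩
  have hstart : FramesDone (((inputState u rs bs).setI 13 (rs.length + bs.length)).setR 6
      (Real.pi / 2)) u p rs.length n 0 := by
    refine ⟨⟨by simp [e0], by simp [e1, hn], by simp [hn], by simp, fun i hi => ?_,
      fun i hi => ?_⟩, ?_, ?_, ?_, ?_⟩
    · simp [inputState, hp, inputPoint, hi]
    · simp [inputState, hp, inputPoint]
    · simp [inputState]
    · simp [inputState]
    · simp [inputState]
    · rw [blockedAngles_zero]
      simp [State.HasUnion, inputState]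
  refine (wp_processFrame f hstart hu hinj (by omega) (by omega) hf).mono ?_
  rintro s₁ k₁ ⟨hk₁, h₁⟩
  refine (wp_processFrame f h₁ hu hinj (by omega) (by omega) hf).mono ?_
  rintro s₂ k₂ ⟨hk₂, h₂⟩
  refine (wp_processFrame f h₂ hu hinj (by omega) (by omega) hf).mono ?_
  rintro s₃ k₃ ⟨hk₃, h₃⟩
  refine (wp_processFrame f h₃ hu hinj (by omega) (by omega) hf).mono ?_
  rintro s₄ k₄ ⟨hk₄, h₄⟩
  have hN := h₄.count
  set N := s₄.ivar 14 with hNdef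
  -- There are at most `16 n` intervals, hence four more levels in the tournament.
  have hf' : 2 * N ≤ 2 ^ (f + 4) := by rw [pow_add]; omega
  refine (wp_sortProg (N := N) (f + 4) (by simp) (by omega) hf').frame.mono ?_
  rintro s₅ k₅ ⟨⟨hk₅, hs₅⟩, hF₅⟩
  have e8 : s₅.rarr 8 = s₄.rarr 8 := hF₅.rarr 8 rfl
  have e9 : s₅.rarr 9 = s₄.rarr 9 := hF₅.rarr 9 rfl
  obtain ⟨hint, hU⟩ := h₄.union
  refine (wp_scan (M := M) (s := s₅) (N := N) (Y := s₄.rarr 9) (o := s₅.iarr 2) ?_ ?_ rfl ?_ ?_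
    (by omega)).mono ?_
  · rw [hF₅.ivar 14 rfl]; simp [hNdef]
  · rw [hF₅.rvar 6 rfl]; exact h₄.input.rightAngle
  · rw [e8]; exact hs₅
  · rw [e8, e9]; exact hint
  · rintro s₆ k₆ ⟨hk₆, hr⟩
    rw [e8, e9, ← hU] at hr
    constructor
    · have hmul : N * (70 * (f + 4) + 160) ≤ 16 * n * (70 * (f + 4) + 160) :=
        Nat.mul_le_mul_right _ (by omega)
      have e1 : 16 * n * (70 * (f + 4) + 160) = 1120 * (n * f) + 7040 * n := by ring
      have e2 : n * (300 * f + 900) = 300 * (n * f) + 900 * n := by ring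
      have e3 : n * (3000 * f + 20000) = 3000 * (n * f) + 20000 * n := by ring
      rw [e2] at hk₁ hk₂ hk₃ hk₄
      rw [e3]
      omega
    · rwa [containmentAngles_eq hu (mem_red_iff bs hR) (hn ▸ mem_blue_iff rs hB)]

end Main

end RealRAM

theorem Enumerates.length_eq {l : List ℂ} {P : Finset ℂ} (h : Enumerates l P) :
    l.length = P.card := by
  classical
  rw [← List.toFinset_card_of_nodup h.1]
  congr 1
  ext z
  simp [h.2]

theorem mainTheorem4 :
    ∃ (prog : RealRAM.Stmt) (C : ℕ),
      ∀ (u : ℂ) (R B : Finset ℂ) (rs bs : List ℂ),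
        u ≠ 0 → Disjoint R B → NoThreeCollinear ((R : Set ℂ) ∪ (B : Set ℂ)) →
        Enumerates rs R → Enumerates bs B →
        ∃ (s : RealRAM.State) (t : ℕ),
          RealRAM.Exec (C * (R.card + B.card + 1)) prog (inputState u rs bs) s t ∧
          t ≤ C * ((R.card + B.card) * Nat.log 2 (R.card + B.card) + 1) ∧
          ReportsIntervals s (containmentAngles u (R : Set ℂ) (B : Set ℂ)) := by
  refine ⟨RealRAM.hullContainment, 100000, fun u R B rs bs hu hd _ hR hB => ?_⟩
  have hn : rs.length + bs.length = R.card + B.card := by rw [hR.length_eq, hB.length_eq]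
  generalize R.card + B.card = n at *
  have hf : 2 * n ≤ 2 ^ (Nat.log 2 n + 2) := by
    have := Nat.lt_pow_succ_log_self (b := 2) (by norm_num) n
    rw [show Nat.log 2 n + 2 = (Nat.log 2 n + 1) + 1 by ring, pow_succ]
    omega
  obtain ⟨s, t, he, ht, hr⟩ := RealRAM.wp_hullContainment (M := 100000 * (n + 1)) _ hu hd hR hB hn
    (by omega) hf
  refine ⟨s, t, he, ?_, hr⟩
  -- For `n ≥ 2` the logarithm is at least `1`, and otherwise the constant suffices, so the linear
  -- terms are absorbed.
  have hlin : n ≤ n * Nat.log 2 n + 1 := by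
    rcases Nat.lt_or_ge n 2 with h | h
    · omega
    · have := Nat.mul_le_mul_left n (Nat.log_pos (b := 2) (by norm_num) h)
      omega
  have e : n * (3000 * (Nat.log 2 n + 2) + 20000) = 3000 * (n * Nat.log 2 n) + 26000 * n := by ring
  omega
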